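/- **Conventions.** An instance consists of a connected graph $G$ on $n\ge 2$ vertices with positive real edge weights $w:E(G)\to(0,\infty)$, a cycle $C$ on $N\ge 3$ vertices $0,\dots,N-1$ (unweighted), and a positive integer $d$. Put $M=\max_{e\in E(G)}w(e)$. Let $D_G(u,v)$ be the minimum total weight of a path from $u$ to $v$ in $G$ and $D_C$ the usual graph distance of $C$. A *non-contracting distortion-$d$ embedding* of $G$ into $C$ is a map $F:V(G)\to V(C)$ with $$D_G(u,v)\;\le\; D_C(F(u),F(v))\;\le\; d\cdot D_G(u,v)\qquad\text{for all }u,v\in V(G).$$ Algorithms are programs for a unit-cost random access machine with natural-number and exact real registers and arrays, whose elementary operations are literals, copying, addition, subtraction, comparison and indirect addressing (no multiplication, division or rounding); an instance is given by $n$, $N$, $d$ and the weighted adjacency matrix of $G$. **Theorem.** There are an algorithm and an absolute constant $K$ such that, for every instance with $M\ge 1$, the algorithm either outputs a non-contracting distortion-$d$ embedding of $G$ into $C$ or correctly reports that none exists, and it halts after at most $$K\cdot n^{3}\,(dM)^{2dM+3}\,\bigl(4dM(2dM+2)\bigr)^{4dM+4}$$ steps. Moreover, the problem of deciding whether an instance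 has a non-contracting distortion-$d$ embedding of $G$ into $C$ is fixed-parameter tractable in $(d,M)$: there are an algorithm deciding it on all instances, a computable function $f:\mathbb N^2\to\mathbb N$ and a constant $c\in\mathbb N$ such that it halts after at most $f(d,\lceil M\rceil)\cdot n^{c}$ steps. -/

import Mathlib

/-! ### A unit-cost random access machine with exact real arithmetic

Programs are finite structured programs.  A machine has natural-number registers and
natural-number arrays, and real registers and real arrays (arrays are unbounded and indexed by
natural numbers).  The operations are literals, copying, addition, subtraction, comparison and
indirect addressing, each at cost `1`.  There is no multiplication, division, rounding or
conversion between the two sorts. On integer inputs all real registers keep integer values, so that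
the machine is then the usual (Cook-Reckhow) random access machine. -/

namespace RealRAM

/-- A memory configuration. -/
structure State where
  /-- natural-number registers -/
  reg : ℕ → ℕ
  /-- natural-number arrays: `arr a i` is the `i`-th cell of array `a` -/
  arr : ℕ → ℕ → ℕ
  /-- real registers -/
  rreg : ℕ → ℝ
  /-- real arrays -/
  rarr : ℕ → ℕ → ℝ

/-- Natural-number expressions; `sub` is truncated subtraction, `read a e` is cell `e` of array
`a`. -/
inductive NExpr where
  | lit (k : ℕ)
  | reg (x : ℕ)
  | read (a : ℕ) (e : NExpr)
  | add (e f : NExpr)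
  | sub (e f : NExpr)

/-- Value of a natural-number expression. -/
def NExpr.val (s : State) : NExpr → ℕ
  | .lit k => k
  | .reg x => s.reg x
  | .read a e => s.arr a (e.val s)
  | .add e f => e.val s + f.val s
  | .sub e f => e.val s - f.val s

/-- Number of elementary operations in a natural-number expression. -/
def NExpr.cost : NExpr → ℕ
  | .lit _ => 1
  | .reg _ => 1
  | .read _ e => e.cost + 1
  | .add e f => e.cost + f.cost + 1
  | .sub e f => e.cost + f.cost + 1

/-- Real expressions. -/
inductive RExpr where
  | lit (k : ℕ)
  | reg (x : ℕ)
  | read (a : ℕ) (e : NExpr)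
  | add (e f : RExpr)
  | sub (e f : RExpr)

/-- Value of a real expression. -/
noncomputable def RExpr.val (s : State) : RExpr → ℝ
  | .lit k => (k : ℝ)
  | .reg x => s.rreg x
  | .read a e => s.rarr a (e.val s)
  | .add e f => e.val s + f.val s
  | .sub e f => e.val s - f.val s

/-- Number of elementary operations in a real expression. -/
def RExpr.cost : RExpr → ℕ
  | .lit _ => 1
  | .reg _ => 1
  | .read _ e => e.cost + 1
  | .add e f => e.cost + f.cost + 1
  | .sub e f => e.cost + f.cost + 1

/-- Tests: comparisons of natural numbers, comparisons of reals, and Boolean combinations. -/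
inductive Test where
  | lt (e f : NExpr)
  | rlt (e f : RExpr)
  | neg (b : Test)
  | conj (b c : Test)

/-- Truth of a test. -/
def Test.holds (s : State) : Test → Prop
  | .lt e f => e.val s < f.val s
  | .rlt e f => e.val s < f.val s
  | .neg b => ¬ b.holds s
  | .conj b c => b.holds s ∧ c.holds s

/-- Number of elementary operations in a test. -/
def Test.cost : Test → ℕ
  | .lt e f => e.cost + f.cost + 1
  | .rlt e f => e.cost + f.cost + 1
  | .neg b => b.cost + 1
  | .conj b c => b.cost + c.cost + 1

/-- Programs. -/
inductive Prog where
  | skip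
  | set (x : ℕ) (e : NExpr)
  | rset (x : ℕ) (e : RExpr)
  | write (a : ℕ) (i e : NExpr)
  | rwrite (a : ℕ) (i : NExpr) (e : RExpr)
  | seq (p q : Prog)
  | ite (b : Test) (p q : Prog)
  | loop (b : Test) (p : Prog)

/-- `Exec p s t s'`: the program `p`, started in `s`, halts in `s'` after `t` elementary steps.
(`loop b p` repeats `p` as long as `b` holds.) -/
inductive Exec : Prog → State → ℕ → State → Prop
  | skip (s : State) : Exec .skip s 1 s
  | set (s : State) (x : ℕ) (e : NExpr) :
      Exec (.set x e) s (e.cost + 1) { s with reg := Function.update s.reg x (e.val s) }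
  | rset (s : State) (x : ℕ) (e : RExpr) :
      Exec (.rset x e) s (e.cost + 1) { s with rreg := Function.update s.rreg x (e.val s) }
  | write (s : State) (a : ℕ) (i e : NExpr) :
      Exec (.write a i e) s (i.cost + e.cost + 1)
        { s with arr := Function.update s.arr a
                          (Function.update (s.arr a) (i.val s) (e.val s)) }
  | rwrite (s : State) (a : ℕ) (i : NExpr) (e : RExpr) :
      Exec (.rwrite a i e) s (i.cost + e.cost + 1)
        { s with rarr := Function.update s.rarr a
                           (Function.update (s.rarr a) (i.val s) (e.val s)) }
  | seq {p q : Prog} {s₁ s₂ s₃ : State} {t₁ t₂ : ℕ} :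
      Exec p s₁ t₁ s₂ → Exec q s₂ t₂ s₃ → Exec (.seq p q) s₁ (t₁ + t₂) s₃
  | ite_true {b : Test} {p q : Prog} {s s' : State} {t : ℕ} :
      b.holds s → Exec p s t s' → Exec (.ite b p q) s (b.cost + t) s'
  | ite_false {b : Test} {p q : Prog} {s s' : State} {t : ℕ} :
      ¬ b.holds s → Exec q s t s' → Exec (.ite b p q) s (b.cost + t) s'
  | loop_true {b : Test} {p : Prog} {s₁ s₂ s₃ : State} {t₁ t₂ : ℕ} :
      b.holds s₁ → Exec p s₁ t₁ s₂ → Exec (.loop b p) s₂ t₂ s₃ →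
        Exec (.loop b p) s₁ (b.cost + t₁ + t₂) s₃
  | loop_false {b : Test} {p : Prog} {s : State} :
      ¬ b.holds s → Exec (.loop b p) s b.cost s

end RealRAM

/-! ### Weighted graph metrics and embeddings into a cycle -/

/-- Weighted distance: the minimum total weight of a walk from `u` to `v` (with positive weights,
the length of a shortest path). -/
noncomputable def weightedDist {V : Type} (G : SimpleGraph V) (w : Sym2 V → ℝ) (u v : V) : ℝ :=
  ⨅ p : G.Walk u v, (p.edges.map w).sum

/-- `F` is a non-contracting distortion-`d` embedding of the weighted graph metric of `(G, w)` into
the graph metric of `H`. -/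
def IsNonContractingEmbedding {V W : Type} (G : SimpleGraph V) (w : Sym2 V → ℝ)
    (H : SimpleGraph W) (d : ℕ) (F : V → W) : Prop :=
  ∀ u v : V, weightedDist G w u v ≤ (H.dist (F u) (F v) : ℝ) ∧
    (H.dist (F u) (F v) : ℝ) ≤ (d : ℝ) * weightedDist G w u v

/-- An instance: a connected graph on `n` vertices with positive real edge weights (with at
least one edge, so that the maximum weight exists), a cycle on `N` vertices, and a positive
integer `d`. -/
structure CycleInstance where
  n : ℕ
  two_le_n : 2 ≤ n
  G : SimpleGraph (Fin n)
  connected : G.Connected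
  w : Sym2 (Fin n) → ℝ
  w_pos : ∀ e ∈ G.edgeSet, 0 < w e
  N : ℕ
  three_le_N : 3 ≤ N
  d : ℕ
  d_pos : 0 < d

namespace CycleInstance

/-- The target cycle, with vertices `0, …, N - 1` in cyclic order. -/
def C (I : CycleInstance) : SimpleGraph (Fin I.N) := SimpleGraph.cycleGraph I.N

/-- The maximum edge weight. -/
noncomputable def M (I : CycleInstance) : ℝ := sSup (I.w '' I.G.edgeSet)

/-- `F` is a solution of the instance. -/
def IsSolution (I : CycleInstance) (F : Fin I.n → Fin I.N) : Prop :=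
  IsNonContractingEmbedding I.G I.w I.C I.d F

open Classical in
/-- The weighted adjacency matrix: the weight of `ij` if it is an edge, and `0` otherwise. -/
noncomputable def matrix (I : CycleInstance) (i j : Fin I.n) : ℝ :=
  if I.G.Adj i j then I.w s(i, j) else 0

/-- The initial memory: registers `0, 1, 2` hold `n, N, d`, the real array `0` holds the
weighted adjacency matrix row by row, everything else is `0`. -/
noncomputable def input (I : CycleInstance) : RealRAM.State where
  reg := fun x => if x = 0 then I.n else if x = 1 then I.N else if x = 2 then I.d else 0
  arr := fun _ _ => 0
  rreg := fun _ => 0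
  rarr := fun a k =>
    if h : a = 0 ∧ k < I.n * I.n then
      I.matrix ⟨k / I.n, Nat.div_lt_of_lt_mul h.2⟩
        ⟨k % I.n, Nat.mod_lt k (Nat.lt_of_lt_of_le Nat.zero_lt_two I.two_le_n)⟩
    else 0

/-- The final memory `s` answers the instance: either register `0` holds `1` and the first `n`
cells of array `0` hold a solution, or register `0` holds `0` and there is no solution. -/
def IsAnswer (I : CycleInstance) (s : RealRAM.State) : Prop :=
  (s.reg 0 = 1 ∧ ∃ F : Fin I.n → Fin I.N,
    (∀ i : Fin I.n, s.arr 0 (i : ℕ) = (F i : ℕ)) ∧ I.IsSolution F) ∨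
  (s.reg 0 = 0 ∧ ¬ ∃ F : Fin I.n → Fin I.N, I.IsSolution F)

end CycleInstance

/-- A decision problem `Q` on the instances, with a parameter `κ` consisting of two natural
numbers, is fixed-parameter tractable: some program decides it (answer in register `0`) in time
`f(κ) · n ^ c` with `f` computable. -/
def IsFPT (Q : CycleInstance → Prop) (κ : CycleInstance → ℕ × ℕ) : Prop :=
  ∃ (p : RealRAM.Prog) (f : ℕ × ℕ → ℕ) (c : ℕ), Computable f ∧
    ∀ I : CycleInstance, ∃ (t : ℕ) (s : RealRAM.State), RealRAM.Exec p I.input t s ∧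
      ((s.reg 0 = 1 ∧ Q I) ∨ (s.reg 0 = 0 ∧ ¬ Q I)) ∧ t ≤ f (κ I) * I.n ^ c

/-! Distances on the cycle are integers, so the real weights matter only through `dc u v`, the
distance rounded up, and through the integer part of `d` times the weight of an edge.
Non-contraction makes the map injective, and the stretch bound need only be checked on edges: the
cycle distance of the images, divided by `d`, obeys the triangle inequality, so a bound on edges
passes to shortest paths (`CycleInstance.isSolution_iff`). Let L be the integer part of dM; no edge
has an image longer than L.

Cut the cycle open and list the vertices in the order of their images. If a vertex other than vertex
0 is preceded by a gap longer than L, cut there: no edge can run through the gap, and a linear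
problem remains whose first vertex has to be guessed (mode 0). Otherwise cut before vertex 0 and let
edges run around the cycle (mode 1). In both cases consecutive images are at most L apart, in mode 0
because the graph is connected (`Data.IsSol.exists_final`). Conversely, by the triangle inequality
it suffices to check non-contraction for consecutive vertices and for the pair of last and first
vertex (`Data.Good.isSol`). Solutions can thus be built one vertex at a time, with gaps between 1
and L.

The future of a partial placement depends only on which vertices are placed, on the last vertex and
the start, and on the positions of placed vertices that still have unplaced neighbours. Those lie
among the last L positions or, in mode 1, among the first L. The key of a placement records this. Of
two placements with the same key, the shorter one has every extension the other has
(`Data.Same.succ`), so one placement per key suffices. In mode 0 the length is therefore left out of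
the key, which saves a factor of order n.

The number of keys is n² times a function of dM. If there is a solution, every ball of radius L + 1
has at most 2d(L + 1) + 1 vertices (`CycleInstance.ball_card_le`); otherwise the algorithm rejects.
The occupants of the last L positions lie in a ball about the last vertex, those of the first L
positions in a ball about vertex 0. Along a true solution the unplaced vertices with a placed
neighbour have images in two intervals of L positions, so there are at most 2L of them, and each is
a neighbour of a vertex in one of the windows. By connectedness, windows and boundary determine the
set of placed vertices (`Data.Decodes.same`, `Data.card_entries_le`).

The algorithm keeps a worklist sorted by the number of placed vertices, with a table addressed by
keys. A better placement with a known key replaces the old one, which has then not been processed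
yet, so no work is repeated (`Data.Inv.ins`). Each entry gives rise to at most (ball size) · L
candidates, and counters of placed neighbours allow each to be tested in time O(nL); with about n²
entries this makes n³. Distances come from the Floyd–Warshall recursion, and products, floors and
ceilings from counting loops. The programs are verified with `Runs`, which joins termination, a time
bound and a postcondition. For the first claim the bound is evaluated at the integer part of dM, for
the second at `d` times the rounded-up M. -/

/-! ### A Hoare-style calculus for the machine -/

namespace RealRAM

infixr:60 " ;; " => Prog.seq

/-- The natural-number registers a program may change. -/
def Prog.wr : Prog → List ℕ
  | .set x _ => [x]
  | .seq p q => p.wr ++ q.wr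
  | .ite _ p q => p.wr ++ q.wr
  | .loop _ p => p.wr
  | _ => []

/-- The natural-number arrays a program may change. -/
def Prog.wa : Prog → List ℕ
  | .write a _ _ => [a]
  | .seq p q => p.wa ++ q.wa
  | .ite _ p q => p.wa ++ q.wa
  | .loop _ p => p.wa
  | _ => []

/-- The real registers a program may change. -/
def Prog.wrr : Prog → List ℕ
  | .rset x _ => [x]
  | .seq p q => p.wrr ++ q.wrr
  | .ite _ p q => p.wrr ++ q.wrr
  | .loop _ p => p.wrr
  | _ => []

/-- The real arrays a program may change. -/
def Prog.wra : Prog → List ℕ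
  | .rwrite a _ _ => [a]
  | .seq p q => p.wra ++ q.wra
  | .ite _ p q => p.wra ++ q.wra
  | .loop _ p => p.wra
  | _ => []

/-- `s'` agrees with `s` on all memory that `p` cannot change. -/
structure Frame (p : Prog) (s s' : State) : Prop where
  reg : ∀ x, x ∉ p.wr → s'.reg x = s.reg x
  arr : ∀ x, x ∉ p.wa → s'.arr x = s.arr x
  rreg : ∀ x, x ∉ p.wrr → s'.rreg x = s.rreg x
  rarr : ∀ x, x ∉ p.wra → s'.rarr x = s.rarr x

theorem Frame.refl (p : Prog) (s : State) : Frame p s s :=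
  ⟨fun _ _ => rfl, fun _ _ => rfl, fun _ _ => rfl, fun _ _ => rfl⟩

theorem Frame.trans {p : Prog} {s₁ s₂ s₃ : State} (h : Frame p s₁ s₂) (h' : Frame p s₂ s₃) :
    Frame p s₁ s₃ :=
  ⟨fun x hx => (h'.reg x hx).trans (h.reg x hx), fun x hx => (h'.arr x hx).trans (h.arr x hx),
    fun x hx => (h'.rreg x hx).trans (h.rreg x hx), fun x hx => (h'.rarr x hx).trans (h.rarr x hx)⟩

theorem Frame.weaken {p q : Prog} {s s' : State} (h : Frame p s s') (h1 : p.wr ⊆ q.wr)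
    (h2 : p.wa ⊆ q.wa) (h3 : p.wrr ⊆ q.wrr) (h4 : p.wra ⊆ q.wra) : Frame q s s' :=
  ⟨fun x hx => h.reg x fun m => hx (h1 m), fun x hx => h.arr x fun m => hx (h2 m),
    fun x hx => h.rreg x fun m => hx (h3 m), fun x hx => h.rarr x fun m => hx (h4 m)⟩

theorem Frame.seq_left {p : Prog} (q : Prog) {s s' : State} (h : Frame p s s') :
    Frame (p ;; q) s s' := by
  apply h.weaken <;> simp [Prog.wr, Prog.wa, Prog.wrr, Prog.wra]

theorem Frame.seq_right {q : Prog} (p : Prog) {s s' : State} (h : Frame q s s') :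
    Frame (p ;; q) s s' := by
  apply h.weaken <;> simp [Prog.wr, Prog.wa, Prog.wrr, Prog.wra]

/-- The write lists are computed from the program text. For concrete programs, preservation of a
register or array is therefore settled by evaluating a list membership. -/
theorem Exec.frame {p : Prog} {s s' : State} {t : ℕ} (h : Exec p s t s') : Frame p s s' := by
  induction h with
  | skip s => exact Frame.refl _ _
  | set s x e =>
    refine ⟨fun y hy => ?_, fun _ _ => rfl, fun _ _ => rfl, fun _ _ => rfl⟩
    simp only [Prog.wr, List.mem_singleton] at hy
    simp [Function.update_of_ne hy]
  | rset s x e =>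
    refine ⟨fun _ _ => rfl, fun _ _ => rfl, fun y hy => ?_, fun _ _ => rfl⟩
    simp only [Prog.wrr, List.mem_singleton] at hy
    simp [Function.update_of_ne hy]
  | write s a i e =>
    refine ⟨fun _ _ => rfl, fun y hy => ?_, fun _ _ => rfl, fun _ _ => rfl⟩
    simp only [Prog.wa, List.mem_singleton] at hy
    simp [Function.update_of_ne hy]
  | rwrite s a i e =>
    refine ⟨fun _ _ => rfl, fun _ _ => rfl, fun _ _ => rfl, fun y hy => ?_⟩
    simp only [Prog.wra, List.mem_singleton] at hy
    simp [Function.update_of_ne hy]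
  | seq _ _ ih1 ih2 => exact (ih1.seq_left _).trans (ih2.seq_right _)
  | ite_true _ _ ih =>
    apply ih.weaken <;> simp [Prog.wr, Prog.wa, Prog.wrr, Prog.wra]
  | ite_false _ _ ih =>
    apply ih.weaken <;> simp [Prog.wr, Prog.wa, Prog.wrr, Prog.wra]
  | loop_true _ _ _ ih1 ih2 =>
    refine Frame.trans (ih1.weaken ?_ ?_ ?_ ?_) ih2 <;>
      simp [Prog.wr, Prog.wa, Prog.wrr, Prog.wra]
  | loop_false _ => exact Frame.refl _ _

/-- `p`, started in `s`, halts within `T` steps in a state satisfying `Q`. -/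
def Runs (p : Prog) (s : State) (T : ℕ) (Q : State → Prop) : Prop :=
  ∃ t s', Exec p s t s' ∧ t ≤ T ∧ Q s'

/-- The consequence may use the frame of the run, so a postcondition need only mention what the
program changes. `Runs.seq` passes the frame on in the same way. -/
theorem Runs.mono {p : Prog} {s : State} {T T' : ℕ} {Q Q' : State → Prop} (h : Runs p s T Q)
    (hT : T ≤ T') (hQ : ∀ s', Frame p s s' → Q s' → Q' s') : Runs p s T' Q' := by
  obtain ⟨t, s', he, ht, hq⟩ := h
  exact ⟨t, s', he, ht.trans hT, hQ s' he.frame hq⟩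

theorem Runs.seq {p q : Prog} {s : State} {T₁ T₂ : ℕ} {Q₁ Q : State → Prop}
    (h : Runs p s T₁ Q₁) (h' : ∀ s₁, Frame p s s₁ → Q₁ s₁ → Runs q s₁ T₂ Q) :
    Runs (p ;; q) s (T₁ + T₂) Q := by
  obtain ⟨t, s', he, ht, hq⟩ := h
  obtain ⟨t', s'', he', ht', hq'⟩ := h' s' he.frame hq
  exact ⟨_, s'', .seq he he', Nat.add_le_add ht ht', hq'⟩

theorem Runs.ite {b : Test} {p q : Prog} {s : State} {T : ℕ} {Q : State → Prop}
    (h : b.holds s → Runs p s T Q) (h' : ¬ b.holds s → Runs q s T Q) :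
    Runs (.ite b p q) s (b.cost + T) Q := by
  by_cases hb : b.holds s
  · obtain ⟨t, s', he, ht, hq⟩ := h hb
    exact ⟨_, s', .ite_true hb he, by omega, hq⟩
  · obtain ⟨t, s', he, ht, hq⟩ := h' hb
    exact ⟨_, s', .ite_false hb he, by omega, hq⟩

theorem Runs.ite_true {b : Test} {p q : Prog} {s : State} {T : ℕ} {Q : State → Prop}
    (hb : b.holds s) (h : Runs p s T Q) : Runs (.ite b p q) s (b.cost + T) Q := by
  obtain ⟨t, s', he, ht, hq⟩ := h
  exact ⟨_, s', .ite_true hb he, by omega, hq⟩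

theorem Runs.ite_false {b : Test} {p q : Prog} {s : State} {T : ℕ} {Q : State → Prop}
    (hb : ¬ b.holds s) (h : Runs q s T Q) : Runs (.ite b p q) s (b.cost + T) Q := by
  obtain ⟨t, s', he, ht, hq⟩ := h
  exact ⟨_, s', .ite_false hb he, by omega, hq⟩

/-- Loop-free programs. -/
def Prog.flat : Prog → Bool
  | .seq p q => p.flat && q.flat
  | .ite _ p q => p.flat && q.flat
  | .loop _ _ => false
  | _ => true

/-- The result of a loop-free program. -/
noncomputable def Prog.run : Prog → State → State
  | .skip, s => s
  | .set x e, s => { s with reg := Function.update s.reg x (e.val s) }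
  | .rset x e, s => { s with rreg := Function.update s.rreg x (e.val s) }
  | .write a i e, s =>
      { s with arr := Function.update s.arr a (Function.update (s.arr a) (i.val s) (e.val s)) }
  | .rwrite a i e, s =>
      { s with rarr := Function.update s.rarr a (Function.update (s.rarr a) (i.val s) (e.val s)) }
  | .seq p q, s => q.run (p.run s)
  | .ite b p q, s => open Classical in if b.holds s then p.run s else q.run s
  | .loop _ _, s => s

/-- An upper bound for the number of steps of a loop-free program. -/
def Prog.bound : Prog → ℕ
  | .skip => 1
  | .set _ e => e.cost + 1
  | .rset _ e => e.cost + 1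
  | .write _ i e => i.cost + e.cost + 1
  | .rwrite _ i e => i.cost + e.cost + 1
  | .seq p q => p.bound + q.bound
  | .ite b p q => b.cost + max p.bound q.bound
  | .loop _ _ => 0

/-- Straight-line code is handled by symbolic evaluation, with the cost bound obtained by
computation; only loops need invariants. -/
theorem Runs.of_flat {p : Prog} (h : p.flat = true) {s : State} {T : ℕ} {Q : State → Prop}
    (hT : p.bound ≤ T) (hQ : Q (p.run s)) : Runs p s T Q := by
  suffices H : ∃ t, Exec p s t (p.run s) ∧ t ≤ p.bound by
    obtain ⟨t, he, ht⟩ := H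
    exact ⟨t, _, he, ht.trans hT, hQ⟩
  clear hQ hT
  induction p generalizing s with
  | skip => exact ⟨_, .skip s, le_rfl⟩
  | set x e => exact ⟨_, .set s x e, le_rfl⟩
  | rset x e => exact ⟨_, .rset s x e, le_rfl⟩
  | write a i e => exact ⟨_, .write s a i e, le_rfl⟩
  | rwrite a i e => exact ⟨_, .rwrite s a i e, le_rfl⟩
  | seq p q ih1 ih2 =>
    simp only [Prog.flat, Bool.and_eq_true] at h
    obtain ⟨t, he, ht⟩ := ih1 h.1 (s := s)
    obtain ⟨t', he', ht'⟩ := ih2 h.2 (s := p.run s)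
    exact ⟨_, .seq he he', Nat.add_le_add ht ht'⟩
  | ite b p q ih1 ih2 =>
    simp only [Prog.flat, Bool.and_eq_true] at h
    by_cases hb : b.holds s
    · obtain ⟨t, he, ht⟩ := ih1 h.1 (s := s)
      exact ⟨_, by simpa [Prog.run, hb] using Exec.ite_true hb he, by simp only [Prog.bound]; omega⟩
    · obtain ⟨t, he, ht⟩ := ih2 h.2 (s := s)
      exact ⟨_, by simpa [Prog.run, hb] using Exec.ite_false hb he,
        by simp only [Prog.bound]; omega⟩
  | loop b p => simp [Prog.flat] at h

/-- The index of the invariant counts completed rounds. Termination is the claim `i < k` whenever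
the test holds, so `k` need only be an a priori bound; this is what a worklist that grows while it
is processed requires. -/
theorem Runs.loop {b : Test} {p : Prog} {s : State} (I : ℕ → State → Prop) (T : ℕ → ℕ) (k : ℕ)
    (h0 : I 0 s)
    (step : ∀ i s', Frame (.loop b p) s s' → I i s' → b.holds s' →
      i < k ∧ Runs p s' (T i) (I (i + 1))) :
    Runs (.loop b p) s (∑ i ∈ Finset.range k, (T i + b.cost) + b.cost)
      (fun s' => ∃ i ≤ k, I i s' ∧ ¬ b.holds s') := by
  suffices H : ∀ j i s', i + j = k → Frame (.loop b p) s s' → I i s' →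
      Runs (.loop b p) s' (∑ x ∈ Finset.range j, (T (i + x) + b.cost) + b.cost)
        (fun s' => ∃ i ≤ k, I i s' ∧ ¬ b.holds s') by
    simpa using H k 0 s (by omega) (Frame.refl _ _) h0
  intro j
  induction j with
  | zero =>
    intro i s' hk hF hI
    by_cases hb : b.holds s'
    · have := (step i s' hF hI hb).1
      omega
    · exact ⟨_, s', .loop_false hb, by simp, i, by omega, hI, hb⟩
  | succ j ih =>
    intro i s' hk hF hI
    by_cases hb : b.holds s'
    · obtain ⟨t, s₁, he, ht, h1⟩ := (step i s' hF hI hb).2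
      have hF1 : Frame (.loop b p) s' s₁ := he.frame.weaken (List.Subset.refl _)
        (List.Subset.refl _) (List.Subset.refl _) (List.Subset.refl _)
      obtain ⟨t', s₂, he', ht', h2⟩ := ih (i + 1) s₁ (by omega) (hF.trans hF1) h1
      refine ⟨_, s₂, .loop_true hb he he', ?_, h2⟩
      rw [Finset.sum_range_succ']
      simp only [add_zero]
      have : ∀ x, i + 1 + x = i + (x + 1) := fun x => by omega
      simp only [this] at ht'
      omega
    · exact ⟨_, s', .loop_false hb, by omega, i, by omega, hI, hb⟩

/-- `for x < b do p` -/
def Prog.forTo (x b : ℕ) (p : Prog) : Prog :=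
  .set x (.lit 0) ;; .loop (.lt (.reg x) (.reg b)) (p ;; .set x (.add (.reg x) (.lit 1)))

/-- The cost may vary with the counter, for loops in which only few rounds are expensive. Each round
pays 3 for the test and 4 for the increment; initialisation and the last test make up the final 5.
-/
theorem Runs.forTo {x b : ℕ} {p : Prog} {s : State} (I : ℕ → State → Prop) (T : ℕ → ℕ)
    (hx : x ∉ p.wr) (hb : b ∉ p.wr) (hxb : b ≠ x)
    (hI : ∀ i s v, I i s → I i { s with reg := Function.update s.reg x v })
    (h0 : I 0 s)
    (step : ∀ i s', i < s.reg b → Frame (Prog.forTo x b p) s s' → s'.reg x = i → I i s' →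
      Runs p s' (T i) (I (i + 1))) :
    Runs (Prog.forTo x b p) s (∑ i ∈ Finset.range (s.reg b), (T i + 7) + 5) (I (s.reg b)) := by
  have hbw : b ∉ (Prog.forTo x b p).wr := by
    simp [Prog.forTo, Prog.wr, hb, hxb]
  have hset : Runs (.set x (.lit 0)) s 2
      (fun s' => s' = { s with reg := Function.update s.reg x 0 }) :=
    Runs.of_flat rfl le_rfl rfl
  have key := Runs.seq (q := .loop (.lt (.reg x) (.reg b)) (p ;; .set x (.add (.reg x) (.lit 1))))
    (T₂ := ∑ i ∈ Finset.range (s.reg b), (T i + 4 + 3) + 3) (Q := I (s.reg b)) hset ?_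
  · refine Runs.mono key (by simp only [add_assoc, Nat.reduceAdd]; omega) fun _ _ h => h
  rintro s₁ hF1 rfl
  refine Runs.mono (Runs.loop (fun i s' => i ≤ s.reg b ∧ s'.reg x = i ∧ I i s') (fun i => T i + 4)
    (s.reg b) ⟨Nat.zero_le _, by simp, hI _ _ _ h0⟩ ?_) le_rfl ?_
  · intro i s' hF hi hlt
    have hF' : Frame (Prog.forTo x b p) s s' := (hF1.seq_left _).trans (hF.seq_right _)
    have hlt' : i < s.reg b := by
      have := hlt
      simp only [Test.holds, NExpr.val, hi.2.1, hF'.reg b hbw] at this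
      exact this
    refine ⟨hlt', Runs.seq (step i s' hlt' hF' hi.2.1 hi.2.2) fun s₂ hF2 h2 => ?_⟩
    have hx2 : s₂.reg x = i := (hF2.reg x hx).trans hi.2.1
    refine Runs.of_flat rfl le_rfl ⟨by omega, ?_, hI _ _ _ h2⟩
    simp [Prog.run, NExpr.val, hx2]
  · rintro s' hF ⟨i, -, ⟨hi, hxi, hI'⟩, hn⟩
    have hF' : Frame (Prog.forTo x b p) s s' := (hF1.seq_left _).trans (hF.seq_right _)
    simp only [Test.holds, NExpr.val, hxi, hF'.reg b hbw] at hn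
    have : i = s.reg b := by omega
    exact this ▸ hI'

/-- A `for` loop whose body has a uniform cost bound. -/
theorem Runs.forTo_const {x b : ℕ} {p : Prog} {s : State} (I : ℕ → State → Prop) (T : ℕ)
    (hx : x ∉ p.wr) (hb : b ∉ p.wr) (hxb : b ≠ x)
    (hI : ∀ i s v, I i s → I i { s with reg := Function.update s.reg x v })
    (h0 : I 0 s)
    (step : ∀ i s', i < s.reg b → Frame (Prog.forTo x b p) s s' → s'.reg x = i → I i s' →
      Runs p s' T (I (i + 1))) :
    Runs (Prog.forTo x b p) s (s.reg b * (T + 7) + 5) (I (s.reg b)) := by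
  refine Runs.mono (Runs.forTo I (fun _ => T) hx hb hxb hI h0 step) ?_ fun _ _ h => h
  simp

end RealRAM

/-! ### Partial placements on the cycle -/

namespace CyclePlacement

/-- The integer data of an instance: `N` is the length of the cycle, `L` the maximal length of the
image of an edge, `dc` the distance rounded up, and `e u v` is one more than the maximal length of
the image of the edge `uv`, and `0` if `uv` is not an edge. -/
structure Data (n : ℕ) where
  N : ℕ
  L : ℕ
  root : Fin n
  dc : Fin n → Fin n → ℕ
  e : Fin n → Fin n → ℕ

/-- A partial placement: `pos y` is the position of `y`, counted from `1`, and `0` if `y` is not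
placed; `start` is at position `1` and `last` at the maximal position `p`.  In mode `1` edges may
run around the cycle, in mode `0` they may not. -/
structure Entry (n : ℕ) where
  mode : ℕ
  start : Fin n
  last : Fin n
  p : ℕ
  pos : Fin n → ℕ

variable {n : ℕ}

/-- What the combinatorics needs of an instance. The field `e_dc` puts neighbours into the ball of
radius `L + 1`, and `conn` is connectedness in the form used throughout: every cut is crossed by an
edge. -/
structure Data.Proper (D : Data n) : Prop where
  dc_self : ∀ u, D.dc u u = 0
  dc_comm : ∀ u v, D.dc u v = D.dc v u
  dc_tri : ∀ u v x, D.dc u x ≤ D.dc u v + D.dc v x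
  e_comm : ∀ u v, D.e u v = D.e v u
  e_irrefl : ∀ u, D.e u u = 0
  e_dc : ∀ u v, 0 < D.e u v → D.dc u v ≤ D.L + 1
  e_le : ∀ u v, D.e u v ≤ D.L + 1
  conn : ∀ S : Set (Fin n), S.Nonempty → Sᶜ.Nonempty → ∃ a ∈ S, ∃ b ∉ S, 0 < D.e a b

/-- A vertex at position `x` may still have neighbours after the current position `p`. -/
def Data.Near (D : Data n) (mode p x : ℕ) : Prop := p < x + D.L ∨ (mode = 1 ∧ x ≤ D.L)

/-- The length constraint of an edge with bound `e` between positions `a ≤ b`. -/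
def Data.EdgeOk (D : Data n) (mode a b e : ℕ) : Prop := b - a < e ∨ (mode = 1 ∧ D.N - (b - a) < e)

/-- The boundary of the placed set: the unplaced vertices with a placed neighbour. -/
def Data.bdry (D : Data n) (pos : Fin n → ℕ) : Finset (Fin n) :=
  {z | pos z = 0 ∧ ∃ y, pos y ≠ 0 ∧ 0 < D.e y z}

/-- The test that keeps the number of partial placements small. -/
structure Data.Checked (D : Data n) (t : Entry n) : Prop where
  near : ∀ y, t.pos y ≠ 0 → (∃ z, t.pos z = 0 ∧ 0 < D.e z y) → D.Near t.mode t.p (t.pos y)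
  card : (D.bdry t.pos).card ≤ 2 * D.L

/-- Place `u` at distance `g` after the last vertex. -/
def Entry.ext (s : Entry n) (u : Fin n) (g : ℕ) : Entry n :=
  { s with last := u, p := s.p + g, pos := Function.update s.pos u (s.p + g) }

/-- Non-contraction is demanded only against the last vertex, the other pairs following from the
triangle inequality. Stretch is demanded only against placed neighbours. -/
structure Data.Succ (D : Data n) (s : Entry n) (u : Fin n) (g : ℕ) : Prop where
  new : s.pos u = 0
  one_le : 1 ≤ g
  le : g ≤ D.L
  dc : D.dc s.last u ≤ g
  le_N : s.p + g ≤ D.N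
  edge : ∀ y, s.pos y ≠ 0 → 0 < D.e u y → D.EdgeOk s.mode (s.pos y) (s.p + g) (D.e u y)
  checked : D.Checked (s.ext u g)

/-- The placement of a single vertex. -/
def Entry.init (mode : ℕ) (r : Fin n) : Entry n := ⟨mode, r, r, 1, Pi.single r 1⟩

/-- In mode 1 a rotation puts the root first. In mode 0 the cut lies in a long gap, and the vertex
following it can be any vertex. -/
inductive Data.Reach (D : Data n) : Entry n → Prop
  | cyc : Reach D (Entry.init 1 D.root)
  | lin (r : Fin n) : Reach D (Entry.init 0 r)
  | step {s : Entry n} {u : Fin n} {g : ℕ} : Reach D s → D.Succ s u g → Reach D (s.ext u g)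

/-- The number of placed vertices. -/
def Entry.size (s : Entry n) : ℕ := (Finset.univ.filter fun y => s.pos y ≠ 0).card

/-- What the key of an entry records about a vertex at position `x`. -/
def Data.dig (D : Data n) (mode p x : ℕ) : ℕ :=
  if x = 0 then 0 else if mode = 1 ∧ x ≤ D.L then 1 + x
  else if p < x + D.L then D.L + 2 + (p - x) else 1

/-- Two entries with the same key. -/
structure Data.Same (D : Data n) (s t : Entry n) : Prop where
  mode : s.mode = t.mode
  p : s.mode = 1 → s.p = t.p
  start : s.start = t.start
  dig : ∀ y, D.dig s.mode s.p (s.pos y) = D.dig t.mode t.p (t.pos y)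

/-- The invariants of the reachable entries. -/
structure Data.Good (D : Data n) (s : Entry n) : Prop where
  mode : s.mode = 0 ∨ (s.mode = 1 ∧ s.start = D.root)
  pos_start : s.pos s.start = 1
  pos_last : s.pos s.last = s.p
  one_le : 1 ≤ s.p
  le_N : s.p ≤ D.N ∨ s.p = 1
  le_p : ∀ y, s.pos y ≤ s.p
  inj : ∀ x y, s.pos x ≠ 0 → s.pos x = s.pos y → x = y
  dc : ∀ x y, s.pos x ≠ 0 → s.pos x ≤ s.pos y → D.dc x y ≤ s.pos y - s.pos x
  edge : ∀ x y, s.pos x ≠ 0 → s.pos x ≤ s.pos y → 0 < D.e x y →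
    D.EdgeOk s.mode (s.pos x) (s.pos y) (D.e x y)
  near : 1 ≤ D.L → ∀ y, s.pos y ≠ 0 → (∃ z, s.pos z = 0 ∧ 0 < D.e z y) →
    D.Near s.mode s.p (s.pos y)
  p_le : s.p ≤ 1 + (s.size - 1) * D.L

/-! ### Invariants of reachable placements -/

theorem Entry.ext_pos_self (s : Entry n) (u : Fin n) (g : ℕ) : (s.ext u g).pos u = s.p + g := by
  simp [Entry.ext]

theorem Entry.ext_pos_ne (s : Entry n) {u y : Fin n} (g : ℕ) (h : y ≠ u) :
    (s.ext u g).pos y = s.pos y := by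
  simp [Entry.ext, h]

theorem Entry.size_init (m : ℕ) (r : Fin n) : (Entry.init m r).size = 1 := by
  have : (Finset.univ.filter fun y => (Entry.init m r).pos y ≠ 0) = {r} := by
    ext y
    by_cases h : y = r <;> simp [Entry.init, h, Pi.single_apply]
  rw [Entry.size, this, Finset.card_singleton]

theorem Entry.size_ext {s : Entry n} {u : Fin n} {g : ℕ} (h : s.pos u = 0) (hg : 1 ≤ g) :
    (s.ext u g).size = s.size + 1 := by
  have : (Finset.univ.filter fun y => (s.ext u g).pos y ≠ 0)
      = insert u (Finset.univ.filter fun y => s.pos y ≠ 0) := by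
    ext y
    by_cases hy : y = u
    · subst hy
      simp [Entry.ext_pos_self]
      omega
    · simp [Entry.ext_pos_ne _ _ hy, hy]
  rw [Entry.size, this, Finset.card_insert_of_notMem (by simp [h])]
  rfl

theorem Data.Good.one_le_size {D : Data n} {s : Entry n} (h : D.Good s) : 1 ≤ s.size :=
  Finset.card_pos.mpr ⟨s.start, by simp [h.pos_start]⟩

theorem Data.good_init {D : Data n} (hD : D.Proper) {m : ℕ} {r : Fin n}
    (h : m = 0 ∨ (m = 1 ∧ r = D.root)) : D.Good (Entry.init m r) := by
  have hp : ∀ y, (Entry.init m r).pos y = if y = r then 1 else 0 := fun y => by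
    simp [Entry.init, Pi.single_apply]
  have h1 : (Entry.init m r).p = 1 := rfl
  refine ⟨h, by simp [Entry.init], by simp [Entry.init], le_rfl, Or.inr rfl, ?_, ?_, ?_, ?_,
    ?_, by simp [h1]⟩
  · intro y; rw [hp, h1]; split_ifs <;> omega
  · intro x y hx hxy
    simp only [hp] at hx hxy
    split_ifs at hx hxy <;> simp_all
  · intro x y hx hxy
    simp only [hp] at hx hxy
    have : x = r := by by_contra hne; simp [hne] at hx
    subst this
    have : y = x := by by_contra hne; simp [hne] at hxy
    subst this
    simp [hD.dc_self]
  · intro x y hx hxy he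
    simp only [hp] at hx hxy
    have : x = r := by by_contra hne; simp [hne] at hx
    subst this
    have : y = x := by by_contra hne; simp [hne] at hxy
    subst this
    simp [hD.e_irrefl] at he
  · intro hL y hy _
    left
    rw [h1]
    omega

/-- Only pairs involving `u` are new. For non-contraction the detour through the last vertex gives
the bound, since distances along the line add up. -/
theorem Data.Good.ext {D : Data n} (hD : D.Proper) {s : Entry n} (h : D.Good s) {u : Fin n} {g : ℕ}
    (hs : D.Succ s u g) : D.Good (s.ext u g) := by
  have hup := s.ext_pos_self u g
  have hne : ∀ y, y ≠ u → (s.ext u g).pos y = s.pos y := fun y => s.ext_pos_ne g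
  have hp : (s.ext u g).p = s.p + g := rfl
  have hm : (s.ext u g).mode = s.mode := rfl
  have hst : s.start ≠ u := by
    rintro hc
    have := h.pos_start
    rw [hc, hs.new] at this
    omega
  have h1 := hs.one_le
  have hle := h.le_p
  refine ⟨h.mode, (hne _ hst).trans h.pos_start, hup, by omega, Or.inl hs.le_N, ?_, ?_, ?_, ?_,
    fun _ => hs.checked.near, ?_⟩
  · intro y
    by_cases hy : y = u
    · rw [hy, hup, hp]
    · rw [hne y hy, hp]
      have := hle y
      omega
  · intro x y hx hxy
    by_cases hxu : x = u <;> by_cases hyu : y = u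
    · rw [hxu, hyu]
    · rw [hxu, hup, hne y hyu] at hxy
      have := hle y
      omega
    · rw [hyu, hup, hne x hxu] at hxy
      have := hle x
      omega
    · rw [hne x hxu, hne y hyu] at hxy
      rw [hne x hxu] at hx
      exact h.inj x y hx hxy
  · intro x y hx hxy
    by_cases hxu : x = u <;> by_cases hyu : y = u
    · rw [hxu, hyu, hD.dc_self]
      omega
    · rw [hxu, hup, hne y hyu] at hxy
      have := hle y
      omega
    · rw [hyu, hup, hne x hxu]
      rw [hne x hxu] at hx
      have h2 := h.dc x s.last hx (by rw [h.pos_last]; exact hle x)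
      have h3 := hD.dc_tri x s.last u
      have h4 := hs.dc
      rw [h.pos_last] at h2
      have := hle x
      omega
    · rw [hne x hxu, hne y hyu] at *
      exact h.dc x y hx hxy
  · intro x y hx hxy he
    by_cases hxu : x = u <;> by_cases hyu : y = u
    · rw [hxu, hyu, hD.e_irrefl] at he
      omega
    · rw [hxu, hup, hne y hyu] at hxy
      have := hle y
      omega
    · rw [hyu] at he
      rw [hyu, hup, hne x hxu, hD.e_comm x u]
      rw [hne x hxu] at hx
      rw [hD.e_comm] at he
      exact hs.edge x hx he
    · rw [hne x hxu, hne y hyu] at *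
      exact h.edge x y hx hxy he
  · rw [Entry.size_ext hs.new h1, hp]
    have h2 := h.p_le
    have h3 := hs.le
    have h4 : 1 ≤ s.size := h.one_le_size
    obtain ⟨k, hk⟩ := Nat.exists_eq_add_of_le h4
    rw [hk] at h2 ⊢
    simp only [Nat.add_sub_cancel_left, Nat.add_sub_cancel] at h2 ⊢
    rw [add_mul]
    omega

theorem Data.Reach.good {D : Data n} (hD : D.Proper) {s : Entry n} (h : D.Reach s) :
    D.Good s := by
  induction h with
  | cyc => exact D.good_init hD (Or.inr ⟨rfl, rfl⟩)
  | lin r => exact D.good_init hD (Or.inl rfl)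
  | step _ hs ih => exact ih.ext hD hs

theorem Data.Good.p_le_mul {D : Data n} {s : Entry n} (h : D.Good s) (hL : 1 ≤ D.L) :
    s.p ≤ n * D.L := by
  have h1 : s.size ≤ n := (Finset.card_le_univ _).trans_eq (Fintype.card_fin n)
  have h2 := h.p_le
  have h3 := h.one_le_size
  obtain ⟨k, hk⟩ := Nat.exists_eq_add_of_le h3
  rw [hk] at h2 h1
  have h4 : (1 + k) * D.L ≤ n * D.L := Nat.mul_le_mul_right _ h1
  rw [add_mul] at h4
  simp only [Nat.add_sub_cancel_left] at h2
  omega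

/-! ### Equivalence and domination of placements -/

theorem Data.dig_lt {D : Data n} {mode p x : ℕ} : D.dig mode p x < 2 * D.L + 3 := by
  unfold Data.dig
  split_ifs <;> omega

theorem Data.Same.zero_iff {D : Data n} {s t : Entry n} (h : D.Same s t) (y : Fin n) :
    s.pos y = 0 ↔ t.pos y = 0 := by
  have := h.dig y
  unfold Data.dig at this
  split_ifs at this <;> omega

theorem Data.Same.symm {D : Data n} {s t : Entry n} (h : D.Same s t) : D.Same t s :=
  ⟨h.mode.symm, fun hm => (h.p (h.mode.trans hm)).symm, h.start.symm, fun y => (h.dig y).symm⟩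

theorem Data.Same.trans {D : Data n} {s t x : Entry n} (h : D.Same s t) (h' : D.Same t x) :
    D.Same s x :=
  ⟨h.mode.trans h'.mode, fun hm => (h.p hm).trans (h'.p (h.mode ▸ hm)), h.start.trans h'.start,
    fun y => (h.dig y).trans (h'.dig y)⟩

theorem Data.Same.refl (D : Data n) (s : Entry n) : D.Same s s :=
  ⟨rfl, fun _ => rfl, rfl, fun _ => rfl⟩

theorem Data.Same.size_eq {D : Data n} {s t : Entry n} (h : D.Same s t) : s.size = t.size := by
  simp only [Entry.size, ne_eq, h.zero_iff]

/-- Entries with the same key agree, relatively to the current position, where it matters. -/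
theorem Data.Same.pos_add {D : Data n} {s t : Entry n} (h : D.Same s t) (hs : D.Good s)
    (ht : D.Good t) {y : Fin n} (hy : s.pos y ≠ 0) (hn : D.Near s.mode s.p (s.pos y)) :
    s.pos y + t.p = t.pos y + s.p := by
  have h1 := h.dig y
  have h2 := hs.le_p y
  have h3 := ht.le_p y
  have h4 := h.p
  have h5 := h.mode
  unfold Data.dig at h1
  unfold Data.Near at hn
  split_ifs at h1 <;> omega

/-- The last vertex is near the end, at offset 0, so the key identifies it. For `L = 0` the window
would be empty. -/
theorem Data.Same.last_eq {D : Data n} {s t : Entry n} (h : D.Same s t) (hs : D.Good s)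
    (ht : D.Good t) (hL : 1 ≤ D.L) : s.last = t.last := by
  have h0 : s.pos s.last ≠ 0 := by have := hs.pos_last; have := hs.one_le; omega
  have h1 := h.pos_add hs ht h0 (Or.inl (by rw [hs.pos_last]; omega))
  rw [hs.pos_last] at h1
  have := ht.one_le
  exact ht.inj _ _ (by omega) (by rw [ht.pos_last]; omega)

/-- If two entries have the same key, then the one with the smaller length can be extended in the
same ways as the other. -/
theorem Data.Same.succ {D : Data n} {s t : Entry n} (h : D.Same s t) (hs : D.Good s)
    (ht : D.Good t) (hp : s.p ≤ t.p) {u : Fin n} {g : ℕ} (hg : D.Succ t u g) :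
    D.Succ s u g ∧ D.Same (s.ext u g) (t.ext u g) := by
  have hL : 1 ≤ D.L := hg.one_le.trans hg.le
  have hu : s.pos u = 0 := (h.zero_iff u).2 hg.new
  have hm := h.mode
  have hp1 := h.p
  have hg1 := hg.one_le
  have hnear : ∀ y, s.pos y ≠ 0 → (∃ z, s.pos z = 0 ∧ 0 < D.e z y) →
      D.Near s.mode s.p (s.pos y) := hs.near hL
  have hzero : ∀ y, (s.ext u g).pos y = 0 ↔ (t.ext u g).pos y = 0 := fun y => by
    by_cases hy : y = u
    · subst hy
      rw [Entry.ext_pos_self, Entry.ext_pos_self]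
      omega
    · rw [Entry.ext_pos_ne _ _ hy, Entry.ext_pos_ne _ _ hy, h.zero_iff]
  refine ⟨⟨hu, hg1, hg.le, by rw [h.last_eq hs ht hL]; exact hg.dc, by have := hg.le_N; omega, ?_,
    ?_, ?_⟩, hm, fun hm1 => ?_, h.start, ?_⟩
  · intro y hy he
    have h1 := hg.edge y (fun hc => hy ((h.zero_iff y).2 hc)) he
    -- Before the step, `u` is an unplaced neighbour of `y`. Hence `y` is near, and its offset from
    -- the end is the same in both entries.
    have h2 := h.pos_add hs ht hy (hnear y hy ⟨u, hu, he⟩)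
    have h3 := hs.le_p y
    have h4 := ht.le_p y
    unfold Data.EdgeOk at *
    have : s.p + g - s.pos y = t.p + g - t.pos y := by omega
    rw [this, hm]
    exact h1
  · rintro y hy ⟨z, hz, he⟩
    have h1 := hg.checked.near y (fun hc => hy ((hzero y).2 hc)) ⟨z, (hzero z).1 hz, he⟩
    by_cases hyu : y = u
    · left
      rw [hyu, Entry.ext_pos_self]
      change s.p + g < _
      omega
    · rw [Entry.ext_pos_ne _ _ hyu] at hy h1 ⊢
      have hzu : z ≠ u := by
        rintro rfl
        rw [Entry.ext_pos_self] at hz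
        omega
      rw [Entry.ext_pos_ne _ _ hzu] at hz
      have h2 := h.pos_add hs ht hy (hnear y hy ⟨z, hz, he⟩)
      unfold Data.Near at *
      change s.p + g < _ ∨ s.mode = 1 ∧ _
      change t.p + g < _ ∨ t.mode = 1 ∧ _ at h1
      omega
  · have : D.bdry (s.ext u g).pos = D.bdry (t.ext u g).pos := by
      ext z
      simp only [Data.bdry, Finset.mem_filter, Finset.mem_univ, true_and, ne_eq, hzero]
    rw [this]
    exact hg.checked.card
  · change s.p + g = t.p + g
    rw [hp1 hm1]
  · intro y
    change D.dig s.mode (s.p + g) _ = D.dig t.mode (t.p + g) _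
    by_cases hyu : y = u
    · rw [hyu, Entry.ext_pos_self, Entry.ext_pos_self]
      unfold Data.dig
      split_ifs <;> omega
    · rw [Entry.ext_pos_ne _ _ hyu, Entry.ext_pos_ne _ _ hyu]
      -- For an old vertex the new digit is a function of the old digit and `g`: offsets from the
      -- end grow by `g`, a vertex that is far stays far, and in mode 1 the digits of the first `L`
      -- positions do not change.
      have h1 := h.dig y
      have h2 := hs.le_p y
      have h3 := ht.le_p y
      unfold Data.dig at *
      split_ifs at h1 ⊢ <;> omega

/-- An entry that is a complete solution. -/
structure Data.Final (D : Data n) (s : Entry n) : Prop where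
  size : s.size = n
  close : D.dc s.last s.start + s.p ≤ D.N + 1

theorem Data.Same.final {D : Data n} {s t : Entry n} (h : D.Same s t) (hs : D.Good s)
    (ht : D.Good t) (hL : 1 ≤ D.L) (hp : s.p ≤ t.p) (hf : D.Final t) : D.Final s :=
  ⟨h.size_eq.trans hf.size, by rw [h.last_eq hs ht hL, h.start]; have := hf.close; omega⟩

end CyclePlacement

namespace CyclePlacement
variable {n : ℕ}

/-! #### Keys -/

/-- Horner evaluation in base `B` of the digits `f 0, …, f (i - 1)`, with leading part `h`. -/
def horner (B h : ℕ) (f : ℕ → ℕ) : ℕ → ℕ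
  | 0 => h
  | i + 1 => horner B h f i * B + f i

theorem horner_inj {B h h' : ℕ} {f f' : ℕ → ℕ} {i : ℕ} (hf : ∀ j < i, f j < B)
    (hf' : ∀ j < i, f' j < B) (H : horner B h f i = horner B h' f' i) :
    h = h' ∧ ∀ j < i, f j = f' j := by
  induction i with
  | zero => exact ⟨H, fun j hj => by omega⟩
  | succ i ih =>
    simp only [horner] at H
    have h1 := hf i (by omega)
    have h2 := hf' i (by omega)
    have hd : horner B h f i = horner B h' f' i := by
      have := congrArg (· / B) H
      simpa [Nat.add_div_of_dvd_right, Nat.mul_div_cancel _ (show 0 < B by omega),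
        Nat.div_eq_of_lt h1, Nat.div_eq_of_lt h2] using this
    have hm : f i = f' i := by rw [hd] at H; omega
    obtain ⟨h3, h4⟩ := ih (fun j hj => hf j (by omega)) (fun j hj => hf' j (by omega)) hd
    refine ⟨h3, fun j hj => ?_⟩
    rcases Nat.lt_succ_iff_lt_or_eq.mp hj with h | rfl
    · exact h4 j h
    · exact hm

/-- Extend a function on `Fin n` by zero. -/
def toNat (f : Fin n → ℕ) (i : ℕ) : ℕ := if h : i < n then f ⟨i, h⟩ else 0

theorem toNat_val (f : Fin n → ℕ) (i : Fin n) : toNat f i = f i := by simp [toNat]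

/-- The parity of the leading part is the mode. In mode 1 the start is the root and the length is
recorded; in mode 0 the start is recorded and the length is omitted on purpose. -/
def Data.key (D : Data n) (s : Entry n) : ℕ :=
  horner (2 * D.L + 3) (if s.mode = 1 then 2 * s.p + 1 else 2 * s.start)
    (toNat fun y => D.dig s.mode s.p (s.pos y)) n

theorem Data.key_eq_iff {D : Data n} {s t : Entry n} (hs : D.Good s) (ht : D.Good t) :
    D.key s = D.key t ↔ D.Same s t := by
  have hms := hs.mode
  have hmt := ht.mode
  constructor
  · intro h
    have hB : ∀ s : Entry n, ∀ j < n,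
        toNat (fun y => D.dig s.mode s.p (s.pos y)) j < 2 * D.L + 3 := fun s j hj => by
      simp only [toNat, hj, dite_true]
      exact D.dig_lt
    obtain ⟨h1, h2⟩ := horner_inj (hB s) (hB t) h
    refine ⟨?_, fun hm => ?_, ?_, fun y => ?_⟩
    · split_ifs at h1 <;> omega
    · split_ifs at h1 <;> omega
    · split_ifs at h1
      · rcases hms with h | h <;> rcases hmt with h' | h' <;> omega
      · omega
      · omega
      · exact Fin.ext (by omega)
    · have := h2 y y.2
      rwa [toNat_val, toNat_val] at this
  · intro h
    unfold Data.key
    rw [h.start]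
    congr 1
    · rw [h.mode]
      split_ifs with h1
      · rw [h.p (h.mode.trans h1)]
      · rfl
    · congr 1
      funext y
      exact h.dig y

/-! #### The number of keys -/

/-- Finite codes for checked entries. -/
abbrev Code (n L B : ℕ) : Type :=
  Bool × Fin (n * L + 1) × Fin n × (Fin L → Option (Fin B)) × (Fin L → Option (Fin B)) ×
    (Fin (2 * L) → Option (Bool × Fin L × Fin B))

/-- The vertex a window slot refers to, given an enumeration `en` of the balls. -/
def slot {L B : ℕ} (en : Fin n → Fin B → Fin n) (root last : Fin n)
    (W W₀ : Fin L → Option (Fin B)) (b : Bool) (k : Fin L) : Option (Fin n) :=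
  if b then (W₀ k).map (en root) else (W k).map (en last)

/-- `c` is a code for `s`. -/
structure Data.Decodes (D : Data n) {B : ℕ} (en : Fin n → Fin B → Fin n) (s : Entry n)
    (c : Code n D.L B) : Prop where
  mode : c.1 = true ↔ s.mode = 1
  num : (c.2.1 : ℕ) = if s.mode = 1 then s.p else s.start
  last : c.2.2.1 = s.last
  win : ∀ (j : Fin D.L) (y : Fin n), (s.pos y ≠ 0 ∧ s.pos y + j = s.p) ↔
    slot en D.root s.last c.2.2.2.1 c.2.2.2.2.1 false j = some y
  win₀ : ∀ (j : Fin D.L) (y : Fin n), (s.mode = 1 ∧ s.pos y = j + 1) ↔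
    slot en D.root s.last c.2.2.2.1 c.2.2.2.2.1 true j = some y
  bdry : ∀ z, z ∈ D.bdry s.pos ↔ ∃ j b k i y, c.2.2.2.2.2 j = some (b, k, i) ∧
    slot en D.root s.last c.2.2.2.1 c.2.2.2.2.1 b k = some y ∧ z = en y i

/-- Used for a single position of a window, which is empty or holds one vertex taken from an
enumerated ball. -/
theorem exists_option {α β : Type*} (P : β → Prop) (f : α → β) (h : ∀ y, P y → ∃ i, f i = y)
    (hP : ∀ y y', P y → P y' → y = y') : ∃ o : Option α, ∀ y, P y ↔ o.map f = some y := by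
  by_cases hy : ∃ y, P y
  · obtain ⟨y, hy⟩ := hy
    obtain ⟨i, hi⟩ := h y hy
    refine ⟨some i, fun y' => ?_⟩
    simp only [Option.map_some, Option.some.injEq, hi]
    exact ⟨fun h => hP _ _ hy h, fun h => h ▸ hy⟩
  · exact ⟨none, fun y => by simpa using fun h => hy ⟨y, h⟩⟩

theorem exists_enum {α : Type*} {k : ℕ} (S : Finset α) (h : S.card ≤ k) :
    ∃ g : Fin k → Option α, ∀ z, z ∈ S ↔ ∃ j, g j = some z := by
  refine ⟨fun j => if hj : (j : ℕ) < S.card then some (S.equivFin.symm ⟨j, hj⟩) else none,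
    fun z => ⟨fun hz => ?_, ?_⟩⟩
  · refine ⟨⟨S.equivFin ⟨z, hz⟩, (S.equivFin ⟨z, hz⟩).2.trans_le h⟩, ?_⟩
    simp
  · rintro ⟨j, hj⟩
    dsimp only at hj
    split_ifs at hj with hlt
    rw [← Option.some.inj hj]
    exact (S.equivFin.symm ⟨j, hlt⟩).2

/-- By non-contraction, window occupants lie in the balls about the last vertex and about the root,
so an index into the enumerated ball names them. A boundary vertex is a neighbour of a placed
vertex, which has a free neighbour and thus occupies a window slot; slot and index in the ball of
the occupant name the boundary vertex. -/
theorem Data.exists_decodes {D : Data n} (hD : D.Proper) {B : ℕ} {en : Fin n → Fin B → Fin n}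
    (hen : ∀ v u, D.dc v u ≤ D.L + 1 → ∃ i, en v i = u) {s : Entry n} (hs : D.Good s)
    (hc : D.Checked s) (hL : 1 ≤ D.L) : ∃ c : Code n D.L B, D.Decodes en s c := by
  have hlp := hs.pos_last
  have hW : ∀ j : Fin D.L, ∃ o : Option (Fin B), ∀ y, (s.pos y ≠ 0 ∧ s.pos y + j = s.p) ↔
      o.map (en s.last) = some y := fun j => by
    refine exists_option _ _ (fun y hy => hen _ _ ?_) fun y y' hy hy' =>
      hs.inj _ _ hy.1 (by omega)
    have := hs.dc y s.last hy.1 (by omega)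
    rw [hD.dc_comm]
    have := j.2
    omega
  have hW₀ : ∀ j : Fin D.L, ∃ o : Option (Fin B), ∀ y, (s.mode = 1 ∧ s.pos y = j + 1) ↔
      o.map (en D.root) = some y := fun j => by
    refine exists_option _ _ (fun y hy => hen _ _ ?_) fun y y' hy hy' =>
      hs.inj _ _ (by omega) (by omega)
    have h1 : s.start = D.root := by
      rcases hs.mode with h | h
      · omega
      · exact h.2
    have h2 := hs.pos_start
    have := hs.dc s.start y (by omega) (by omega)
    rw [h1] at this
    have := j.2
    omega
  choose W hW using hW
  choose W₀ hW₀ using hW₀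
  obtain ⟨g, hg⟩ := exists_enum _ hc.card
  have hU : ∀ j : Fin (2 * D.L), ∃ o : Option (Bool × Fin D.L × Fin B), ∀ z, g j = some z ↔
      ∃ b k i y, o = some (b, k, i) ∧ slot en D.root s.last W W₀ b k = some y ∧ z = en y i :=
    fun j => by
    rcases hgj : g j with _ | z
    · exact ⟨none, fun z => by simp⟩
    · have hz := (hg z).2 ⟨j, hgj⟩
      simp only [Data.bdry, Finset.mem_filter, Finset.mem_univ, true_and] at hz
      obtain ⟨hz0, y, hy, he⟩ := hz
      obtain ⟨i, hi⟩ := hen y z (hD.e_dc y z he)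
      have hsl : ∃ b k, slot en D.root s.last W W₀ b k = some y := by
        have hle := hs.le_p y
        rcases hc.near y hy ⟨z, hz0, by rwa [hD.e_comm]⟩ with h | h
        · exact ⟨false, ⟨s.p - s.pos y, by omega⟩, (hW _ y).1 ⟨hy, by dsimp only; omega⟩⟩
        · exact ⟨true, ⟨s.pos y - 1, by omega⟩, (hW₀ _ y).1 ⟨h.1, by dsimp only; omega⟩⟩
      obtain ⟨b, k, hbk⟩ := hsl
      refine ⟨some (b, k, i), fun z' => ⟨?_, ?_⟩⟩
      · rintro h
        obtain rfl := Option.some.inj h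
        exact ⟨b, k, i, y, rfl, hbk, hi.symm⟩
      · rintro ⟨b', k', i', y', h1, h2, rfl⟩
        simp only [Option.some.injEq, Prod.mk.injEq] at h1
        obtain ⟨rfl, rfl, rfl⟩ := h1
        rw [hbk] at h2
        obtain rfl := Option.some.inj h2
        rw [hi]
  choose U hU using hU
  have hp := hs.p_le_mul hL
  refine ⟨(decide (s.mode = 1), ⟨if s.mode = 1 then s.p else s.start, ?_⟩, s.last, W, W₀, U),
    by simp, rfl, rfl, fun j y => hW j y, fun j y => hW₀ j y, fun z => ?_⟩
  · split_ifs
    · omega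
    · have := s.start.2
      have := Nat.le_mul_of_pos_right n hL
      omega
  · rw [hg]
    exact exists_congr fun j => hU j z

/-- The windows fix every digit except for the question whether a vertex outside them is placed.
Suppose some vertices are placed in `s` but not in `t`; an edge from such an `a` leads to a `b` not
of this kind. If `b` is unplaced in `s`, then `a` is near in `s`, lies in a common window and is
placed in `t`. If `b` is placed in `s`, it is placed in `t` too, so `a` belongs to the boundary of
`t`, which is the boundary of `s`, and is unplaced in `s`. Both are absurd. -/
theorem Data.Decodes.same {D : Data n} (hD : D.Proper) {B : ℕ} {en : Fin n → Fin B → Fin n}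
    {s t : Entry n} {c : Code n D.L B} (h : D.Decodes en s c) (h' : D.Decodes en t c)
    (hs : D.Good s) (ht : D.Good t) (hcs : D.Checked s) (hct : D.Checked t) : D.Same s t := by
  have hms := hs.mode
  have hmt := ht.mode
  have hmode : s.mode = t.mode := by
    have h1 := h.mode.symm.trans h'.mode
    omega
  have hnum := h.num.symm.trans h'.num
  have hp : s.mode = 1 → s.p = t.p := fun hm => by
    rwa [if_pos hm, if_pos (hmode ▸ hm)] at hnum
  have hst : s.start = t.start := by
    rcases hms with hm | hm
    · rw [if_neg (by omega), if_neg (by omega)] at hnum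
      exact Fin.ext hnum
    · rw [hm.2, (hmt.resolve_left (by omega)).2]
  have hlast : s.last = t.last := h.last.symm.trans h'.last
  have hwin : ∀ (j : Fin D.L) (y : Fin n), (s.pos y ≠ 0 ∧ s.pos y + j = s.p) ↔
      (t.pos y ≠ 0 ∧ t.pos y + j = t.p) := fun j y => by rw [h.win, h'.win, hlast]
  have hwin₀ : ∀ (j : Fin D.L) (y : Fin n), (s.mode = 1 ∧ s.pos y = j + 1) ↔
      (t.mode = 1 ∧ t.pos y = j + 1) := fun j y => by rw [h.win₀, h'.win₀, hlast]
  have hbd : D.bdry s.pos = D.bdry t.pos := by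
    ext z
    rw [h.bdry, h'.bdry, hlast]
  clear h h'
  have near : ∀ s t : Entry n, D.Good s → (∀ (j : Fin D.L) (y : Fin n),
      (s.pos y ≠ 0 ∧ s.pos y + j = s.p) ↔ (t.pos y ≠ 0 ∧ t.pos y + j = t.p)) →
      (∀ (j : Fin D.L) (y : Fin n), (s.mode = 1 ∧ s.pos y = j + 1) ↔
      (t.mode = 1 ∧ t.pos y = j + 1)) → ∀ y, s.pos y ≠ 0 → D.Near s.mode s.p (s.pos y) →
      (t.pos y ≠ 0 ∧ s.pos y + t.p = t.pos y + s.p) ∨ (s.mode = 1 ∧ t.pos y = s.pos y) := by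
    intro s t hs hw hw₀ y hy hn
    have := hs.le_p y
    rcases hn with hn | hn
    · have := (hw ⟨s.p - s.pos y, by omega⟩ y).1 ⟨hy, by dsimp only; omega⟩
      dsimp only at this
      left
      omega
    · have := (hw₀ ⟨s.pos y - 1, by omega⟩ y).1 ⟨hn.1, by dsimp only; omega⟩
      dsimp only at this
      right
      omega
  have sub : ∀ s t : Entry n, D.Good s → D.Good t → D.Checked s → (∀ (j : Fin D.L) (y : Fin n),
      (s.pos y ≠ 0 ∧ s.pos y + j = s.p) ↔ (t.pos y ≠ 0 ∧ t.pos y + j = t.p)) →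
      (∀ (j : Fin D.L) (y : Fin n), (s.mode = 1 ∧ s.pos y = j + 1) ↔
      (t.mode = 1 ∧ t.pos y = j + 1)) → D.bdry s.pos = D.bdry t.pos →
      ∀ y, s.pos y ≠ 0 → t.pos y ≠ 0 := by
    intro s t hs ht hc hw hw₀ hb y hy hty
    -- The start of `t` is placed in `t`, so the set is not everything and some edge leaves it.
    obtain ⟨a, ha, b, hb', he⟩ := hD.conn {y | s.pos y ≠ 0 ∧ t.pos y = 0} ⟨y, hy, hty⟩
      ⟨t.start, fun hx => by have := ht.pos_start; have := hx.2; omega⟩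
    simp only [Set.mem_ofPred_eq, not_and] at ha hb'
    by_cases hbs : s.pos b = 0
    · rcases near s t hs hw hw₀ a ha.1 (hc.near a ha.1 ⟨b, hbs, by rwa [hD.e_comm]⟩) with h | h
      · exact h.1 ha.2
      · exact ha.1 (h.2 ▸ ha.2)
    · have : a ∈ D.bdry t.pos := by
        simp only [Data.bdry, Finset.mem_filter, Finset.mem_univ, true_and]
        exact ⟨ha.2, b, hb' hbs, by rwa [hD.e_comm]⟩
      rw [← hb] at this
      simp only [Data.bdry, Finset.mem_filter, Finset.mem_univ, true_and] at this
      exact ha.1 this.1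
  refine ⟨hmode, hp, hst, fun y => ?_⟩
  have h1 := sub s t hs ht hcs hwin hwin₀ hbd y
  have h2 := sub t s ht hs hct (fun j y => (hwin j y).symm) (fun j y => (hwin₀ j y).symm)
    hbd.symm y
  have h3 := near s t hs hwin hwin₀ y
  have h4 := near t s ht (fun j y => (hwin j y).symm) (fun j y => (hwin₀ j y).symm) y
  have h5 := hs.le_p y
  have h6 := ht.le_p y
  unfold Data.Near at h3 h4
  unfold Data.dig
  split_ifs <;> omega

theorem card_code (n L B : ℕ) : Fintype.card (Code n L B) =
    2 * ((n * L + 1) * (n * ((B + 1) ^ L * ((B + 1) ^ L * (2 * (L * B) + 1) ^ (2 * L))))) := by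
  simp [Fintype.card_option]

/-- The number of checked entries with different keys. -/
theorem Data.card_entries_le {D : Data n} (hD : D.Proper) {B : ℕ}
    (hB : ∀ v, (Finset.univ.filter fun u => D.dc v u ≤ D.L + 1).card ≤ B) (hL : 1 ≤ D.L) {k : ℕ}
    (f : Fin k → Entry n) (hg : ∀ j, D.Good (f j)) (hc : ∀ j, D.Checked (f j))
    (hf : ∀ i j, D.Same (f i) (f j) → i = j) : k ≤ Fintype.card (Code n D.L B) := by
  have hen : ∃ en : Fin n → Fin B → Fin n, ∀ v u, D.dc v u ≤ D.L + 1 → ∃ i, en v i = u := by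
    have : ∀ v : Fin n, ∃ en : Fin B → Fin n, ∀ u, D.dc v u ≤ D.L + 1 → ∃ i, en i = u := fun v => by
      obtain ⟨g, hg⟩ := exists_enum _ (hB v)
      refine ⟨fun j => (g j).getD v, fun u hu => ?_⟩
      obtain ⟨j, hj⟩ := (hg u).1 (by simpa using hu)
      exact ⟨j, by simp [hj]⟩
    choose en hen using this
    exact ⟨en, hen⟩
  obtain ⟨en, hen⟩ := hen
  choose c hc' using fun j => D.exists_decodes hD hen (hg j) (hc j) hL
  have hinj : Function.Injective c := fun i j hij =>
    hf i j (Data.Decodes.same hD (hc' i) (hij ▸ hc' j) (hg i) (hg j) (hc i) (hc j))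
  simpa using Fintype.card_le_of_injective c hinj

end CyclePlacement

namespace CyclePlacement
variable {n : ℕ}

/-! #### Solutions and complete entries -/

/-- Distance on the cycle of length `N`. -/
def cdist (N a b : ℕ) : ℕ := min (a - b + (b - a)) (N - (a - b + (b - a)))

structure Data.IsSol (D : Data n) (F : Fin n → ℕ) : Prop where
  lt : ∀ v, F v < D.N
  inj : Function.Injective F
  dc : ∀ u v, D.dc u v ≤ cdist D.N (F u) (F v)
  edge : ∀ u v, 0 < D.e u v → cdist D.N (F u) (F v) < D.e u v

theorem Entry.pos_ne_zero {s : Entry n} (h : s.size = n) (y : Fin n) :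
    s.pos y ≠ 0 := by
  have : (Finset.univ.filter fun y => s.pos y ≠ 0) = Finset.univ :=
    Finset.eq_univ_of_card _ (h.trans (Fintype.card_fin n).symm)
  have hy := Finset.mem_univ y
  rw [← this] at hy
  simpa using hy

/-- One arc between two images is controlled by the invariant `dc`, the complementary arc by the
detour through start and last vertex together with the closing condition. -/
theorem Data.Good.isSol {D : Data n} (hD : D.Proper) (hN : 1 ≤ D.N) {s : Entry n} (hs : D.Good s)
    (hf : D.Final s) : D.IsSol fun v => s.pos v - 1 := by
  have hpos : ∀ y, s.pos y ≠ 0 := Entry.pos_ne_zero hf.size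
  have hpN := hs.le_N
  have key : ∀ u v, s.pos u ≤ s.pos v → D.dc u v ≤ cdist D.N (s.pos u - 1) (s.pos v - 1) := by
    intro u v huv
    have h1 := hs.dc u v (hpos u) huv
    have h2 := hs.dc s.start u (by rw [hs.pos_start]; omega)
      (by rw [hs.pos_start]; have := hpos u; omega)
    have h3 := hs.dc v s.last (hpos v) (by rw [hs.pos_last]; exact hs.le_p v)
    have h4 := hf.close
    -- Along `u`, start, last, `v` the distances are at most `pos u - 1`, `N + 1 - p` and `p - pos
    -- v`, with sum `N - (pos v - pos u)`.
    have h5 := hD.dc_tri u s.start v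
    have h6 := hD.dc_tri s.start s.last v
    rw [hD.dc_comm u s.start] at h5
    rw [hD.dc_comm s.start s.last, hD.dc_comm s.last v] at h6
    rw [hs.pos_start] at h2
    rw [hs.pos_last] at h3
    have := hpos u
    have := hpos v
    have := hs.le_p v
    unfold cdist
    omega
  have hcomm : ∀ a b, cdist D.N a b = cdist D.N b a := fun a b => by unfold cdist; omega
  refine ⟨fun v => ?_, fun u v huv => ?_, fun u v => ?_, fun u v he => ?_⟩
  · have := hs.le_p v
    omega
  · have := hpos u
    have := hpos v
    exact hs.inj u v (hpos u) (by omega)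
  · rcases le_total (s.pos u) (s.pos v) with h | h
    · exact key u v h
    · rw [hD.dc_comm, hcomm]
      exact key v u h
  · have h0 := hpos u
    have h0' := hpos v
    rcases le_total (s.pos u) (s.pos v) with h | h
    · have := hs.edge u v (hpos u) h he
      unfold Data.EdgeOk at this
      unfold cdist
      omega
    · rw [hD.e_comm] at he ⊢
      have := hs.edge v u (hpos v) h he
      unfold Data.EdgeOk at this
      unfold cdist
      omega

/-- The initial segment, ending in `v`, of the placement `q`. -/
def segment (mode : ℕ) (r : Fin n) (q : Fin n → ℕ) (v : Fin n) : Entry n :=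
  ⟨mode, r, v, q v, fun y => if q y ≤ q v then q y else 0⟩

/-- Induction on the position of `v`: the segment ending in `v` extends the one ending in the vertex
just before `v`. The point is that true solutions pass the tests in `Data.Checked`, so pruning loses
nothing. -/
theorem Data.reach_segment {D : Data n} (hD : D.Proper) {mode : ℕ} {r : Fin n} {q : Fin n → ℕ}
    (hmode : mode = 0 ∨ (mode = 1 ∧ r = D.root)) (hr : q r = 1) (hq1 : ∀ y, 1 ≤ q y)
    (hqN : ∀ y, q y ≤ D.N) (hinj : Function.Injective q)
    (hdc : ∀ x y, q x ≤ q y → D.dc x y ≤ q y - q x)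
    (hedge : ∀ x y, q x ≤ q y → 0 < D.e x y → D.EdgeOk mode (q x) (q y) (D.e x y))
    (hgap : ∀ v, v ≠ r → ∃ v', q v' < q v ∧ q v ≤ q v' + D.L) (v : Fin n) :
    D.Reach (segment mode r q v) := by
  induction hk : q v using Nat.strong_induction_on generalizing v with
  | _ k ih =>
    subst hk
    by_cases hv : v = r
    · subst hv
      have : segment mode v q v = Entry.init mode v := by
        simp only [segment, Entry.init, hr, Entry.mk.injEq, true_and]
        funext y
        by_cases hy : y = v
        · subst hy
          simp [hr]
        · have : q y ≠ 1 := fun h => hy (hinj (h.trans hr.symm))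
          have := hq1 y
          rw [if_neg (by omega), Pi.single_eq_of_ne hy]
      rw [this]
      rcases hmode with rfl | ⟨rfl, rfl⟩
      · exact .lin v
      · exact .cyc
    · obtain ⟨w, hw1, hw2⟩ := hgap v hv
      obtain ⟨v', hv', hmax⟩ := (Finset.univ.filter fun y => q y < q v).exists_max_image q
        ⟨w, by simpa using hw1⟩
      simp only [Finset.mem_filter, Finset.mem_univ, true_and] at hv' hmax
      have hwv := hmax w hw1
      have hext : (segment mode r q v').ext v (q v - q v') = segment mode r q v := by
        have : q v' + (q v - q v') = q v := by omega
        simp only [segment, Entry.ext, this, Entry.mk.injEq, true_and]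
        funext y
        by_cases hy : y = v
        · subst hy
          simp
        · rw [Function.update_of_ne hy]
          have h1 : q y ≠ q v := fun h => hy (hinj h)
          have h2 := hmax y
          split_ifs <;> omega
      have hchk : D.Checked (segment mode r q v) := by
        -- An edge from the placed to the unplaced side either is short along the line or runs
        -- around the cycle.
        have hE : ∀ y z, q y ≤ q v → q v < q z → 0 < D.e y z →
            q z ≤ q y + D.L ∨ (mode = 1 ∧ D.N + q y ≤ q z + D.L) := by
          intro y z hy hz he
          have h1 := hedge y z (by omega) he
          have h2 := hD.e_le y z
          have h3 := hqN z
          unfold Data.EdgeOk at h1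
          omega
        have hpos0 : ∀ y, (segment mode r q v).pos y = 0 ↔ q v < q y := fun y => by
          have := hq1 y
          simp only [segment]
          split_ifs <;> omega
        refine ⟨?_, ?_⟩
        · rintro y hy ⟨z, hz, he⟩
          rw [hpos0] at hz
          rw [Ne, hpos0, not_lt] at hy
          have h1 := hE y z hy hz (by rwa [hD.e_comm])
          have h3 := hqN z
          have : (segment mode r q v).pos y = q y := by simp [segment, hy]
          rw [this]
          change q v < _ ∨ mode = 1 ∧ _
          omega
        -- Boundary vertices are mapped injectively into the `L` positions after `v` and, by edges
        -- around the cycle, into the last `L` positions. This is the source of the bound `2 * L`.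
        · have hcard : (Finset.Ioc (q v) (q v + D.L) ∪ Finset.Ioc (D.N - D.L) D.N).card
              ≤ 2 * D.L := by
            refine (Finset.card_union_le _ _).trans ?_
            simp only [Nat.card_Ioc]
            omega
          refine le_trans (Finset.card_le_card_of_injOn q ?_ hinj.injOn) hcard
          intro z hz
          simp only [Data.bdry, Finset.coe_filter, Finset.mem_univ, true_and, Set.mem_ofPred_eq,
            hpos0] at hz
          obtain ⟨hz, y, hy, he⟩ := hz
          rw [Ne, hpos0, not_lt] at hy
          have h1 := hE y z hy hz he
          have h2 := hq1 y
          have h3 := hqN z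
          simp only [Finset.coe_union, Finset.coe_Ioc, Set.mem_union, Set.mem_Ioc]
          omega
      rw [← hext] at hchk ⊢
      refine .step (ih _ hv' v' rfl) ⟨?_, by omega, by omega, hdc v' v hv'.le, ?_, ?_, hchk⟩
      · simp only [segment]
        rw [if_neg (by omega)]
      · have := hqN v
        change q v' + _ ≤ _
        omega
      · intro y hy he
        have hyv : q y ≤ q v' := by
          by_contra hc
          exact hy (if_neg hc)
        have h1 : (segment mode r q v').pos y = q y := if_pos hyv
        rw [hD.e_comm] at he ⊢
        rw [h1]
        change D.EdgeOk mode (q y) (q v' + (q v - q v')) _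
        have : q v' + (q v - q v') = q v := by omega
        rw [this]
        exact hedge y v (by omega) he

/-- It remains to choose where the cycle is cut, so that all gaps between consecutive positions are
at most `L` and the edges obey the rule of the mode. -/
theorem Data.IsSol.exists_final {D : Data n} (hD : D.Proper) {F : Fin n → ℕ} (hF : D.IsSol F) :
    ∃ s, D.Reach s ∧ D.Final s := by
  -- Positions after rotating the cycle so that `r` comes first, at position 1.
  let q : Fin n → Fin n → ℕ := fun r v =>
    if F r ≤ F v then F v - F r + 1 else F v + D.N - F r + 1
  have hr : ∀ r, q r r = 1 := fun r => by simp [q]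
  have hq1 : ∀ r y, 1 ≤ q r y := fun r y => by simp only [q]; split_ifs <;> omega
  have hqN : ∀ r y, q r y ≤ D.N := fun r y => by
    have := hF.lt y
    have := hF.lt r
    simp only [q]
    split_ifs <;> omega
  have hinj : ∀ r, Function.Injective (q r) := fun r x y h => by
    have h1 := hF.lt x
    have h2 := hF.lt y
    have h3 := hF.lt r
    apply hF.inj
    simp only [q] at h
    split_ifs at h <;> omega
  have hcd : ∀ r x y, q r x ≤ q r y →
      cdist D.N (F x) (F y) = min (q r y - q r x) (D.N - (q r y - q r x)) := fun r x y h => by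
    have h1 := hF.lt x
    have h2 := hF.lt y
    have h3 := hF.lt r
    unfold cdist
    simp only [q] at h ⊢
    split_ifs at h ⊢ <;> omega
  have hdc : ∀ r x y, q r x ≤ q r y → D.dc x y ≤ q r y - q r x := fun r x y h => by
    have h1 := hF.dc x y
    rw [hcd r x y h] at h1
    omega
  suffices H : ∃ mode r, (mode = 0 ∨ (mode = 1 ∧ r = D.root)) ∧
      (∀ x y, q r x ≤ q r y → 0 < D.e x y → D.EdgeOk mode (q r x) (q r y) (D.e x y)) ∧
      (∀ v, v ≠ r → ∃ v', q r v' < q r v ∧ q r v ≤ q r v' + D.L) by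
    obtain ⟨mode, r, hmode, hedge, hgap⟩ := H
    have key := fun v => D.reach_segment hD hmode (hr r) (hq1 r) (hqN r) (hinj r) (hdc r) hedge
      hgap v
    obtain ⟨v, -, hv⟩ := Finset.univ.exists_max_image (q r) ⟨r, Finset.mem_univ r⟩
    refine ⟨_, key v, ?_, ?_⟩
    · have : (Finset.univ.filter fun y => (segment mode r (q r) v).pos y ≠ 0) = Finset.univ := by
        ext y
        have h1 := hv y (Finset.mem_univ y)
        have h2 := hq1 r y
        have h3 : (segment mode r (q r) v).pos y = q r y := if_pos h1
        simp only [h3, Finset.mem_filter, Finset.mem_univ, true_and, iff_true]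
        omega
      rw [Entry.size, this, Finset.card_univ, Fintype.card_fin]
    -- The closing condition is non-contraction along the arc from the last vertex onwards to `r`.
    · change D.dc v r + q r v ≤ D.N + 1
      have h1 := hF.dc r v
      rw [hcd r r v (by rw [hr]; exact hq1 r v), hr, hD.dc_comm] at h1
      have := hqN r v
      have := hq1 r v
      omega
  -- If, seen from the root, every vertex has a predecessor within `L`, mode 1 applies. Otherwise a
  -- vertex `r` follows a gap longer than `L`, and the cycle is cut before `r`.
  by_cases hbig : ∀ v, v ≠ D.root → ∃ v', q D.root v' < q D.root v ∧
      q D.root v ≤ q D.root v' + D.L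
  · by_cases hlast : ∀ x y, q D.root x ≤ q D.root y → 0 < D.e x y →
        D.EdgeOk 1 (q D.root x) (q D.root y) (D.e x y)
    · exact ⟨1, D.root, Or.inr ⟨rfl, rfl⟩, hlast, hbig⟩
    · exfalso
      apply hlast
      intro x y h he
      have h1 := hF.edge x y he
      rw [hcd _ x y h] at h1
      unfold Data.EdgeOk
      omega
  · push Not at hbig
    obtain ⟨r, hrr, hr'⟩ := hbig
    -- The way from any `x` onwards to `r` passes through the long gap, so no edge can use it.
    have hclose : ∀ x, x ≠ r → D.L < D.N + 1 - q r x := by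
      intro x hx
      have h1 := hr' x
      have h2 := hF.lt x
      have h3 := hF.lt r
      have h4 := hF.lt D.root
      have h5 : F x ≠ F r := fun h => hx (hF.inj h)
      have h6 : F D.root ≠ F r := fun h => hrr (hF.inj h).symm
      have h7 := hr' D.root
      simp only [q] at h1 h7 ⊢
      split_ifs at h1 h7 ⊢ <;> omega
    have hedge : ∀ x y, q r x ≤ q r y → 0 < D.e x y → q r y - q r x < D.e x y := by
      intro x y h he
      have h1 := hF.edge x y he
      rw [hcd r x y h] at h1
      have h2 := hD.e_le x y
      have h3 := hq1 r x
      have h4 := hqN r y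
      by_cases hy : y = r
      · subst hy
        rw [hr] at *
        omega
      · have := hclose y hy
        omega
    refine ⟨0, r, Or.inl rfl, fun x y h he => Or.inl (hedge x y h he), fun v hv => ?_⟩
    by_contra hc
    push Not at hc
    have hrv : q r r < q r v := by
      have h1 := hq1 r v
      have h2 : q r v ≠ q r r := fun h => hv (hinj r h)
      rw [hr] at *
      omega
    -- Connectedness yields an edge across the supposed gap before `v`; its image would have to be
    -- longer than `L`.
    obtain ⟨a, ha, b, hb, he⟩ := hD.conn {y | q r y < q r v} ⟨r, hrv⟩
      ⟨v, by simp⟩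
    simp only [Set.mem_ofPred_eq, not_lt] at ha hb
    have h1 := hedge a b (by omega) he
    have h2 := hc a ha
    have h3 := hD.e_le a b
    omega

/-! #### The worklist -/

/-- A worklist: the entries `ent 0, …, ent (m - 1)`. -/
structure Config (n : ℕ) where
  m : ℕ
  ent : ℕ → Entry n

/-- Some entry of the worklist has the same key as `t` and is not longer. -/
def Config.Cov (D : Data n) (c : Config n) (t : Entry n) : Prop :=
  ∃ j < c.m, D.Same (c.ent j) t ∧ (c.ent j).p ≤ t.p

/-- The effect of inserting `t` into the worklist. -/
inductive Data.Ins (D : Data n) (c : Config n) (t : Entry n) : Config n → Prop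
  | old (j : ℕ) : n + 1 ≤ j → j < c.m → D.Same (c.ent j) t → (c.ent j).p ≤ t.p → Ins D c t c
  | upd (j : ℕ) : n + 1 ≤ j → j < c.m → D.Same (c.ent j) t → t.p < (c.ent j).p →
      Ins D c t ⟨c.m, Function.update c.ent j t⟩
  | new : (∀ j, n + 1 ≤ j → j < c.m → ¬ D.Same (c.ent j) t) →
      Ins D c t ⟨c.m + 1, Function.update c.ent c.m t⟩

/-- The `t`-th entry the worklist is started with. -/
def Data.startEntry (D : Data n) (t : ℕ) : Entry n :=
  if h : 1 ≤ t ∧ t ≤ n then Entry.init 0 ⟨t - 1, by omega⟩ else Entry.init 1 D.root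

/-- The invariant of the worklist when the first `k` entries have been processed. -/
structure Data.Inv (D : Data n) (k : ℕ) (c : Config n) : Prop where
  lt_m : n + 1 ≤ c.m
  k_le : k ≤ c.m
  start : ∀ t ≤ n, c.ent t = D.startEntry t
  reach : ∀ j < c.m, D.Reach (c.ent j)
  checked : ∀ j, n + 1 ≤ j → j < c.m → 1 ≤ D.L ∧ D.Checked (c.ent j)
  inj : ∀ i j, n + 1 ≤ i → i < c.m → n + 1 ≤ j → j < c.m → D.Same (c.ent i) (c.ent j) → i = j
  mono : ∀ i j, i ≤ j → j < c.m → (c.ent i).size ≤ (c.ent j).size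
  size_le : k < c.m → ∀ j < c.m, (c.ent j).size ≤ (c.ent k).size + 1
  cov : ∀ j < k, ∀ u g, D.Succ (c.ent j) u g → c.Cov D ((c.ent j).ext u g)

theorem Data.startEntry_reach (D : Data n) (t : ℕ) : D.Reach (D.startEntry t) := by
  unfold Data.startEntry
  split_ifs
  · exact .lin _
  · exact .cyc

theorem Data.startEntry_size (D : Data n) (t : ℕ) : (D.startEntry t).size = 1 := by
  unfold Data.startEntry
  split_ifs <;> exact Entry.size_init _ _

theorem Data.inv_zero {D : Data n} {c : Config n} (hm : c.m = n + 1)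
    (hc : ∀ t ≤ n, c.ent t = D.startEntry t) : D.Inv 0 c := by
  have hs : ∀ j < c.m, (c.ent j).size = 1 := fun j hj => by
    rw [hc j (by omega), D.startEntry_size]
  refine ⟨hm.ge, Nat.zero_le _, hc, fun j hj => ?_, fun j h1 h2 => by omega,
    fun i j h1 h2 => by omega, fun i j h1 h2 => ?_, fun h j hj => ?_, fun j hj => by omega⟩
  · rw [hc j (by omega)]
    exact D.startEntry_reach j
  · rw [hs i (by omega), hs j h2]
  · rw [hs j hj]
    omega

theorem Data.Inv.next {D : Data n} {k : ℕ} {c : Config n} (h : D.Inv k c) (hk : k < c.m)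
    (hcov : ∀ u g, D.Succ (c.ent k) u g → c.Cov D ((c.ent k).ext u g)) : D.Inv (k + 1) c := by
  refine ⟨h.lt_m, hk, h.start, h.reach, h.checked, h.inj, h.mono, fun hk' j hj => ?_,
    fun j hj u g hs => ?_⟩
  · have h1 := h.size_le hk j hj
    have h2 := h.mono k (k + 1) (by omega) hk'
    omega
  · rcases Nat.lt_succ_iff_lt_or_eq.mp hj with hj' | rfl
    · exact h.cov j hj' u g hs
    · exact hcov u g hs

/-- Inserting a successor of entry `k` never touches entries up to `k`, and coverage never gets
worse: an overwritten entry is replaced by an equivalent shorter one. -/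
theorem Data.Inv.ins {D : Data n} {k : ℕ} {c c' : Config n} (h : D.Inv k c)
    (hk : k < c.m) {u : Fin n} {g : ℕ} (hs : D.Succ (c.ent k) u g)
    (hi : D.Ins c ((c.ent k).ext u g) c') :
    D.Inv k c' ∧ (∀ j ≤ k, c'.ent j = c.ent j) ∧ c.m ≤ c'.m ∧ (∀ t, c.Cov D t → c'.Cov D t) ∧
      c'.Cov D ((c.ent k).ext u g) := by
  have hsz := Entry.size_ext hs.new hs.one_le
  have hreach := Data.Reach.step (h.reach k hk) hs
  have hL := hs.one_le.trans hs.le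
  set t := (c.ent k).ext u g with ht
  have hlt := h.lt_m
  cases hi with
  | old j h1 h2 h3 h4 =>
    exact ⟨h, fun _ _ => rfl, le_rfl, fun _ h => h, j, h2, h3, h4⟩
  | upd j h1 h2 h3 h4 =>
    have hsj := h3.size_eq
    -- The entry to be replaced has one placed vertex more than entry `k`, while sizes do not
    -- decrease along the list; hence it comes after `k`.
    have hkj : ∀ i ≤ k, i ≠ j := by
      rintro i hik rfl
      have := h.mono i k hik hk
      omega
    have hold : ∀ i, i ≠ j → Function.update c.ent j t i = c.ent i :=
      fun i hi => Function.update_of_ne hi _ _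
    have hnew : Function.update c.ent j t j = t := Function.update_self _ _ _
    have hsame : ∀ i, D.Same (Function.update c.ent j t i) (c.ent i) := fun i => by
      by_cases hi : i = j
      · subst hi
        rw [hnew]
        exact h3.symm
      · rw [hold i hi]
        exact .refl _ _
    have hsize : ∀ i, (Function.update c.ent j t i).size = (c.ent i).size :=
      fun i => (hsame i).size_eq
    have hcov : ∀ x, c.Cov D x → Config.Cov D ⟨c.m, Function.update c.ent j t⟩ x := by
      rintro x ⟨i, hi, h5, h6⟩
      refine ⟨i, hi, (hsame i).trans h5, ?_⟩
      dsimp only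
      by_cases hij : i = j
      · subst hij
        rw [hnew]
        omega
      · rw [hold i hij]
        exact h6
    refine ⟨⟨hlt, h.k_le, fun i hi => ?_, fun i hi => ?_, fun i hi hi' => ?_,
      fun i i' h5 h6 h7 h8 h9 => ?_, fun i i' h5 h6 => ?_, fun h5 i hi => ?_,
      fun i hi u' g' h5 => ?_⟩, fun i hi => hold i (hkj i hi), le_rfl, hcov,
      j, h2, ?_, ?_⟩
    · dsimp only
      rw [hold i (by omega)]
      exact h.start i hi
    · dsimp only
      by_cases hij : i = j
      · subst hij
        rw [hnew]
        exact hreach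
      · rw [hold i hij]
        exact h.reach i hi
    · dsimp only
      by_cases hij : i = j
      · subst hij
        rw [hnew]
        exact ⟨hL, hs.checked⟩
      · rw [hold i hij]
        exact h.checked i hi hi'
    · exact h.inj i i' h5 h6 h7 h8 (((hsame i).symm.trans h9).trans (hsame i'))
    · dsimp only
      rw [hsize, hsize]
      exact h.mono i i' h5 h6
    · dsimp only
      rw [hsize, hsize]
      exact h.size_le h5 i hi
    · dsimp only at h5 ⊢
      rw [hold i (hkj i hi.le)] at h5 ⊢
      exact hcov _ (h.cov i hi u' g' h5)
    · dsimp only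
      rw [hnew]
      exact .refl _ _
    · dsimp only
      rw [hnew]
  | new h1 =>
    have hold : ∀ i, i < c.m → Function.update c.ent c.m t i = c.ent i :=
      fun i hi => Function.update_of_ne (by omega) _ _
    have hnew : Function.update c.ent c.m t c.m = t := Function.update_self _ _ _
    have hcov : ∀ x, c.Cov D x → Config.Cov D ⟨c.m + 1, Function.update c.ent c.m t⟩ x := by
      rintro x ⟨i, hi, h5, h6⟩
      refine ⟨i, by dsimp only; omega, ?_⟩
      dsimp only
      rw [hold i hi]
      exact ⟨h5, h6⟩
    have hcase : ∀ i < c.m + 1, i < c.m ∨ i = c.m := fun i hi => by omega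
    refine ⟨⟨by dsimp only; omega, by dsimp only; omega, fun i hi => ?_, fun i hi => ?_,
      fun i hi hi' => ?_, fun i i' h5 h6 h7 h8 h9 => ?_, fun i i' h5 h6 => ?_, fun h5 i hi => ?_,
      fun i hi u' g' h5 => ?_⟩, fun i hi => hold i (by omega), by dsimp only; omega, hcov,
      c.m, by dsimp only; omega, ?_, ?_⟩
    · dsimp only
      rw [hold i (by omega)]
      exact h.start i hi
    · dsimp only at hi ⊢
      rcases hcase i hi with hi | rfl
      · rw [hold i hi]
        exact h.reach i hi
      · rw [hnew]
        exact hreach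
    · dsimp only at hi' ⊢
      rcases hcase i hi' with hi' | rfl
      · rw [hold i hi']
        exact h.checked i hi hi'
      · rw [hnew]
        exact ⟨hL, hs.checked⟩
    · dsimp only at h6 h8 h9
      rcases hcase i h6 with h6 | rfl <;> rcases hcase i' h8 with h8 | rfl
      · rw [hold i h6, hold i' h8] at h9
        exact h.inj i i' h5 h6 h7 h8 h9
      · rw [hold i h6, hnew] at h9
        exact absurd h9 (h1 i h5 h6)
      · rw [hold i' h8, hnew] at h9
        exact absurd h9.symm (h1 i' h7 h8)
      · rfl
    · dsimp only at h6 ⊢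
      rcases hcase i' h6 with h6 | rfl
      · rw [hold i (by omega), hold i' h6]
        exact h.mono i i' h5 h6
      · rw [hnew]
        rcases hcase i (by omega) with h7 | rfl
        · rw [hold i h7, hsz]
          exact h.size_le hk i h7
        · rw [hnew]
    · dsimp only at hi ⊢
      rw [hold k hk]
      rcases hcase i hi with hi | rfl
      · rw [hold i hi]
        exact h.size_le hk i hi
      · rw [hnew, hsz]
    · dsimp only at h5 ⊢
      rw [hold i (by omega)] at h5 ⊢
      exact hcov _ (h.cov i hi u' g' h5)
    · dsimp only
      rw [hnew]
      exact .refl _ _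
    · dsimp only
      rw [hnew]

/-- The list entry covering the predecessor is equivalent to it and not longer, so by
`Data.Same.succ` it admits the same extension. That extension is covered because the list has been
processed completely. -/
theorem Data.Inv.cov_reach {D : Data n} (hD : D.Proper) {c : Config n} (h : D.Inv c.m c)
    {s : Entry n} (hs : D.Reach s) : c.Cov D s := by
  have hlt := h.lt_m
  induction hs with
  | cyc =>
    refine ⟨0, by omega, ?_⟩
    have : c.ent 0 = Entry.init 1 D.root := by
      rw [h.start 0 (by omega)]
      simp [Data.startEntry]
    rw [this]
    exact ⟨.refl _ _, le_rfl⟩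
  | lin r =>
    refine ⟨r + 1, by omega, ?_⟩
    have : c.ent (r + 1) = Entry.init 0 r := by
      rw [h.start _ (by omega), Data.startEntry, dif_pos (by omega)]
      rfl
    rw [this]
    exact ⟨.refl _ _, le_rfl⟩
  | step hs hsucc ih =>
    obtain ⟨j, hj, h1, h2⟩ := ih
    have h3 := h1.succ ((h.reach j hj).good hD) (hs.good hD) h2 hsucc
    obtain ⟨i, hi, h4, h5⟩ := h.cov j hj _ _ h3.1
    refine ⟨i, hi, h4.trans h3.2, h5.trans ?_⟩
    change (c.ent j).p + _ ≤ _ + _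
    omega

/-- When the worklist has been processed completely, it contains a complete solution if there is
one. -/
theorem Data.Inv.exists_final {D : Data n} (hD : D.Proper) (hn : 2 ≤ n) {c : Config n}
    (h : D.Inv c.m c) {F : Fin n → ℕ} (hF : D.IsSol F) : ∃ j < c.m, D.Final (c.ent j) := by
  obtain ⟨s, hs, hf⟩ := hF.exists_final hD
  obtain ⟨j, hj, h1, h2⟩ := h.cov_reach hD hs
  refine ⟨j, hj, h1.final ((h.reach j hj).good hD) (hs.good hD) ?_ h2 hf⟩
  -- With two vertices there is an edge; its ends have distinct images, which forces `1 ≤ L`.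
  obtain ⟨a, ha, b, hb, he⟩ := hD.conn {(⟨0, by omega⟩ : Fin n)} ⟨_, rfl⟩
    ⟨⟨1, by omega⟩, by simp⟩
  have h3 := hF.edge a b he
  have h4 := hD.e_le a b
  have h5 : F a ≠ F b := fun hc => hb (hF.inj hc ▸ ha)
  have h6 := hF.lt a
  have h7 := hF.lt b
  unfold cdist at h3
  omega

/-- The `n + 1` initial entries are counted separately, since they have passed no test. The inserted
ones are tested and pairwise inequivalent, and the presence of one shows `1 ≤ L`. -/
theorem Data.Inv.m_le {D : Data n} (hD : D.Proper) {B : ℕ}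
    (hB : ∀ v, (Finset.univ.filter fun u => D.dc v u ≤ D.L + 1).card ≤ B) {k : ℕ} {c : Config n}
    (h : D.Inv k c) : c.m ≤ n + 1 + Fintype.card (Code n D.L B) := by
  by_cases hm : c.m ≤ n + 1
  · omega
  have hL := (h.checked (n + 1) le_rfl (by omega)).1
  have := D.card_entries_le hD hB hL (k := c.m - (n + 1)) (fun j => c.ent (n + 1 + j))
    (fun j => (h.reach _ (by omega)).good hD)
    (fun j => (h.checked _ (by omega) (by omega)).2) (fun i j hij => ?_)
  · omega
  · have := h.inj _ _ (by omega) (by omega) (by omega) (by omega) hij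
    exact Fin.ext (by omega)

end CyclePlacement

/-! ### Weighted distances and distances on the cycle -/

section WeightedDist

variable {V : Type} {G : SimpleGraph V} {w : Sym2 V → ℝ}

theorem walk_weight_nonneg (hw : ∀ e ∈ G.edgeSet, 0 < w e) {u v : V} (p : G.Walk u v) :
    0 ≤ (p.edges.map w).sum := by
  refine List.sum_nonneg fun x hx => ?_
  obtain ⟨e, he, rfl⟩ := List.mem_map.1 hx
  exact (hw e (p.edges_subset_edgeSet he)).le

theorem weightedDist_le (hw : ∀ e ∈ G.edgeSet, 0 < w e) {u v : V} (p : G.Walk u v) :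
    weightedDist G w u v ≤ (p.edges.map w).sum :=
  ciInf_le ⟨0, by rintro _ ⟨q, rfl⟩; exact walk_weight_nonneg hw q⟩ p

/-- A function obeying the triangle inequality which is at most the weight on every edge is at most
the weighted distance. -/
theorem le_weightedDist (hG : G.Connected) {f : V → V → ℝ} (h0 : ∀ u, f u u ≤ 0)
    (htri : ∀ u v x, f u x ≤ f u v + f v x) (he : ∀ u v, G.Adj u v → f u v ≤ w s(u, v)) (u v : V) :
    f u v ≤ weightedDist G w u v := by
  have : Nonempty (G.Walk u v) := hG.preconnected u v
  refine le_ciInf fun p => ?_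
  clear this
  induction p with
  | nil => simpa using h0 _
  | cons h p ih =>
    have h1 := he _ _ h
    have h2 := htri _ _ _ |>.trans (add_le_add h1 ih)
    simpa using h2

theorem weightedDist_nonneg (hG : G.Connected) (hw : ∀ e ∈ G.edgeSet, 0 < w e) (u v : V) :
    0 ≤ weightedDist G w u v :=
  le_weightedDist (f := fun _ _ => 0) hG (fun _ => le_rfl) (fun _ _ _ => by simp)
    (fun _ _ h => (hw _ h).le) u v

theorem weightedDist_self (hG : G.Connected) (hw : ∀ e ∈ G.edgeSet, 0 < w e) (u : V) :
    weightedDist G w u u = 0 :=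
  le_antisymm (by simpa using weightedDist_le hw (SimpleGraph.Walk.nil : G.Walk u u))
    (weightedDist_nonneg hG hw u u)

theorem weightedDist_comm (hG : G.Connected) (hw : ∀ e ∈ G.edgeSet, 0 < w e) (u v : V) :
    weightedDist G w u v = weightedDist G w v u := by
  suffices H : ∀ u v, weightedDist G w u v ≤ weightedDist G w v u from le_antisymm (H _ _) (H _ _)
  intro u v
  have : Nonempty (G.Walk v u) := hG.preconnected v u
  refine le_ciInf fun p => (weightedDist_le hw p.reverse).trans_eq ?_
  rw [SimpleGraph.Walk.edges_reverse, List.map_reverse, List.sum_reverse]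

theorem weightedDist_triangle (hG : G.Connected) (hw : ∀ e ∈ G.edgeSet, 0 < w e) (u v x : V) :
    weightedDist G w u x ≤ weightedDist G w u v + weightedDist G w v x := by
  have : Nonempty (G.Walk u v) := hG.preconnected u v
  have : Nonempty (G.Walk v x) := hG.preconnected v x
  rw [← sub_le_iff_le_add]
  refine le_ciInf fun p => ?_
  rw [sub_le_comm]
  refine le_ciInf fun q => ?_
  have := weightedDist_le hw (p.append q)
  rw [SimpleGraph.Walk.edges_append, List.map_append, List.sum_append] at this
  linarith

theorem weightedDist_le_of_adj (hw : ∀ e ∈ G.edgeSet, 0 < w e) {u v : V} (h : G.Adj u v) :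
    weightedDist G w u v ≤ w s(u, v) := by
  simpa using weightedDist_le hw h.toWalk

/-- Finitely many positive weights have a positive lower bound ε, and ε times the discrete metric is
a minorant in `le_weightedDist`. -/
theorem weightedDist_pos [Finite V] (hG : G.Connected) (hw : ∀ e ∈ G.edgeSet, 0 < w e) {u v : V}
    (h : u ≠ v) : 0 < weightedDist G w u v := by
  classical
  obtain ⟨ε, hε, hle⟩ : ∃ ε > 0, ∀ e ∈ G.edgeSet, ε ≤ w e := by
    rcases G.edgeSet.eq_empty_or_nonempty with h | h
    · exact ⟨1, one_pos, by simp [h]⟩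
    · obtain ⟨e, he, hmin⟩ := G.edgeSet.exists_min_image w (Set.toFinite _) h
      exact ⟨w e, hw e he, hmin⟩
  have := le_weightedDist (f := fun a b => if a = b then 0 else ε) hG (by simp) (fun a b c => by
    by_cases h1 : a = b <;> by_cases h2 : b = c <;> by_cases h3 : a = c <;> simp_all <;> linarith)
    (fun a b hab => by simpa [hab.ne] using hle _ hab) u v
  simp only [h, if_false] at this
  linarith

end WeightedDist

open CyclePlacement

theorem cycleGraph_adj_cases {N : ℕ} {a b : Fin N} (h : (SimpleGraph.cycleGraph N).Adj a b) :
    (a : ℕ) + 1 = b ∨ (b : ℕ) + 1 = a ∨ ((a : ℕ) = 0 ∧ (b : ℕ) + 1 = N) ∨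
      ((b : ℕ) = 0 ∧ (a : ℕ) + 1 = N) := by
  have ha := a.2
  have hb := b.2
  rw [SimpleGraph.cycleGraph_adj', Fin.sub_def, Fin.sub_def] at h
  dsimp only at h
  rcases le_or_gt (a : ℕ) b with hab | hab
  · have h2 : (N - (a : ℕ) + b) % N = b - a := by
      rw [show N - (a : ℕ) + b = (b - a) + N by omega, Nat.add_mod_right, Nat.mod_eq_of_lt]
      omega
    rcases Nat.eq_or_lt_of_le hab with heq | hlt
    · rw [h2, heq, Nat.sub_add_cancel hb.le, Nat.mod_self] at h
      omega
    · rw [h2, Nat.mod_eq_of_lt (by omega)] at h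
      omega
  · have h2 : (N - (b : ℕ) + a) % N = a - b := by
      rw [show N - (b : ℕ) + a = (a - b) + N by omega, Nat.add_mod_right, Nat.mod_eq_of_lt]
      omega
    rw [h2, Nat.mod_eq_of_lt (by omega)] at h
    omega

theorem cycleGraph_adj_succ {N : ℕ} (hN : 2 ≤ N) {a b : Fin N}
    (h : (b : ℕ) = if (a : ℕ) + 1 < N then (a : ℕ) + 1 else 0) :
    (SimpleGraph.cycleGraph N).Adj a b := by
  have ha := a.2
  rw [SimpleGraph.cycleGraph_adj', Fin.sub_def, Fin.sub_def]
  right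
  dsimp only
  split_ifs at h
  · rw [show N - (a : ℕ) + b = 1 + N by omega, Nat.add_mod_right, Nat.mod_eq_of_lt]
    omega
  · rw [show N - (a : ℕ) + b = 1 by omega, Nat.mod_eq_of_lt]
    omega

/-- The upper bound walks forwards from either end; the lower bound holds since `cdist` changes by
at most 1 along an edge. -/
theorem cycleGraph_dist {N : ℕ} (hN : 2 ≤ N) (a b : Fin N) :
    (SimpleGraph.cycleGraph N).dist a b = cdist N a b := by
  have hconn : (SimpleGraph.cycleGraph N).Connected := by
    obtain ⟨k, rfl⟩ := Nat.exists_eq_add_of_le' (show 1 ≤ N by omega)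
    exact SimpleGraph.cycleGraph_connected
  have hstep : ∀ k, ∀ a b : Fin N, (b : ℕ) = (if (a : ℕ) + k < N then (a : ℕ) + k else a + k - N) →
      k < N → (SimpleGraph.cycleGraph N).dist a b ≤ k := by
    intro k
    induction k with
    | zero =>
      intro a b h _
      have : a = b := Fin.ext (by rw [h, if_pos (by omega)]; rfl)
      rw [this, SimpleGraph.dist_self]
    | succ k ih =>
      intro a b h hk
      have ha := a.2
      let c : Fin N := ⟨if (a : ℕ) + k < N then (a : ℕ) + k else a + k - N, by split_ifs <;> omega⟩
      have h1 := ih a c rfl (by omega)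
      have h2 : (SimpleGraph.cycleGraph N).Adj c b := cycleGraph_adj_succ hN (by
        simp only [c, h]
        split_ifs <;> omega)
      have h3 := hconn.dist_triangle (u := a) (v := c) (w := b)
      have h4 := SimpleGraph.dist_eq_one_iff_adj.2 h2
      omega
  refine le_antisymm ?_ ?_
  · have hle : ∀ a b : Fin N, (a : ℕ) ≤ b →
        (SimpleGraph.cycleGraph N).dist a b ≤ cdist N a b := by
      intro a b hab
      have hb := b.2
      have h1 := hstep (b - a) a b (by rw [if_pos (by omega)]; omega) (by omega)
      rcases Nat.eq_or_lt_of_le hab with heq | hlt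
      · unfold cdist
        omega
      · have h2 := hstep (N - (b - a)) b a (by rw [if_neg (by omega)]; omega) (by omega)
        rw [SimpleGraph.dist_comm] at h2
        unfold cdist
        omega
    rcases le_total (a : ℕ) b with h | h
    · exact hle a b h
    · rw [SimpleGraph.dist_comm]
      refine (hle b a h).trans_eq ?_
      unfold cdist
      omega
  · obtain ⟨p, hp⟩ := hconn.exists_walk_length_eq_dist a b
    rw [← hp]
    clear hp
    induction p with
    | nil =>
      unfold cdist
      omega
    | @cons u v x h p ih =>
      have h1 := cycleGraph_adj_cases h
      have hu := u.2
      have hv := v.2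
      have hx := x.2
      rw [SimpleGraph.Walk.length_cons]
      refine le_trans ?_ (Nat.add_le_add_right ih 1)
      unfold cdist
      omega

/-! ### The integer data of an instance -/

namespace CycleInstance

variable (I : CycleInstance)

theorem le_M {e : Sym2 (Fin I.n)} (he : e ∈ I.G.edgeSet) : I.w e ≤ I.M :=
  le_csSup ((Set.toFinite _).image I.w).bddAbove ⟨e, he, rfl⟩

theorem exists_adj (u : Fin I.n) : ∃ v, I.G.Adj u v := by
  have : Nontrivial (Fin I.n) := Fin.nontrivial_iff_two_le.2 I.two_le_n
  exact I.connected.preconnected.exists_adj_of_nontrivial u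

theorem M_pos : 0 < I.M := by
  obtain ⟨v, hv⟩ := I.exists_adj ⟨0, by have := I.two_le_n; omega⟩
  exact (I.w_pos s(_, v) hv).trans_le (I.le_M hv)

open Classical in
/-- The integer data on which the search works. -/
noncomputable def data : Data I.n where
  N := I.N
  L := ⌊I.d * I.M⌋₊
  root := ⟨0, by have := I.two_le_n; omega⟩
  dc u v := ⌈weightedDist I.G I.w u v⌉₊
  e u v := if I.G.Adj u v then ⌊I.d * I.w s(u, v)⌋₊ + 1 else 0

theorem data_e_pos {u v : Fin I.n} : 0 < I.data.e u v ↔ I.G.Adj u v := by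
  simp only [data]
  split_ifs with h <;> simp [h]

theorem data_proper : I.data.Proper where
  dc_self u := by simp [data, weightedDist_self I.connected I.w_pos]
  dc_comm u v := by simp only [data]; rw [weightedDist_comm I.connected I.w_pos]
  dc_tri u v x := (Nat.ceil_le_ceil (weightedDist_triangle I.connected I.w_pos u v x)).trans
    (Nat.ceil_add_le _ _)
  e_comm u v := by
    simp only [data]
    rw [Sym2.eq_swap]
    by_cases h : I.G.Adj u v
    · rw [if_pos h, if_pos h.symm]
    · rw [if_neg h, if_neg fun h' => h h'.symm]
  e_irrefl u := by simp [data]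
  e_dc u v h := by
    rw [data_e_pos] at h
    -- The chain is w ≤ M ≤ dM < L + 1; the extra 1 compensates for the floor in the definition of
    -- L.
    refine Nat.ceil_le.2 ((weightedDist_le_of_adj I.w_pos h).trans ?_)
    have h1 := I.le_M (e := s(u, v)) h
    have h2 : (1 : ℝ) ≤ I.d := by exact_mod_cast I.d_pos
    have h3 := (Nat.lt_floor_add_one (I.d * I.M)).le
    have h4 := I.M_pos
    simp only [data]
    push_cast
    nlinarith
  e_le u v := by
    simp only [data]
    split_ifs with h
    · have := I.le_M (e := s(u, v)) h
      gcongr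
    · omega
  conn S hS hS' := by
    obtain ⟨u, hu⟩ := hS
    obtain ⟨v, hv⟩ := hS'
    obtain ⟨p⟩ := I.connected.preconnected u v
    obtain ⟨d, -, h1, h2⟩ := p.exists_boundary_dart S hu hv
    exact ⟨_, h1, _, h2, I.data_e_pos.2 d.adj⟩

theorem dist_eq (a b : Fin I.N) : I.C.dist a b = cdist I.N a b :=
  cycleGraph_dist (by have := I.three_le_N; omega) a b

/-- Rounding loses nothing because cycle distances are integers. From edges to all pairs,
`le_weightedDist` is applied to the cycle distance of the images divided by `d`. -/
theorem isSolution_iff (F : Fin I.n → Fin I.N) :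
    I.IsSolution F ↔ I.data.IsSol fun v => (F v : ℕ) := by
  have hd : (0 : ℝ) < I.d := by exact_mod_cast I.d_pos
  constructor
  · intro h
    have hinj : Function.Injective F := fun u v huv => by
      by_contra hne
      have h1 := (h u v).1
      rw [huv, SimpleGraph.dist_self] at h1
      have := weightedDist_pos I.connected I.w_pos hne
      simp only [Nat.cast_zero] at h1
      linarith
    refine ⟨fun v => (F v).2, fun u v huv => hinj (Fin.ext huv), fun u v => ?_, fun u v he => ?_⟩
    · have h1 := (h u v).1
      rw [dist_eq] at h1
      exact Nat.ceil_le.2 h1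
    · have h1 := (h u v).2
      rw [data_e_pos] at he
      rw [dist_eq] at h1
      have h2 : (cdist I.N (F u) (F v) : ℝ) ≤ I.d * I.w s(u, v) :=
        h1.trans (by gcongr; exact weightedDist_le_of_adj I.w_pos he)
      simp only [data, he, if_true]
      exact Nat.lt_succ_of_le (Nat.le_floor h2)
  · intro h u v
    refine ⟨?_, ?_⟩
    · rw [dist_eq]
      exact (Nat.le_ceil _).trans (by exact_mod_cast h.dc u v)
    · have hconn : I.C.Connected := by
        have := I.three_le_N
        have : ∃ k, I.N = k + 1 := ⟨I.N - 1, by omega⟩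
        obtain ⟨k, hk⟩ := this
        unfold C
        rw [hk]
        exact SimpleGraph.cycleGraph_connected
      have := le_weightedDist (w := I.w)
        (f := fun u v => (I.C.dist (F u) (F v) : ℝ) / I.d) I.connected (by simp)
        (fun u v x => by
          rw [← add_div]
          gcongr
          exact_mod_cast hconn.dist_triangle)
        (fun u v huv => by
          have h1 := h.edge u v (I.data_e_pos.2 huv)
          simp only [data, huv, if_true] at h1
          rw [div_le_iff₀ hd, dist_eq, mul_comm]
          refine le_trans ?_ (Nat.floor_le (by have := I.w_pos s(u, v) huv; positivity))
          exact_mod_cast Nat.le_of_lt_succ h1) u v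
      rw [div_le_iff₀ hd] at this
      linarith

/-- In an instance with a solution, the balls are small. -/
theorem ball_card_le {F : Fin I.n → Fin I.N} (hF : I.IsSolution F) (v : Fin I.n) :
    (Finset.univ.filter fun u => I.data.dc v u ≤ I.data.L + 1).card
      ≤ I.d * (2 * (I.data.L + 1)) + 1 := by
  have hsol := (I.isSolution_iff F).1 hF
  set r := I.d * (I.data.L + 1) with hr
  -- Measured forwards from the image of `v`, the images of the ball have offsets at most `r` or,
  -- going backwards, at least `N - r`: at most `2r + 1` values.
  have hcard : (Finset.range (r + 1) ∪ Finset.Ico (I.N - r) I.N).card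
      ≤ I.d * (2 * (I.data.L + 1)) + 1 := by
    refine (Finset.card_union_le _ _).trans ?_
    simp only [Finset.card_range, Nat.card_Ico]
    have : I.d * (2 * (I.data.L + 1)) = 2 * r := by rw [hr]; ring
    omega
  refine le_trans (Finset.card_le_card_of_injOn (fun u => if (F v : ℕ) ≤ F u then (F u : ℕ) - F v
    else F u + I.N - F v) ?_ ?_) hcard
  · intro u hu
    have hu' : I.data.dc v u ≤ I.data.L + 1 := by simpa using hu
    have h1 := (hF v u).2
    rw [dist_eq] at h1
    have h2 : weightedDist I.G I.w v u ≤ (I.data.L + 1 : ℕ) :=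
      (Nat.le_ceil _).trans (by exact_mod_cast hu')
    have h3 : (cdist I.N (F v) (F u) : ℝ) ≤ (r : ℕ) := by
      refine h1.trans ?_
      rw [hr]
      push_cast at h2 ⊢
      gcongr
    have h4 : cdist I.N (F v) (F u) ≤ r := by exact_mod_cast h3
    have h5 := (F v).2
    have h6 := (F u).2
    unfold cdist at h4
    simp only [Finset.coe_union, Finset.coe_range, Finset.coe_Ico, Set.mem_union, Set.mem_Iio,
      Set.mem_Ico]
    split_ifs <;> omega
  · intro a _ b _ hab
    have h5 := (F v).2
    have h6 := (F a).2
    have h7 := (F b).2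
    apply hsol.inj
    dsimp only at hab ⊢
    split_ifs at hab <;> omega

end CycleInstance

/-! ### Loop patterns -/

namespace RealRAM

attribute [local simp] NExpr.val RExpr.val Test.holds Prog.run Function.update_apply

theorem cell_inj {n i j i' j' : ℕ} (hj : j < n) (hj' : j' < n) :
    i * n + j = i' * n + j' ↔ i = i' ∧ j = j' := by
  constructor
  · intro h
    have h1 := congrArg (· / n) h
    have h2 := congrArg (· % n) h
    have hn : 0 < n := by omega
    simp only [Nat.mul_add_mod', Nat.mod_eq_of_lt hj, Nat.mod_eq_of_lt hj'] at h2
    simp only [mul_comm _ n, Nat.mul_add_div hn, Nat.div_eq_of_lt hj, Nat.div_eq_of_lt hj'] at h1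
    exact ⟨by simpa using h1, h2⟩
  · rintro ⟨rfl, rfl⟩
    rfl

/-- Lexicographic order on the cells of a matrix. -/
def Before (i' j' i j : ℕ) : Prop := i' < i ∨ (i' = i ∧ j' < j)

/-- Row offsets are stored in array `1`, the number of rows in register `0`. -/
structure Rows (n : ℕ) (s : State) : Prop where
  size : s.reg 0 = n
  row : ∀ i < n, s.arr 1 i = i * n

theorem Rows.frame {n : ℕ} {p : Prog} {s s' : State} (h : Rows n s) (hF : Frame p s s')
    (h0 : 0 ∉ p.wr) (h1 : 1 ∉ p.wa) : Rows n s' :=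
  ⟨(hF.reg 0 h0).trans h.size, fun i hi => by rw [hF.arr 1 h1]; exact h.row i hi⟩

/-- Run `p` for all cells of a matrix; registers `5`, `6` and `11` hold the row, the column and the
row offset. -/
def Prog.forMat (p : Prog) : Prog :=
  .forTo 5 0 (.set 11 (.read 1 (.reg 5)) ;; .forTo 6 0 p)

/-- `I i j` describes the state when the cells before `(i, j)` in row order are done; `hnext` passes
from the end of a row to the next row. The loop registers must not enter the invariant. -/
theorem Runs.forMat {n : ℕ} {p : Prog} {s : State} (hs : Rows n s) (I : ℕ → ℕ → State → Prop)
    (T : ℕ) (h0 : 0 ∉ p.wr) (h5 : 5 ∉ p.wr) (h6 : 6 ∉ p.wr) (h11 : 11 ∉ p.wr) (h1 : 1 ∉ p.wa)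
    (hI : ∀ i j s r, (∀ x, x ≠ 5 → x ≠ 6 → x ≠ 11 → r x = s.reg x) → I i j s →
      I i j { s with reg := r })
    (hnext : ∀ i s, I i n s → I (i + 1) 0 s) (hinit : I 0 0 s)
    (step : ∀ i j s', i < n → j < n → Frame (Prog.forMat p) s s' → s'.reg 5 = i → s'.reg 6 = j →
      s'.reg 11 = i * n → Rows n s' → I i j s' → Runs p s' T (I i (j + 1))) :
    Runs (Prog.forMat p) s (n * (n * (T + 7) + 15) + 5) (I n 0) := by
  have hw : 0 ∉ (Prog.forMat p).wr := by simp [Prog.forMat, Prog.forTo, Prog.wr, h0]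
  have hwa : 1 ∉ (Prog.forMat p).wa := by simp [Prog.forMat, Prog.forTo, Prog.wa, h1]
  have := Runs.forTo_const (x := 5) (b := 0) (p := .set 11 (.read 1 (.reg 5)) ;; .forTo 6 0 p)
    (s := s) (fun i s => I i 0 s) (n * (T + 7) + 8)
    (by simp [Prog.forTo, Prog.wr, h5]) (by simp [Prog.forTo, Prog.wr, h0]) (by decide)
    (fun i s v h => hI _ _ _ _ (fun x hx _ _ => by simp [hx]) h) hinit ?_
  · rw [hs.size] at this
    exact Runs.mono this (by simp [add_assoc]) fun _ _ h => h
  intro i s₁ hi hF h5i hIi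
  rw [hs.size] at hi
  have hr1 : Rows n s₁ := hs.frame (p := Prog.forMat p) hF hw hwa
  have h := Runs.seq (p := .set 11 (.read 1 (.reg 5))) (q := .forTo 6 0 p) (s := s₁) (T₁ := 3)
    (T₂ := n * (T + 7) + 5) (Q := fun s => I (i + 1) 0 s)
    (Q₁ := fun s' => s' = { s₁ with reg := Function.update s₁.reg 11 (i * n) })
    (Runs.of_flat rfl (by decide) (by simp [h5i, hr1.row i hi])) ?_
  · exact Runs.mono h (by omega) fun _ _ h => h
  rintro s₂ hF2 rfl
  have hr2 : Rows n { s₁ with reg := Function.update s₁.reg 11 (i * n) } :=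
    ⟨by simp [hr1.size], hr1.row⟩
  have hsub : Frame (.set 11 (.read 1 (.reg 5)) ;; .forTo 6 0 p) s₁
      { s₁ with reg := Function.update s₁.reg 11 (i * n) } := hF2.seq_left _
  have hsub2 := hF.trans (hsub.weaken (q := Prog.forMat p)
      (by intro x; simp [Prog.forMat, Prog.forTo, Prog.wr]; tauto)
      (by simp [Prog.forMat, Prog.forTo, Prog.wa]) (by simp [Prog.forMat, Prog.forTo, Prog.wrr])
      (by simp [Prog.forMat, Prog.forTo, Prog.wra]))
  have := Runs.forTo_const (x := 6) (b := 0) (p := p)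
    (s := { s₁ with reg := Function.update s₁.reg 11 (i * n) }) (fun j s => I i j s) T
    h6 h0 (by decide) (fun i s v h => hI _ _ _ _ (fun x _ hx _ => by simp [hx]) h)
    (hI _ _ _ _ (fun x _ _ hx => by simp [hx]) hIi) ?_
  · rw [hr2.size] at this
    exact Runs.mono this le_rfl fun _ _ h => hnext _ _ h
  intro j s₃ hj hF3 h6j hIj
  rw [hr2.size] at hj
  refine step i j s₃ hi hj ?_ ?_ h6j ?_ ?_ hIj
  · refine hsub2.trans (hF3.weaken ?_ ?_ ?_ ?_) <;>
      (intro x; simp [Prog.forTo, Prog.wr, Prog.wa, Prog.wrr, Prog.wra]; try tauto)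
  · rw [hF3.reg 5 (by simp [Prog.forTo, Prog.wr, h5])]
    simp [h5i]
  · rw [hF3.reg 11 (by simp [Prog.forTo, Prog.wr, h11])]
    simp
  · exact hr2.frame hF3 (by simp [Prog.forTo, Prog.wr, h0])
      (by simpa [Prog.forTo, Prog.wa] using h1)

/-- Counting up to the integer part of real register `q`; the result is in register `x`. -/
def floorLoop (x r q : ℕ) : Prog :=
  .set x (.lit 0) ;; .rset r (.lit 1) ;;
  .loop (.neg (.rlt (.reg q) (.reg r)))
    (.set x (.add (.reg x) (.lit 1)) ;; .rset r (.add (.reg r) (.lit 1)))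

theorem runs_floorLoop {x r q : ℕ} (hrq : q ≠ r) (s : State) {K : ℕ} (hK : ⌊s.rreg q⌋₊ ≤ K)
    (h0 : 0 ≤ s.rreg q) :
    Runs (floorLoop x r q) s (12 * K + 8) (fun s' => s'.reg x = ⌊s.rreg q⌋₊) := by
  refine Runs.mono (Runs.seq (T₁ := 2) (Q₁ := fun s' => s'.reg x = 0)
    (T₂ := 2 + (12 * K + 4)) (Q := fun s' => s'.reg x = ⌊s.rreg q⌋₊)
    (Runs.of_flat rfl le_rfl (by simp)) fun s₁ hF1 h1 => ?_) (by omega) fun _ _ h => h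
  refine Runs.seq (Q₁ := fun s' => s'.reg x = 0 ∧ s'.rreg r = 1 ∧ s'.rreg q = s.rreg q)
    (Runs.of_flat rfl le_rfl ⟨by simpa using h1, by simp, ?_⟩) ?_
  · have := hF1.rreg q (by simp [Prog.wrr])
    simp [hrq, this]
  rintro s₂ - ⟨h2, h3, h4⟩
  -- The real register runs one ahead of the counter, so the loop stops at the first integer
  -- exceeding register `q`, when the counter is the floor.
  refine Runs.mono (Runs.loop (fun i s' => s'.reg x = i ∧ s'.rreg r = i + 1 ∧
    s'.rreg q = s.rreg q ∧ i ≤ ⌊s.rreg q⌋₊) (fun _ => 8) K ⟨h2, by simp [h3], h4, by simp⟩ ?_)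
    (by simp [Test.cost, RExpr.cost]; omega) ?_
  · rintro i s' - ⟨h5, h6, h7, h8⟩ hb
    simp only [Test.holds, RExpr.val, h6, h7, not_lt] at hb
    have : i + 1 ≤ ⌊s.rreg q⌋₊ := Nat.le_floor (by exact_mod_cast hb)
    refine ⟨by omega, Runs.of_flat rfl le_rfl ?_⟩
    simp [h5, h6, hrq, h7, this]
  · rintro s' - ⟨i, -, ⟨h5, h6, h7, h8⟩, hb⟩
    simp only [Test.holds, RExpr.val, h6, h7, not_not] at hb
    have : ⌊s.rreg q⌋₊ < i + 1 := (Nat.floor_lt h0).2 (by exact_mod_cast hb)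
    omega

/-- Counting up to real register `q`, rounding up. -/
def ceilLoop (x r q : ℕ) : Prog :=
  .set x (.lit 0) ;; .rset r (.lit 0) ;;
  .loop (.rlt (.reg r) (.reg q))
    (.set x (.add (.reg x) (.lit 1)) ;; .rset r (.add (.reg r) (.lit 1)))

theorem runs_ceilLoop {x r q : ℕ} (hrq : q ≠ r) (s : State) {K : ℕ} (hK : ⌈s.rreg q⌉₊ ≤ K) :
    Runs (ceilLoop x r q) s (12 * K + 8) (fun s' => s'.reg x = ⌈s.rreg q⌉₊) := by
  refine Runs.mono (Runs.seq (T₁ := 2) (Q₁ := fun s' => s'.reg x = 0)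
    (T₂ := 2 + (12 * K + 4)) (Q := fun s' => s'.reg x = ⌈s.rreg q⌉₊)
    (Runs.of_flat rfl le_rfl (by simp)) fun s₁ hF1 h1 => ?_) (by omega) fun _ _ h => h
  refine Runs.seq (Q₁ := fun s' => s'.reg x = 0 ∧ s'.rreg r = 0 ∧ s'.rreg q = s.rreg q)
    (Runs.of_flat rfl le_rfl ⟨by simpa using h1, by simp, ?_⟩) ?_
  · have := hF1.rreg q (by simp [Prog.wrr])
    simp [hrq, this]
  rintro s₂ - ⟨h2, h3, h4⟩
  refine Runs.mono (Runs.loop (fun i s' => s'.reg x = i ∧ s'.rreg r = i ∧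
    s'.rreg q = s.rreg q ∧ i ≤ ⌈s.rreg q⌉₊) (fun _ => 8) K ⟨h2, by simp [h3], h4, by simp⟩ ?_)
    (by simp [Test.cost, RExpr.cost]; omega) ?_
  · rintro i s' - ⟨h5, h6, h7, h8⟩ hb
    simp only [Test.holds, RExpr.val, h6, h7] at hb
    have : i < ⌈s.rreg q⌉₊ := Nat.lt_ceil.2 hb
    refine ⟨by omega, Runs.of_flat rfl le_rfl ?_⟩
    simp [h5, h6, hrq, h7]
    omega
  · rintro s' - ⟨i, -, ⟨h5, h6, h7, h8⟩, hb⟩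
    simp only [Test.holds, RExpr.val, h6, h7, not_lt] at hb
    have : ⌈s.rreg q⌉₊ ≤ i := Nat.ceil_le.2 hb
    omega

/-- `d` times real register `q`, where `d` is register `b`; the result is in real register `r`. -/
def mulLoop (x b r : ℕ) (e : RExpr) : Prog :=
  .rset r (.lit 0) ;; .forTo x b (.rset r (.add (.reg r) e))

theorem runs_mulLoop {x b r : ℕ} {e : RExpr} (hbx : b ≠ x) (s : State) (v : ℝ)
    (he : ∀ s', Frame (mulLoop x b r e) s s' → e.val s' = v) :
    Runs (mulLoop x b r e) s (s.reg b * (e.cost + 10) + 7) (fun s' => s'.rreg r = s.reg b * v) := by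
  refine Runs.mono (Runs.seq (T₁ := 2) (Q₁ := fun s' => s'.rreg r = 0)
    (T₂ := s.reg b * (e.cost + 10) + 5) (Q := fun s' => s'.rreg r = s.reg b * v)
    (Runs.of_flat rfl le_rfl (by simp)) fun s₁ hF1 h1 => ?_) (by omega) fun _ _ h => h
  have hb : s₁.reg b = s.reg b := hF1.reg b (by simp [Prog.wr])
  have h := Runs.forTo_const (x := x) (b := b) (p := .rset r (.add (.reg r) e)) (s := s₁)
    (fun i s' => s'.rreg r = i * v) (e.cost + 3) (by simp [Prog.wr]) (by simp [Prog.wr]) hbx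
    (fun i s v h => h) (by simpa using h1) fun i s' hi hF hx hI => ?_
  · rw [hb] at h
    exact Runs.mono h le_rfl fun _ _ h => h
  · have h2 := he s' ((hF1.seq_left _).trans (hF.seq_right _))
    refine Runs.of_flat rfl (by simp [Prog.bound, RExpr.cost]; omega) ?_
    simp [hI, h2]
    ring

end RealRAM

/-! ### The Floyd–Warshall recursion -/

/-- Matrices obtained from `A` by allowing the first `k` vertices as intermediate vertices. -/
noncomputable def floydWarshall {n : ℕ} (A : Fin n → Fin n → ℝ) : ℕ → Fin n → Fin n → ℝ
  | 0 => A
  | k + 1 => fun i j => if h : k < n then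
      min (floydWarshall A k i j) (floydWarshall A k i ⟨k, h⟩ + floydWarshall A k ⟨k, h⟩ j)
      else floydWarshall A k i j

section FloydWarshall

variable {n : ℕ} {A : Fin n → Fin n → ℝ}

theorem floydWarshall_succ {k : ℕ} (h : k < n) (i j : Fin n) : floydWarshall A (k + 1) i j =
    min (floydWarshall A k i j) (floydWarshall A k i ⟨k, h⟩ + floydWarshall A k ⟨k, h⟩ j) := by
  simp [floydWarshall, h]

theorem floydWarshall_nonneg (h0 : ∀ i j, 0 ≤ A i j) (k : ℕ) (i j : Fin n) :
    0 ≤ floydWarshall A k i j := by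
  induction k generalizing i j with
  | zero => exact h0 i j
  | succ k ih =>
    by_cases h : k < n
    · rw [floydWarshall_succ h]
      exact le_min (ih _ _) (add_nonneg (ih _ _) (ih _ _))
    · simpa [floydWarshall, h] using ih i j

theorem floydWarshall_le (k : ℕ) (i j : Fin n) : floydWarshall A k i j ≤ A i j := by
  induction k with
  | zero => exact le_rfl
  | succ k ih =>
    by_cases h : k < n
    · rw [floydWarshall_succ h]
      exact (min_le_left _ _).trans ih
    · simpa [floydWarshall, h] using ih

theorem floydWarshall_self (h0 : ∀ i j, 0 ≤ A i j) (hd : ∀ i, A i i = 0) (k : ℕ) (i : Fin n) :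
    floydWarshall A k i i = 0 :=
  le_antisymm ((floydWarshall_le k i i).trans_eq (hd i)) (floydWarshall_nonneg h0 k i i)

/-- The diagonal is zero, so round `k` does not change row `k`, nor column `k`. This is what makes
the update in place correct. -/
theorem floydWarshall_row (h0 : ∀ i j, 0 ≤ A i j) (hd : ∀ i, A i i = 0) {k : ℕ} (h : k < n)
    (j : Fin n) : floydWarshall A (k + 1) ⟨k, h⟩ j = floydWarshall A k ⟨k, h⟩ j := by
  rw [floydWarshall_succ h, floydWarshall_self h0 hd]
  simp

theorem floydWarshall_col (h0 : ∀ i j, 0 ≤ A i j) (hd : ∀ i, A i i = 0) {k : ℕ} (h : k < n)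
    (i : Fin n) : floydWarshall A (k + 1) i ⟨k, h⟩ = floydWarshall A k i ⟨k, h⟩ := by
  rw [floydWarshall_succ h, floydWarshall_self h0 hd]
  simp

theorem floydWarshall_triangle (h0 : ∀ i j, 0 ≤ A i j) (hd : ∀ i, A i i = 0) (k : ℕ)
    (i m j : Fin n) (hm : (m : ℕ) < k) :
    floydWarshall A k i j ≤ floydWarshall A k i m + floydWarshall A k m j := by
  induction k generalizing i m j with
  | zero => omega
  | succ k ih =>
    by_cases h : k < n
    · rcases Nat.lt_succ_iff_lt_or_eq.mp hm with hm | hm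
      · rw [floydWarshall_succ h, floydWarshall_succ h, floydWarshall_succ h]
        set B := floydWarshall A k with hB
        set q : Fin n := ⟨k, h⟩
        have h1 := ih i m j hm
        have h2 := ih i m q hm
        have h3 := ih q m j hm
        have h4 : 0 ≤ B q m := floydWarshall_nonneg h0 k q m
        have h5 : 0 ≤ B m q := floydWarshall_nonneg h0 k m q
        -- Each of the two legs may or may not pass through `q`. If both do, the closed detour from
        -- `q` to `m` and back is dropped, being nonnegative.
        rcases min_cases (B i m) (B i q + B q m) with ⟨h6, -⟩ | ⟨h6, -⟩ <;>
          rcases min_cases (B m j) (B m q + B q j) with ⟨h7, -⟩ | ⟨h7, -⟩ <;> rw [h6, h7]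
        · exact (min_le_left _ _).trans h1
        · exact (min_le_right _ _).trans (by linarith)
        · exact (min_le_right _ _).trans (by linarith)
        · exact (min_le_right _ _).trans (by linarith)
      · have : m = ⟨k, h⟩ := Fin.ext hm
        subst this
        rw [floydWarshall_row h0 hd, floydWarshall_col h0 hd, floydWarshall_succ h]
        exact min_le_right _ _
    · have := m.2
      simpa [floydWarshall, h] using ih i m j (by omega)

end FloydWarshall

namespace CycleInstance

variable (I : CycleInstance)

/-- The matrix the Floyd–Warshall recursion is started with. -/
noncomputable def initMatrix (i j : Fin I.n) : ℝ :=
  if i = j then 0 else if 0 < I.matrix i j then I.matrix i j else I.n * I.M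

theorem matrix_pos {i j : Fin I.n} : 0 < I.matrix i j ↔ I.G.Adj i j := by
  unfold matrix
  split_ifs with h
  · exact ⟨fun _ => h, fun _ => I.w_pos s(i, j) h⟩
  · simp [h]

theorem matrix_of_adj {i j : Fin I.n} (h : I.G.Adj i j) : I.matrix i j = I.w s(i, j) := by
  simp [matrix, h]

theorem matrix_le_M (i j : Fin I.n) : I.matrix i j ≤ I.M := by
  unfold matrix
  split_ifs with h
  · exact I.le_M (e := s(i, j)) h
  · exact I.M_pos.le

theorem initMatrix_nonneg (i j : Fin I.n) : 0 ≤ I.initMatrix i j := by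
  have := I.M_pos
  unfold initMatrix
  split_ifs with h1 h2
  · exact le_rfl
  · exact h2.le
  · positivity

theorem initMatrix_self (i : Fin I.n) : I.initMatrix i i = 0 := by simp [initMatrix]

/-- A path has fewer than n edges. Therefore nM can stand for infinity at the non-edges of
`initMatrix`. -/
theorem weightedDist_le_mul (u v : Fin I.n) : weightedDist I.G I.w u v ≤ I.n * I.M := by
  classical
  obtain ⟨p⟩ := I.connected.preconnected u v
  have h1 := p.toPath.2.length_lt
  rw [Fintype.card_fin] at h1
  refine (weightedDist_le I.w_pos p.toPath.1).trans ?_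
  have h2 : ((p.toPath.1.edges.map I.w).sum) ≤ (p.toPath.1.edges.map I.w).length • I.M :=
    List.sum_le_card_nsmul _ _ fun x hx => by
      obtain ⟨e, he, rfl⟩ := List.mem_map.1 hx
      exact I.le_M (p.toPath.1.edges_subset_edgeSet he)
  rw [List.length_map, SimpleGraph.Walk.length_edges, nsmul_eq_mul] at h2
  refine h2.trans ?_
  have := I.M_pos
  gcongr

/-- The final matrix obeys the triangle inequality through every vertex and is at most the weight on
edges, so `le_weightedDist` bounds it above; and no round goes below the true distance. -/
theorem floydWarshall_eq (u v : Fin I.n) :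
    floydWarshall I.initMatrix I.n u v = weightedDist I.G I.w u v := by
  apply le_antisymm
  · refine le_weightedDist (f := floydWarshall I.initMatrix I.n) I.connected (fun u => ?_)
      (fun u v x => ?_) (fun u v h => ?_) u v
    · rw [floydWarshall_self I.initMatrix_nonneg I.initMatrix_self]
    · exact floydWarshall_triangle I.initMatrix_nonneg I.initMatrix_self _ _ _ _ v.2
    · refine (floydWarshall_le _ _ _).trans_eq ?_
      rw [initMatrix, if_neg h.ne, if_pos (I.matrix_pos.2 h), I.matrix_of_adj h]
  · suffices H : ∀ k u v, weightedDist I.G I.w u v ≤ floydWarshall I.initMatrix k u v from H _ _ _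
    intro k
    induction k with
    | zero =>
      intro u v
      simp only [floydWarshall, initMatrix]
      split_ifs with h1 h2
      · rw [h1, weightedDist_self I.connected I.w_pos]
      · have h3 := I.matrix_pos.1 h2
        rw [I.matrix_of_adj h3]
        exact weightedDist_le_of_adj I.w_pos h3
      · exact I.weightedDist_le_mul u v
    | succ k ih =>
      intro u v
      by_cases h : k < I.n
      · rw [floydWarshall_succ h]
        exact le_min (ih _ _) ((weightedDist_triangle I.connected I.w_pos _ _ _).trans
          (add_le_add (ih _ _) (ih _ _)))
      · simpa [floydWarshall, h] using ih u v

end CycleInstance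

/-! ### Preprocessing -/

namespace CycleInstance

open RealRAM

attribute [local simp] NExpr.val RExpr.val Test.holds Prog.run Function.update_apply

/-- The input is still available, and array `9` has not been used. -/
structure Inp (I : CycleInstance) (s : State) : Prop where
  n : s.reg 0 = I.n
  N : s.reg 1 = I.N
  d : s.reg 2 = I.d
  mat : ∀ i j : Fin I.n, s.rarr 0 (i * I.n + j) = I.matrix i j
  seen : ∀ k, s.arr 9 k = 0

variable {I : CycleInstance}

theorem Inp.frame {p : Prog} {s s' : State} (h : I.Inp s) (hF : Frame p s s') (h0 : 0 ∉ p.wr)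
    (h1 : 1 ∉ p.wr) (h2 : 2 ∉ p.wr) (h3 : 0 ∉ p.wra) (h4 : 9 ∉ p.wa) : I.Inp s' :=
  ⟨(hF.reg 0 h0).trans h.n, (hF.reg 1 h1).trans h.N, (hF.reg 2 h2).trans h.d,
    fun i j => by rw [hF.rarr 0 h3]; exact h.mat i j, fun k => by rw [hF.arr 9 h4]; exact h.seen k⟩

theorem inp_input (I : CycleInstance) : I.Inp I.input := by
  refine ⟨by simp [input], by simp [input], by simp [input], fun i j => ?_, fun _ => rfl⟩
  have hlt : (i : ℕ) * I.n + j < I.n * I.n := by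
    have h1 : ((i : ℕ) + 1) * I.n ≤ I.n * I.n := Nat.mul_le_mul_right _ i.2
    have := j.2
    rw [add_mul] at h1
    omega
  have hn : 0 < I.n := by have := I.two_le_n; omega
  simp only [input, true_and, hlt, dite_true]
  congr 1
  · apply Fin.ext
    simp only
    rw [mul_comm, Nat.mul_add_div hn, Nat.div_eq_of_lt j.2, add_zero]
  · apply Fin.ext
    simp only
    rw [Nat.mul_add_mod', Nat.mod_eq_of_lt j.2]

/-- The products `i * n` are tabulated once by repeated addition, since the machine cannot multiply
when it addresses a matrix cell. -/
def initRows : Prog :=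
  .set 11 (.lit 0) ;; .forTo 5 0 (.write 1 (.reg 5) (.reg 11) ;;
    .set 11 (.add (.reg 11) (.reg 0)))

theorem runs_initRows {n : ℕ} {s : State} (h : s.reg 0 = n) :
    Runs initRows s (n * 14 + 7) (Rows n) := by
  refine Runs.mono (Runs.seq (T₁ := 2) (T₂ := n * 14 + 5) (Q₁ := fun s => s.reg 11 = 0)
    (Q := Rows n) (Runs.of_flat rfl (by decide) (by simp)) fun s₁ hF h1 => ?_) (by omega)
    fun _ _ h => h
  have h2 : s₁.reg 0 = n := (hF.reg 0 (by decide)).trans h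
  have := Runs.forTo_const (x := 5) (b := 0) (s := s₁)
    (p := .write 1 (.reg 5) (.reg 11) ;; .set 11 (.add (.reg 11) (.reg 0)))
    (fun i s => s.reg 11 = i * n ∧ s.reg 0 = n ∧ ∀ k < i, s.arr 1 k = k * n) 7
    (by decide) (by decide) (by decide) (fun i s v h => by simpa using h)
    ⟨by simpa using h1, h2, by simp⟩ fun i s' hi hF' h5 ⟨h3, h4, h6⟩ => ?_
  · rw [h2] at this
    exact Runs.mono this le_rfl fun s _ h => ⟨h.2.1, h.2.2⟩
  · refine Runs.of_flat rfl (by decide) ⟨by simp [h3, h4]; ring, by simpa using h4, fun k hk => ?_⟩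
    simp only [Prog.run, NExpr.val, Function.update_apply, if_true, h5]
    split_ifs with hki
    · rw [h3, hki]
    · exact h6 k (by omega)

def maxWeight : Prog :=
  .rset 0 (.lit 0) ;; .forMat (.ite (.rlt (.reg 0) (.read 0 (.add (.reg 11) (.reg 6))))
    (.rset 0 (.read 0 (.add (.reg 11) (.reg 6)))) .skip)

/-- Non-edges appear as 0 in the matrix, which does no harm because M is positive. -/
theorem runs_maxWeight {s : State} (h : I.Inp s) (hr : Rows I.n s) :
    Runs maxWeight s (I.n * (I.n * 18 + 15) + 7) (fun s' => s'.rreg 0 = I.M) := by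
  refine Runs.mono (Runs.seq (T₁ := 2) (T₂ := I.n * (I.n * 18 + 15) + 5)
    (Q₁ := fun s => s.rreg 0 = 0) (Q := fun s' => s'.rreg 0 = I.M)
    (Runs.of_flat rfl (by decide) (by simp)) fun s₁ hF h1 => ?_) (by omega) fun _ _ h => h
  have h2 := h.frame hF (by decide) (by decide) (by decide) (by decide) (by decide)
  have := Runs.forMat (hr.frame hF (by decide) (by decide))
    (p := .ite (.rlt (.reg 0) (.read 0 (.add (.reg 11) (.reg 6))))
    (.rset 0 (.read 0 (.add (.reg 11) (.reg 6)))) .skip)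
    (fun i j s => s.rreg 0 ≤ I.M ∧ ∀ i' j' : Fin I.n, Before i' j' i j → I.matrix i' j' ≤ s.rreg 0)
    11 (by decide) (by decide) (by decide) (by decide) (by decide) (fun _ _ _ _ _ h => h)
    (fun i s h => ⟨h.1, fun i' j' hb => h.2 i' j' (by
      have := j'.2; unfold Before at *; omega)⟩)
    ⟨by rw [h1]; exact I.M_pos.le, fun i' j' hb => by unfold Before at hb; omega⟩ ?_
  · refine Runs.mono this le_rfl fun s' _ h => le_antisymm h.1 ?_
    obtain ⟨v, hv⟩ := I.exists_adj ⟨0, by have := I.two_le_n; omega⟩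
    refine csSup_le ⟨_, s(_, v), hv, rfl⟩ ?_
    rintro _ ⟨e, he, rfl⟩
    induction e with
    | _ a b =>
      rw [← I.matrix_of_adj he]
      exact h.2 a b (Or.inl a.2)
  · rintro i j s' hi hj hF' h5 h6 h11 - ⟨h3, h4⟩
    have hm := (h2.frame hF' (by decide) (by decide) (by decide) (by decide) (by decide)).mat
      ⟨i, hi⟩ ⟨j, hj⟩
    have hM := I.matrix_le_M ⟨i, hi⟩ ⟨j, hj⟩
    have hb : ∀ i' j' : Fin I.n, Before i' j' i (j + 1) → Before i' j' i j ∨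
        I.matrix i' j' = I.matrix ⟨i, hi⟩ ⟨j, hj⟩ := by
      intro i' j' hb
      by_cases hc : (i' : ℕ) = i ∧ (j' : ℕ) = j
      · right
        congr
        · exact Fin.ext hc.1
        · exact Fin.ext hc.2
      · left
        unfold Before at *
        omega
    refine Runs.of_flat rfl (by decide) ?_
    by_cases hlt : s'.rreg 0 < I.matrix ⟨i, hi⟩ ⟨j, hj⟩
    · simp only [Prog.run, Test.holds, RExpr.val, NExpr.val, h11, h6, hm, hlt, if_true,
        Function.update_self]
      refine ⟨hM, fun i' j' h7 => ?_⟩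
      rcases hb i' j' h7 with h8 | h8
      · exact (h4 _ _ h8).trans hlt.le
      · exact h8.le
    · simp only [Prog.run, Test.holds, RExpr.val, NExpr.val, h11, h6, hm, hlt, if_false]
      refine ⟨h3, fun i' j' h7 => ?_⟩
      rcases hb i' j' h7 with h8 | h8
      · exact h4 _ _ h8
      · rw [h8]
        exact not_lt.1 hlt

/-- Compute `d M` in real register `1`, its integer part in register `3` and `n M` in real
register `3`. -/
def bounds : Prog :=
  mulLoop 5 2 1 (.reg 0) ;; floorLoop 3 2 1 ;; mulLoop 5 0 3 (.reg 0)

theorem runs_bounds {s : State} (h : I.Inp s) (hM : s.rreg 0 = I.M) {R : ℕ} (hL : I.data.L ≤ R) :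
    Runs bounds s (I.d * 11 + 12 * R + I.n * 11 + 22)
      (fun s' => s'.reg 3 = I.data.L ∧ s'.rreg 3 = I.n * I.M) := by
  have hM0 := I.M_pos
  refine Runs.mono (Runs.seq (T₁ := I.d * 11 + 7) (T₂ := 12 * R + I.n * 11 + 15)
    (Q₁ := fun s' => s'.rreg 1 = I.d * I.M) (Q := fun s' => s'.reg 3 = I.data.L ∧
    s'.rreg 3 = I.n * I.M) ?_ fun s₁ hF1 h1 => ?_) (by omega) fun _ _ h => h
  · refine Runs.mono (runs_mulLoop (by decide) s I.M fun s' hF => ?_) ?_ ?_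
    · exact (hF.rreg 0 (by decide)).trans hM
    · rw [h.d]
      simp [RExpr.cost]
    · rintro s' - h1
      rw [h1, h.d]
  have hi1 := h.frame hF1 (by decide) (by decide) (by decide) (by decide) (by decide)
  refine Runs.mono (Runs.seq (T₁ := 12 * R + 8) (T₂ := I.n * 11 + 7)
    (Q₁ := fun s' => s'.reg 3 = I.data.L) (Q := fun s' => s'.reg 3 = I.data.L ∧
    s'.rreg 3 = I.n * I.M) ?_ fun s₂ hF2 h2 => ?_) (by omega) fun _ _ h => h
  · refine Runs.mono (runs_floorLoop (by decide) s₁ (K := R) (by rw [h1]; exact hL)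
      (by rw [h1]; positivity)) le_rfl fun s' _ h2 => ?_
    rw [h2, h1]
    rfl
  have hi2 := hi1.frame hF2 (by decide) (by decide) (by decide) (by decide) (by decide)
  refine Runs.mono (runs_mulLoop (by decide) s₂ I.M fun s' hF => ?_) ?_ ?_
  · have h3 := (hF.rreg 0 (by decide)).trans ((hF2.rreg 0 (by decide)).trans
      (hF1.rreg 0 (by decide)))
    exact h3.trans hM
  · rw [hi2.n]
    simp [RExpr.cost]
  · rintro s' hF h3
    rw [h3, hi2.n, hF.reg 3 (by decide), h2]
    exact ⟨rfl, rfl⟩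

end CycleInstance

/-! ### Matrix cells in row order, and counting -/

namespace RealRAM

theorem before_succ {i' j' i j : ℕ} :
    Before i' j' i (j + 1) ↔ Before i' j' i j ∨ i' = i ∧ j' = j := by
  unfold Before; omega

theorem before_row {i' j' i n : ℕ} (h : j' < n) : Before i' j' i n ↔ Before i' j' (i + 1) 0 := by
  unfold Before; omega

theorem not_before_zero {i' j' : ℕ} : ¬ Before i' j' 0 0 := by
  unfold Before; omega

theorem not_before_self {i j : ℕ} : ¬ Before i j i j := by
  unfold Before; omega

theorem before_last {i j n : ℕ} (h : i < n) : Before i j n 0 := Or.inl h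

theorem update_cell {α : Type*} {n i j i' j' : ℕ} (f : ℕ → α) (x : α) (hj : j < n)
    (hj' : j' < n) : Function.update f (i' * n + j') x (i * n + j) =
      if i = i' ∧ j = j' then x else f (i * n + j) := by
  rw [Function.update_apply]
  exact if_congr (cell_inj hj hj') rfl rfl

/-- The current cell of a matrix inside `Prog.forMat`. -/
abbrev cell : NExpr := .add (.reg 11) (.reg 6)

/-- The number of `x < j` with `P x`. -/
def countBelow {n : ℕ} (P : Fin n → Prop) [DecidablePred P] (j : ℕ) : ℕ :=
  (Finset.univ.filter fun x : Fin n => (x : ℕ) < j ∧ P x).card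

section

variable {n : ℕ} (P : Fin n → Prop) [DecidablePred P]

theorem countBelow_zero : countBelow P 0 = 0 := by simp [countBelow]

theorem countBelow_succ {j : ℕ} (hj : j < n) :
    countBelow P (j + 1) = countBelow P j + if P ⟨j, hj⟩ then 1 else 0 := by
  unfold countBelow
  split_ifs with h
  · rw [← Finset.card_insert_of_notMem (a := ⟨j, hj⟩) (by simp)]
    refine congrArg Finset.card (Finset.ext fun x => ?_)
    simp only [Finset.mem_filter, Finset.mem_univ, true_and, Finset.mem_insert, Fin.ext_iff]
    constructor
    · rintro ⟨h1, h2⟩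
      by_cases hx : (x : ℕ) = j
      · exact Or.inl hx
      · exact Or.inr ⟨by omega, h2⟩
    · rintro (h1 | h1)
      · exact ⟨by omega, by rwa [show x = ⟨j, hj⟩ from Fin.ext h1]⟩
      · exact ⟨by omega, h1.2⟩
  · rw [add_zero]
    refine congrArg Finset.card (Finset.ext fun x => ?_)
    simp only [Finset.mem_filter, Finset.mem_univ, true_and]
    refine and_congr_left fun hx => ⟨fun h1 => ?_, fun h1 => by omega⟩
    have : (x : ℕ) ≠ j := fun hc => h (by rwa [show x = ⟨j, hj⟩ from Fin.ext hc] at hx)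
    omega

theorem countBelow_last : countBelow P n = (Finset.univ.filter P).card := by
  simp [countBelow]

end

end RealRAM

/-! ### Computing distances, rounded data and ball sizes -/

namespace CycleInstance

open RealRAM CyclePlacement

attribute [local simp] NExpr.val RExpr.val Test.holds Prog.run Function.update_apply

variable {I : CycleInstance}

def distInit : Prog :=
  .forMat (.ite (.conj (.neg (.lt (.reg 5) (.reg 6))) (.neg (.lt (.reg 6) (.reg 5))))
    (.rwrite 1 cell (.lit 0))
    (.ite (.rlt (.lit 0) (.read 0 cell)) (.rwrite 1 cell (.read 0 cell)) (.rwrite 1 cell (.reg 3))))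

/-- Real array `1` holds the matrix `A`. -/
def HoldsMat (A : Fin I.n → Fin I.n → ℝ) (s : State) : Prop :=
  ∀ i j : Fin I.n, s.rarr 1 (i * I.n + j) = A i j

theorem runs_distInit {s : State} (h : I.Inp s) (hr : Rows I.n s) (hM : s.rreg 3 = I.n * I.M) :
    Runs distInit s (I.n * (I.n * 31 + 15) + 5) (HoldsMat I.initMatrix) := by
  have := Runs.forMat hr (p := .ite (.conj (.neg (.lt (.reg 5) (.reg 6)))
      (.neg (.lt (.reg 6) (.reg 5)))) (.rwrite 1 cell (.lit 0))
      (.ite (.rlt (.lit 0) (.read 0 cell)) (.rwrite 1 cell (.read 0 cell))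
        (.rwrite 1 cell (.reg 3))))
    (fun i j s => ∀ i' j' : Fin I.n, Before i' j' i j →
      s.rarr 1 (i' * I.n + j') = I.initMatrix i' j')
    24 (by decide) (by decide) (by decide) (by decide) (by decide) (fun _ _ _ _ _ h => h)
    (fun i s h i' j' hb => h i' j' ((before_row j'.2).2 hb))
    (fun i' j' hb => absurd hb not_before_zero) ?_
  · exact Runs.mono this le_rfl fun s' _ h i j => h i j (before_last i.2)
  · intro i j s' hi hj hF h5 h6 h11 _ hI
    have hm := (h.frame hF (by decide) (by decide) (by decide) (by decide) (by decide)).mat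
      ⟨i, hi⟩ ⟨j, hj⟩
    have h3 : s'.rreg 3 = I.n * I.M := (hF.rreg 3 (by decide)).trans hM
    refine Runs.of_flat rfl (by decide) fun i' j' hb => ?_
    suffices H : ((Prog.ite (.conj (.neg (.lt (.reg 5) (.reg 6)))
      (.neg (.lt (.reg 6) (.reg 5)))) (.rwrite 1 cell (.lit 0))
      (.ite (.rlt (.lit 0) (.read 0 cell)) (.rwrite 1 cell (.read 0 cell))
        (.rwrite 1 cell (.reg 3)))).run s').rarr 1
        = Function.update (s'.rarr 1) (i * I.n + j) (I.initMatrix ⟨i, hi⟩ ⟨j, hj⟩) by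
      rw [H, update_cell _ _ j'.2 hj]
      split_ifs with hc
      · congr 1 <;> exact Fin.ext (by simp [hc.1, hc.2])
      · exact hI i' j' ((before_succ.1 hb).resolve_right hc)
    simp only at hm
    unfold initMatrix
    simp only [Fin.mk.injEq]
    by_cases hij : i = j
    · subst hij
      simp [h5, h6, h11]
    · have hij' : ¬ (j ≤ i ∧ i ≤ j) := by omega
      by_cases hp : 0 < I.matrix ⟨i, hi⟩ ⟨j, hj⟩
      · simp [h5, h6, h11, hm, hp, hij, hij']
      · simp [h5, h6, h11, hm, hp, hij, hij', h3]

def distStep : Prog :=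
  .ite (.rlt (.add (.read 1 (.add (.reg 11) (.reg 7))) (.read 1 (.add (.reg 8) (.reg 6))))
    (.read 1 cell))
    (.rwrite 1 cell (.add (.read 1 (.add (.reg 11) (.reg 7))) (.read 1 (.add (.reg 8) (.reg 6)))))
    .skip

def distLoop : Prog :=
  .forTo 7 0 (.set 8 (.read 1 (.reg 7)) ;; .forMat distStep)

theorem runs_distLoop {s : State} (hr : Rows I.n s) (hA : HoldsMat I.initMatrix s) :
    Runs distLoop s (I.n * (I.n * (I.n * 34 + 15) + 15) + 5)
      (HoldsMat (I := I) fun u v => weightedDist I.G I.w u v) := by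
  have := Runs.forTo_const (x := 7) (b := 0) (s := s)
    (p := .set 8 (.read 1 (.reg 7)) ;; .forMat distStep)
    (fun k => HoldsMat (floydWarshall I.initMatrix k)) (I.n * (I.n * 34 + 15) + 8)
    (by decide) (by decide) (by decide) (fun _ _ _ h => h) hA ?_
  · rw [hr.size] at this
    refine Runs.mono this (by simp [add_assoc]) fun s' _ h i j => ?_
    rw [h i j, I.floydWarshall_eq]
  intro k s₁ hk hF1 h7 hA1
  rw [hr.size] at hk
  have hr1 := hr.frame hF1 (by decide) (by decide)
  refine Runs.mono (Runs.seq (T₁ := 3) (T₂ := I.n * (I.n * 34 + 15) + 5)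
    (Q₁ := fun s' => s'.reg 8 = k * I.n) (Q := HoldsMat (floydWarshall I.initMatrix (k + 1)))
    (Runs.of_flat rfl (by decide) (by simp [h7, hr1.row k hk])) fun s₂ hF2 h8 => ?_) (by omega)
    fun _ _ h => h
  have hr2 := hr1.frame hF2 (by decide) (by decide)
  have h72 : s₂.reg 7 = k := (hF2.reg 7 (by decide)).trans h7
  have hA2 : HoldsMat (floydWarshall I.initMatrix k) s₂ := fun i j => by
    rw [hF2.rarr 1 (by decide)]
    exact hA1 i j
  have := Runs.forMat hr2 (p := distStep)
    (fun i j s => ∀ i' j' : Fin I.n, (Before i' j' i j →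
      s.rarr 1 (i' * I.n + j') = floydWarshall I.initMatrix (k + 1) i' j') ∧ (¬ Before i' j' i j →
      s.rarr 1 (i' * I.n + j') = floydWarshall I.initMatrix k i' j'))
    27 (by decide) (by decide) (by decide) (by decide) (by decide) (fun _ _ _ _ _ h => h)
    (fun i s h i' j' => by rw [← before_row j'.2]; exact h i' j')
    (fun i' j' => ⟨fun hb => absurd hb not_before_zero, fun _ => hA2 i' j'⟩) ?_
  · exact Runs.mono this le_rfl fun s' _ h i j => (h i j).1 (before_last i.2)
  intro i j s' hi hj hF h5 h6 h11 _ hI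
  have h7' : s'.reg 7 = k := (hF.reg 7 (by decide)).trans h72
  have h8' : s'.reg 8 = k * I.n := (hF.reg 8 (by decide)).trans h8
  have e1 : s'.rarr 1 (i * I.n + j) = floydWarshall I.initMatrix k ⟨i, hi⟩ ⟨j, hj⟩ :=
    (hI ⟨i, hi⟩ ⟨j, hj⟩).2 not_before_self
  -- This cell may already have been overwritten in the present round, but column `k` has the same
  -- values before and after; likewise row `k` below.
  have e2 : s'.rarr 1 (i * I.n + k) = floydWarshall I.initMatrix k ⟨i, hi⟩ ⟨k, hk⟩ := by
    by_cases hb : Before i k i j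
    · rw [(hI ⟨i, hi⟩ ⟨k, hk⟩).1 hb, floydWarshall_col I.initMatrix_nonneg I.initMatrix_self]
    · exact (hI ⟨i, hi⟩ ⟨k, hk⟩).2 hb
  have e3 : s'.rarr 1 (k * I.n + j) = floydWarshall I.initMatrix k ⟨k, hk⟩ ⟨j, hj⟩ := by
    by_cases hb : Before k j i j
    · rw [(hI ⟨k, hk⟩ ⟨j, hj⟩).1 hb, floydWarshall_row I.initMatrix_nonneg I.initMatrix_self]
    · exact (hI ⟨k, hk⟩ ⟨j, hj⟩).2 hb
  have H : (distStep.run s').rarr 1 = Function.update (s'.rarr 1) (i * I.n + j)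
      (floydWarshall I.initMatrix (k + 1) ⟨i, hi⟩ ⟨j, hj⟩) := by
    rw [floydWarshall_succ hk]
    simp only [distStep, Prog.run, Test.holds, RExpr.val, NExpr.val, h11, h6, h7', h8', e1, e2, e3]
    split_ifs with hlt
    · rw [min_eq_right hlt.le]
      simp
    · rw [min_eq_left (not_lt.1 hlt), ← e1, Function.update_eq_self]
  refine Runs.of_flat rfl (by decide) fun i' j' => ?_
  rw [H, update_cell _ _ j'.2 hj, before_succ]
  by_cases hc : (i' : ℕ) = i ∧ (j' : ℕ) = j
  · have h1 : i' = ⟨i, hi⟩ := Fin.ext hc.1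
    have h2 : j' = ⟨j, hj⟩ := Fin.ext hc.2
    simp [h1, h2]
  · simp only [hc, if_false, or_false]
    exact hI i' j'

def roundStep : Prog :=
  .rset 5 (.read 1 cell) ;; ceilLoop 8 4 5 ;; .write 2 cell (.reg 8) ;;
  .ite (.rlt (.lit 0) (.read 0 cell))
    (mulLoop 7 2 5 (.read 0 cell) ;; floorLoop 8 4 5 ;; .write 3 cell (.add (.reg 8) (.lit 1)))
    (.write 3 cell (.lit 0))

theorem runs_roundStep {s : State} (h : I.Inp s)
    (hD : HoldsMat (I := I) (fun u v => weightedDist I.G I.w u v) s) {R : ℕ} (hL : I.data.L ≤ R)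
    (hM : I.M ≤ R + 1) {i j : Fin I.n} (h6 : s.reg 6 = j) (h11 : s.reg 11 = i * I.n) :
    Runs roundStep s (12 * (I.n * (R + 1)) + I.d * 15 + 12 * R + 50) (fun s' =>
      s'.arr 2 = Function.update (s.arr 2) (i * I.n + j) (I.data.dc i j) ∧
      s'.arr 3 = Function.update (s.arr 3) (i * I.n + j) (I.data.e i j)) := by
  have hn : 0 < I.n := by have := I.two_le_n; omega
  refine Runs.mono (Runs.seq (T₁ := 5)
    (T₂ := 12 * (I.n * (R + 1)) + 8 + (5 + (I.d * 15 + 12 * R + 28)))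
    (Q₁ := fun s' => s'.rreg 5 = weightedDist I.G I.w i j)
    (Runs.of_flat rfl (by decide) (by simp [h6, h11, hD i j])) fun s₁ hF1 h1 => ?_) (by omega)
    fun _ _ h => h
  -- The ceiling is found by counting up to the distance, which is at most nM. This costs O(nR) per
  -- cell, hence O(n³R) in total.
  have hceil : ⌈weightedDist I.G I.w i j⌉₊ ≤ I.n * (R + 1) := by
    refine Nat.ceil_le.2 ((I.weightedDist_le_mul i j).trans ?_)
    push_cast
    gcongr
  refine Runs.seq (runs_ceilLoop (by decide) s₁ (by rw [h1]; exact hceil)) fun s₂ hF2 h2 => ?_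
  rw [h1] at h2
  have hF12 : Frame (Prog.rset 5 (.read 1 cell) ;; ceilLoop 8 4 5) s s₂ :=
    (hF1.seq_left _).trans (hF2.seq_right _)
  have h62 : s₂.reg 6 = j := (hF12.reg 6 (by decide)).trans h6
  have h112 : s₂.reg 11 = i * I.n := (hF12.reg 11 (by decide)).trans h11
  have hi2 := h.frame hF12 (by decide) (by decide) (by decide) (by decide) (by decide)
  refine Runs.seq (Q₁ := fun s' => s'.arr 2 =
    Function.update (s.arr 2) (i * I.n + j) (I.data.dc i j))
    (Runs.of_flat rfl (by decide) ?_) fun s₃ hF3 h3 => ?_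
  · simp only [Prog.run, NExpr.val, h62, h112, h2, Function.update_self,
      hF12.arr 2 (by decide)]
    rfl
  have h63 : s₃.reg 6 = j := (hF3.reg 6 (by decide)).trans h62
  have h113 : s₃.reg 11 = i * I.n := (hF3.reg 11 (by decide)).trans h112
  have hi3 := hi2.frame hF3 (by decide) (by decide) (by decide) (by decide) (by decide)
  have ha3 : s₃.arr 3 = s.arr 3 := (hF3.arr 3 (by decide)).trans (hF12.arr 3 (by decide))
  refine Runs.mono (Runs.ite (T := I.d * 15 + 12 * R + 22) (fun hb => ?_) fun hb => ?_)
    (by simp [Test.cost, RExpr.cost, NExpr.cost]; omega) fun _ _ h => h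
  · simp only [Test.holds, RExpr.val, NExpr.val, h63, h113, hi3.mat, Nat.cast_zero] at hb
    have hadj := I.matrix_pos.1 hb
    refine Runs.mono (Runs.seq (T₁ := I.d * 15 + 7) (T₂ := 12 * R + 8 + 7)
      (Q₁ := fun s' => s'.rreg 5 = I.d * I.w s(i, j)) ?_ fun s₄ hF4 h4 => ?_) (by omega)
      fun _ _ h => h
    · refine Runs.mono (runs_mulLoop (by decide) s₃ (I.matrix i j) fun s' hF => ?_) ?_ ?_
      · simp only [RExpr.val, NExpr.val, hF.reg 11 (by decide), hF.reg 6 (by decide),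
          hF.rarr 0 (by decide), h63, h113, hi3.mat]
      · rw [hi3.d]
        simp [RExpr.cost, NExpr.cost]
        omega
      · rintro s' - h4
        rw [h4, hi3.d, I.matrix_of_adj hadj]
    have hw : ⌊(I.d * I.w s(i, j) : ℝ)⌋₊ ≤ R :=
      le_trans (Nat.floor_le_floor (by gcongr; exact I.le_M (e := s(i, j)) hadj)) hL
    refine Runs.seq (runs_floorLoop (by decide) s₄ (by rw [h4]; exact hw)
      (by rw [h4]; have := I.w_pos s(i, j) hadj; positivity)) fun s₅ hF5 h5 => ?_
    rw [h4] at h5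
    refine Runs.of_flat rfl (by decide) ?_
    have h65 : s₅.reg 6 = j :=
      (hF5.reg 6 (by decide)).trans ((hF4.reg 6 (by decide)).trans h63)
    have h115 : s₅.reg 11 = i * I.n :=
      (hF5.reg 11 (by decide)).trans ((hF4.reg 11 (by decide)).trans h113)
    have ha5 : s₅.arr = s₃.arr := funext fun a =>
      (hF5.arr a (by simp [floorLoop, Prog.wa])).trans
        (hF4.arr a (by simp [mulLoop, Prog.forTo, Prog.wa]))
    constructor
    · simp [ha5, h3]
    · simp only [Prog.run, NExpr.val, Function.update_self, h65, h115, h5, ha5, ha3]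
      simp [data, hadj]
  · simp only [Test.holds, RExpr.val, NExpr.val, h63, h113, hi3.mat, Nat.cast_zero] at hb
    rw [I.matrix_pos] at hb
    refine Runs.mono (Runs.of_flat (T := 5) rfl (by decide) ?_) (by omega) fun _ _ h => h
    constructor
    · simp [h3]
    · simp [h63, h113, ha3, data, hb]

/-- The integer data are stored in arrays `2` and `3`. -/
structure HoldsData {n : ℕ} (D : Data n) (s : State) : Prop where
  dc : ∀ i j : Fin n, s.arr 2 (i * n + j) = D.dc i j
  e : ∀ i j : Fin n, s.arr 3 (i * n + j) = D.e i j

theorem runs_round {s : State} (h : I.Inp s) (hr : Rows I.n s)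
    (hD : HoldsMat (I := I) (fun u v => weightedDist I.G I.w u v) s) {R : ℕ} (hL : I.data.L ≤ R)
    (hM : I.M ≤ R + 1) : Runs (.forMat roundStep) s
      (I.n * (I.n * (12 * (I.n * (R + 1)) + I.d * 15 + 12 * R + 57) + 15) + 5)
      (HoldsData I.data) := by
  have := Runs.forMat hr (p := roundStep)
    (fun i j s => ∀ i' j' : Fin I.n, Before i' j' i j →
      s.arr 2 (i' * I.n + j') = I.data.dc i' j' ∧ s.arr 3 (i' * I.n + j') = I.data.e i' j')
    (12 * (I.n * (R + 1)) + I.d * 15 + 12 * R + 50)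
    (by decide) (by decide) (by decide) (by decide) (by decide) (fun _ _ _ _ _ h => h)
    (fun i s h i' j' hb => h i' j' ((before_row j'.2).2 hb))
    (fun i' j' hb => absurd hb not_before_zero) ?_
  · exact Runs.mono this le_rfl fun s' _ h =>
      ⟨fun i j => (h i j (before_last i.2)).1, fun i j => (h i j (before_last i.2)).2⟩
  intro i j s' hi hj hF h5 h6 h11 _ hI
  refine Runs.mono (runs_roundStep (i := ⟨i, hi⟩) (j := ⟨j, hj⟩)
    (h.frame hF (by decide) (by decide) (by decide) (by decide) (by decide))
    (fun u v => by rw [hF.rarr 1 (by decide)]; exact hD u v) hL hM h6 h11) le_rfl ?_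
  rintro s₁ - ⟨h1, h2⟩ i' j' hb
  rw [h1, h2, update_cell _ _ j'.2 hj, update_cell _ _ j'.2 hj]
  split_ifs with hc
  · rw [show i' = ⟨i, hi⟩ from Fin.ext hc.1, show j' = ⟨j, hj⟩ from Fin.ext hc.2]
    exact ⟨rfl, rfl⟩
  · exact hI i' j' ((before_succ.1 hb).resolve_right hc)

/-- Compute the degrees and test the sizes of the balls. -/
def ballStep : Prog :=
  .ite (.lt (.lit 0) (.read 3 (.add (.read 1 (.reg 6)) (.reg 5))))
    (.set 7 (.add (.reg 7) (.lit 1))) .skip ;;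
  .ite (.lt (.read 2 cell) (.add (.reg 3) (.lit 2))) (.set 8 (.add (.reg 8) (.lit 1))) .skip

def ballRow : Prog :=
  (.set 7 (.lit 0) ;; .set 8 (.lit 0) ;; .set 11 (.read 1 (.reg 5))) ;; .forTo 6 0 ballStep ;;
  (.write 4 (.reg 5) (.reg 7) ;; .ite (.lt (.reg 10) (.reg 8)) (.set 9 (.lit 1)) .skip)

def ballBound : Prog :=
  .set 10 (.lit 1) ;;
  .forTo 5 2 (.set 10 (.add (.reg 10) (.add (.add (.reg 3) (.lit 1)) (.add (.reg 3) (.lit 1)))))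

def ballTest : Prog :=
  ballBound ;; .set 9 (.lit 0) ;; .forTo 5 0 ballRow

/-- The number of neighbours of `y`. -/
def _root_.CyclePlacement.Data.deg {n : ℕ} (D : Data n) (y : Fin n) : ℕ :=
  (Finset.univ.filter fun x => 0 < D.e x y).card

/-- The number of vertices within distance `L + 1` of `v`. -/
def _root_.CyclePlacement.Data.ball {n : ℕ} (D : Data n) (v : Fin n) : ℕ :=
  (Finset.univ.filter fun u => D.dc v u ≤ D.L + 1).card

theorem runs_ballBound {s : State} {L d : ℕ} (h3 : s.reg 3 = L) (h2 : s.reg 2 = d) :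
    Runs ballBound s (d * 17 + 7) (fun s' => s'.reg 10 = d * (2 * (L + 1)) + 1) := by
  refine Runs.mono (Runs.seq (T₁ := 2) (T₂ := d * 17 + 5) (Q₁ := fun s => s.reg 10 = 1)
    (Q := fun s' => s'.reg 10 = d * (2 * (L + 1)) + 1)
    (Runs.of_flat rfl (by decide) (by simp)) fun s₁ hF h1 => ?_) (by omega) fun _ _ h => h
  have h3' : s₁.reg 3 = L := (hF.reg 3 (by decide)).trans h3
  have h2' : s₁.reg 2 = d := (hF.reg 2 (by decide)).trans h2
  have := Runs.forTo_const (x := 5) (b := 2) (s := s₁)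
    (p := .set 10 (.add (.reg 10) (.add (.add (.reg 3) (.lit 1)) (.add (.reg 3) (.lit 1)))))
    (fun i s => s.reg 10 = i * (2 * (L + 1)) + 1 ∧ s.reg 3 = L) 10
    (by decide) (by decide) (by decide) (fun i s v h => by simpa using h)
    (by simp [h1, h3']) fun i s' hi hF' h5 ⟨h4, h6⟩ => ?_
  · rw [h2'] at this
    exact Runs.mono this le_rfl fun s _ h => h.1
  · refine Runs.of_flat rfl (by decide) ⟨?_, by simpa using h6⟩
    simp [h4, h6]
    ring

theorem runs_ballRow {n : ℕ} {D : Data n} {s : State} (hr : Rows n s) (hD : HoldsData D s)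
    (h3 : s.reg 3 = D.L) {i : Fin n} (h5 : s.reg 5 = i) :
    Runs ballRow s (n * 33 + 20) (fun s' =>
      s'.arr 4 = Function.update (s.arr 4) i (D.deg i) ∧
      s'.reg 9 = if s.reg 10 < D.ball i then 1 else s.reg 9) := by
  refine Runs.mono (Runs.seq (T₁ := 7) (T₂ := (n * 33 + 5) + 8)
    (Q₁ := fun s' => s'.reg 7 = 0 ∧ s'.reg 8 = 0 ∧ s'.reg 11 = i * n)
    (Runs.of_flat rfl (by decide) (by simp [h5, hr.row i i.2])) fun s₁ hF1 ⟨h7, h8, h11⟩ => ?_)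
    (by omega) fun _ _ h => h
  have hr1 := hr.frame hF1 (by decide) (by decide)
  have h51 : s₁.reg 5 = i := (hF1.reg 5 (by decide)).trans h5
  have h31 : s₁.reg 3 = D.L := (hF1.reg 3 (by decide)).trans h3
  refine Runs.seq (Q₁ := fun s' => s'.reg 7 = D.deg i ∧ s'.reg 8 = D.ball i) ?_
    fun s₂ hF2 ⟨h72, h82⟩ => ?_
  · have := Runs.forTo_const (x := 6) (b := 0) (s := s₁) (p := ballStep)
      (fun j s => s.reg 7 = countBelow (fun x => 0 < D.e x i) j ∧
        s.reg 8 = countBelow (fun u => D.dc i u ≤ D.L + 1) j) 26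
      (by decide) (by decide) (by decide) (fun i s v h => by simpa using h)
      ⟨by rw [h7, countBelow_zero], by rw [h8, countBelow_zero]⟩
      fun j s' hj hF' h6 ⟨h4, h9⟩ => ?_
    · rw [hr1.size, countBelow_last, countBelow_last] at this
      exact Runs.mono this le_rfl fun s _ h => h
    · rw [hr1.size] at hj
      have hr' := hr1.frame hF' (by decide) (by decide)
      have a2 : s'.arr 2 (i * n + j) = D.dc i ⟨j, hj⟩ := by
        rw [hF'.arr 2 (by decide), hF1.arr 2 (by decide)]
        exact hD.dc i ⟨j, hj⟩
      have a3 : s'.arr 3 (j * n + i) = D.e ⟨j, hj⟩ i := by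
        rw [hF'.arr 3 (by decide), hF1.arr 3 (by decide)]
        exact hD.e ⟨j, hj⟩ i
      have h5' : s'.reg 5 = i := (hF'.reg 5 (by decide)).trans h51
      have h3' : s'.reg 3 = D.L := (hF'.reg 3 (by decide)).trans h31
      have h11' : s'.reg 11 = i * n := (hF'.reg 11 (by decide)).trans h11
      refine Runs.of_flat rfl (by decide) ?_
      rw [countBelow_succ _ hj, countBelow_succ _ hj]
      have hle : D.dc i ⟨j, hj⟩ ≤ D.L + 1 ↔ D.dc i ⟨j, hj⟩ < D.L + 2 := by omega
      by_cases hp : 0 < D.e ⟨j, hj⟩ i <;> by_cases hq : D.dc i ⟨j, hj⟩ < D.L + 2 <;>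
        simp [ballStep, h5', h3', h11', h6, hr'.row j hj, a2, a3, hp, hq, hle, h4, h9]
  · have h52 : s₂.reg 5 = i := (hF2.reg 5 (by decide)).trans h51
    have h10 : s₂.reg 10 = s.reg 10 := (hF2.reg 10 (by decide)).trans (hF1.reg 10 (by decide))
    have h9 : s₂.reg 9 = s.reg 9 := (hF2.reg 9 (by decide)).trans (hF1.reg 9 (by decide))
    have ha : s₂.arr 4 = s.arr 4 := (hF2.arr 4 (by decide)).trans (hF1.arr 4 (by decide))
    refine Runs.of_flat rfl (by decide) ?_
    by_cases hlt : s.reg 10 < D.ball i <;> simp [h52, h72, h82, h10, h9, ha, hlt]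

/-- The result of the preprocessing. -/
structure Env {n : ℕ} (D : Data n) (s : State) : Prop where
  rows : Rows n s
  N : s.reg 1 = D.N
  L : s.reg 3 = D.L
  data : HoldsData D s
  deg : ∀ i : Fin n, s.arr 4 i = D.deg i

theorem runs_ballTest {n : ℕ} {D : Data n} {s : State} (hr : Rows n s) (hD : HoldsData D s)
    (h1 : s.reg 1 = D.N) (h3 : s.reg 3 = D.L) {d : ℕ} (h2 : s.reg 2 = d) :
    Runs ballTest s (d * 17 + n * (n * 33 + 27) + 14) (fun s' => Env D s' ∧
      ((s'.reg 9 = 0 ∧ ∀ v, D.ball v ≤ d * (2 * (D.L + 1)) + 1) ∨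
      (s'.reg 9 = 1 ∧ ∃ v, d * (2 * (D.L + 1)) + 1 < D.ball v))) := by
  refine Runs.mono (Runs.seq (T₂ := 2 + (n * (n * 33 + 27) + 5))
    (Q := fun s' => (∀ i : Fin n, s'.arr 4 i = D.deg i) ∧
      ((s'.reg 9 = 0 ∧ ∀ v, D.ball v ≤ d * (2 * (D.L + 1)) + 1) ∨
      (s'.reg 9 = 1 ∧ ∃ v, d * (2 * (D.L + 1)) + 1 < D.ball v)))
    (runs_ballBound h3 h2) fun s₁ hF1 h10 => ?_) (by omega)
    fun s' hF h => ⟨⟨hr.frame hF (by decide) (by decide), (hF.reg 1 (by decide)).trans h1,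
      (hF.reg 3 (by decide)).trans h3,
      ⟨fun i j => by rw [hF.arr 2 (by decide)]; exact hD.dc i j,
        fun i j => by rw [hF.arr 3 (by decide)]; exact hD.e i j⟩, h.1⟩, h.2⟩
  refine Runs.seq (Q₁ := fun s' => s'.reg 9 = 0) (Runs.of_flat rfl (by decide) (by simp))
    fun s₂ hF2 h9 => ?_
  have hF12 : Frame (ballBound ;; .set 9 (.lit 0)) s s₂ := (hF1.seq_left _).trans (hF2.seq_right _)
  have hr2 := hr.frame hF12 (by decide) (by decide)
  have h102 : s₂.reg 10 = d * (2 * (D.L + 1)) + 1 := (hF2.reg 10 (by decide)).trans h10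
  have := Runs.forTo_const (x := 5) (b := 0) (s := s₂) (p := ballRow)
    (fun i s => (∀ k : Fin n, (k : ℕ) < i → s.arr 4 k = D.deg k) ∧
      ((s.reg 9 = 0 ∧ ∀ v : Fin n, (v : ℕ) < i → D.ball v ≤ d * (2 * (D.L + 1)) + 1) ∨
      (s.reg 9 = 1 ∧ ∃ v, d * (2 * (D.L + 1)) + 1 < D.ball v))) (n * 33 + 20)
    (by decide) (by decide) (by decide) (fun i s v h => by simpa using h)
    ⟨by simp, Or.inl ⟨h9, by simp⟩⟩ fun i s' hi hF' h5 ⟨h6, h7⟩ => ?_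
  · rw [hr2.size] at this
    refine Runs.mono this (by simp [add_assoc]) fun s' _ h => ⟨fun i => h.1 i i.2, ?_⟩
    rcases h.2 with h' | h'
    · exact Or.inl ⟨h'.1, fun v => h'.2 v v.2⟩
    · exact Or.inr h'
  · rw [hr2.size] at hi
    refine Runs.mono (runs_ballRow (D := D) (i := ⟨i, hi⟩) (hr2.frame hF' (by decide) (by decide))
      ⟨fun i j => ?_, fun i j => ?_⟩ ?_ h5) le_rfl ?_
    · rw [hF'.arr 2 (by decide), hF12.arr 2 (by decide)]
      exact hD.dc i j
    · rw [hF'.arr 3 (by decide), hF12.arr 3 (by decide)]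
      exact hD.e i j
    · exact (hF'.reg 3 (by decide)).trans ((hF12.reg 3 (by decide)).trans h3)
    · rintro s₃ - ⟨h8, h9'⟩
      have hk : ∀ k : Fin n, (k : ℕ) < i + 1 → (k : ℕ) < i ∨ k = ⟨i, hi⟩ := fun k hk => by
        by_cases hc : (k : ℕ) = i
        · exact Or.inr (Fin.ext hc)
        · exact Or.inl (by omega)
      rw [(hF'.reg 10 (by decide)).trans h102] at h9'
      refine ⟨fun k hk' => ?_, ?_⟩
      · rw [h8]
        rcases hk k hk' with h | rfl
        · rw [Function.update_of_ne (by dsimp only; omega)]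
          exact h6 k h
        · simp
      · split_ifs at h9' with hlt
        · exact Or.inr ⟨h9', _, hlt⟩
        · rcases h7 with h | h
          · refine Or.inl ⟨h9'.trans h.1, fun v hv => ?_⟩
            rcases hk v hv with h' | rfl
            · exact h.2 v h'
            · exact not_lt.1 hlt
          · exact Or.inr ⟨h9'.trans h.1, h.2⟩

end CycleInstance

/-! ### The search program -/

namespace CycleInstance

open RealRAM CyclePlacement

attribute [local simp] NExpr.val RExpr.val Test.holds Prog.run Function.update_apply

variable {n : ℕ}

/-- The number of placed neighbours of `y`. -/
def _root_.CyclePlacement.Data.pn (D : Data n) (pos : Fin n → ℕ) (y : Fin n) : ℕ :=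
  (Finset.univ.filter fun x => pos x ≠ 0 ∧ 0 < D.e x y).card

/-- With the counters at hand, the existence of an unplaced neighbour is one comparison, so a
candidate is tested without a quadratic scan over pairs of vertices. -/
theorem pn_lt_deg {D : Data n} {pos : Fin n → ℕ} {y : Fin n} :
    D.pn pos y < D.deg y ↔ ∃ z, pos z = 0 ∧ 0 < D.e z y := by
  have hsub : (Finset.univ.filter fun x => pos x ≠ 0 ∧ 0 < D.e x y) ⊆
      Finset.univ.filter fun x => 0 < D.e x y := fun x => by simp
  constructor
  · intro h
    by_contra hc
    push Not at hc
    refine absurd h (not_lt.2 (Finset.card_le_card fun x hx => ?_))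
    simp only [Finset.mem_filter, Finset.mem_univ, true_and] at hx ⊢
    exact ⟨fun h0 => by have := hc x h0; omega, hx⟩
  · rintro ⟨z, hz, he⟩
    exact Finset.card_lt_card ⟨hsub, fun hc => by
      have := hc (show z ∈ _ by simpa using he)
      simp [hz] at this⟩

theorem pn_pos {D : Data n} {pos : Fin n → ℕ} {y : Fin n} :
    0 < D.pn pos y ↔ ∃ x, pos x ≠ 0 ∧ 0 < D.e x y := by
  rw [Data.pn, Finset.card_pos]
  simp [Finset.Nonempty]

theorem pn_ext {D : Data n} {t : Entry n} {u : Fin n} (hu : t.pos u = 0) {g : ℕ} (hg : 1 ≤ g)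
    (y : Fin n) : D.pn (t.ext u g).pos y = D.pn t.pos y + if 0 < D.e u y then 1 else 0 := by
  unfold Data.pn
  split_ifs with he
  · rw [← Finset.card_insert_of_notMem (a := u) (by simp [hu])]
    refine congrArg Finset.card (Finset.ext fun x => ?_)
    by_cases hx : x = u
    · subst hx
      simp only [Finset.mem_filter, Finset.mem_univ, true_and, Finset.mem_insert, true_or,
        Entry.ext_pos_self, iff_true]
      exact ⟨by omega, he⟩
    · simp [Entry.ext_pos_ne _ _ hx, hx]
  · rw [add_zero]
    refine congrArg Finset.card (Finset.ext fun x => ?_)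
    by_cases hx : x = u
    · subst hx
      simp [he]
    · simp [Entry.ext_pos_ne _ _ hx]

theorem pn_init {D : Data n} (m : ℕ) (r y : Fin n) :
    D.pn (Entry.init m r).pos y = if 0 < D.e r y then 1 else 0 := by
  have hp : ∀ x, (Entry.init m r).pos x ≠ 0 ↔ x = r := fun x => by
    by_cases h : x = r <;> simp [Entry.init, h]
  unfold Data.pn
  simp only [hp]
  split_ifs with he
  · rw [Finset.card_eq_one]
    refine ⟨r, Finset.ext fun x => ?_⟩
    simp only [Finset.mem_filter, Finset.mem_univ, true_and, Finset.mem_singleton,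
      and_iff_left_iff_imp]
    rintro rfl
    exact he
  · rw [Finset.card_eq_zero]
    refine Finset.eq_empty_of_forall_notMem fun x => ?_
    simp only [Finset.mem_filter, Finset.mem_univ, true_and, not_and]
    rintro rfl
    exact he

theorem Env.frame {D : Data n} {p : Prog} {s s' : State} (h : Env D s) (hF : Frame p s s')
    (h1 : ∀ x ∈ [0, 1, 3], x ∉ p.wr) (h2 : ∀ x ∈ [1, 2, 3, 4], x ∉ p.wa) : Env D s' :=
  ⟨h.rows.frame hF (h1 0 (by simp)) (h2 1 (by simp)), (hF.reg 1 (h1 1 (by simp))).trans h.N,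
    (hF.reg 3 (h1 3 (by simp))).trans h.L,
    ⟨fun i j => by rw [hF.arr 2 (h2 2 (by simp))]; exact h.data.dc i j,
      fun i j => by rw [hF.arr 3 (h2 3 (by simp))]; exact h.data.e i j⟩,
    fun i => by rw [hF.arr 4 (h2 4 (by simp))]; exact h.deg i⟩

/-- The entry number `k` in memory is `t`. -/
structure RepEntry (D : Data n) (k : ℕ) (t : Entry n) (s : State) : Prop where
  pos : ∀ y : Fin n, s.arr 5 (k * n + y) = t.pos y
  pn : ∀ y : Fin n, s.arr 6 (k * n + y) = D.pn t.pos y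
  off : s.arr 10 k = k * n
  p : s.arr 11 k = t.p
  last : s.arr 12 k = t.last
  start : s.arr 13 k = t.start
  mode : s.arr 14 k = t.mode
  size : s.arr 15 k = t.size

theorem RepEntry.congr {D : Data n} {k : ℕ} {t : Entry n} {s s' : State} (h : RepEntry D k t s)
    (ha : ∀ a ∈ [5, 6, 10, 11, 12, 13, 14, 15], s'.arr a = s.arr a) : RepEntry D k t s' := by
  simp only [List.mem_cons, List.not_mem_nil, or_false, forall_eq_or_imp, forall_eq] at ha
  obtain ⟨h5, h6, h10, h11, h12, h13, h14, h15⟩ := ha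
  refine ⟨?_, ?_, ?_, ?_, ?_, ?_, ?_, ?_⟩
  · rw [h5]; exact h.pos
  · rw [h6]; exact h.pn
  · rw [h10]; exact h.off
  · rw [h11]; exact h.p
  · rw [h12]; exact h.last
  · rw [h13]; exact h.start
  · rw [h14]; exact h.mode
  · rw [h15]; exact h.size

/-- The entry under construction is `t`. -/
structure Scratch (D : Data n) (t : Entry n) (s : State) : Prop where
  pos : ∀ y : Fin n, s.arr 7 y = t.pos y
  pn : ∀ y : Fin n, s.arr 8 y = D.pn t.pos y
  p : s.reg 24 = t.p
  last : s.reg 22 = t.last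
  start : s.reg 18 = t.start
  mode : s.reg 19 = t.mode
  size : s.reg 41 = t.size

theorem Scratch.frame {D : Data n} {t : Entry n} {p : Prog} {s s' : State} (h : Scratch D t s)
    (hF : Frame p s s') (h1 : ∀ x ∈ [24, 22, 18, 19, 41], x ∉ p.wr)
    (h2 : ∀ x ∈ [7, 8], x ∉ p.wa) : Scratch D t s' :=
  ⟨fun y => by rw [hF.arr 7 (h2 7 (by simp))]; exact h.pos y,
    fun y => by rw [hF.arr 8 (h2 8 (by simp))]; exact h.pn y,
    (hF.reg 24 (h1 24 (by simp))).trans h.p, (hF.reg 22 (h1 22 (by simp))).trans h.last,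
    (hF.reg 18 (h1 18 (by simp))).trans h.start, (hF.reg 19 (h1 19 (by simp))).trans h.mode,
    (hF.reg 41 (h1 41 (by simp))).trans h.size⟩

def writeBody : Prog :=
  .write 5 (.add (.reg 32) (.reg 27)) (.read 7 (.reg 27)) ;;
  .write 6 (.add (.reg 32) (.reg 27)) (.read 8 (.reg 27))

def writeFields : Prog :=
  .write 10 (.reg 40) (.reg 32) ;; .write 11 (.reg 40) (.reg 24) ;; .write 12 (.reg 40) (.reg 22) ;;
  .write 13 (.reg 40) (.reg 18) ;; .write 14 (.reg 40) (.reg 19) ;; .write 15 (.reg 40) (.reg 41)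

/-- Copy the entry under construction to place `40`, with offset `32`. -/
def writeEntry : Prog := .forTo 27 0 writeBody ;; writeFields

theorem runs_writeEntry {D : Data n} {s : State} (hr : Rows n s) {t : Entry n}
    (ht : Scratch D t s) {q : ℕ} (h40 : s.reg 40 = q) (h32 : s.reg 32 = q * n) :
    Runs writeEntry s (n * 19 + 23) (fun s' => RepEntry D q t s' ∧
      ∀ k ≠ q, ∀ t', RepEntry D k t' s → RepEntry D k t' s') := by
  have hbody := Runs.forTo_const (x := 27) (b := 0) (s := s) (p := writeBody)
    (fun j s' => (∀ y : Fin n, (y : ℕ) < j → s'.arr 5 (q * n + y) = t.pos y ∧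
      s'.arr 6 (q * n + y) = D.pn t.pos y) ∧ ∀ k ≠ q, ∀ y : Fin n,
      s'.arr 5 (k * n + y) = s.arr 5 (k * n + y) ∧ s'.arr 6 (k * n + y) = s.arr 6 (k * n + y)) 12
    (by decide) (by decide) (by decide) (fun i s v h => h)
    ⟨fun y hy => by omega, fun k _ y => ⟨rfl, rfl⟩⟩ fun j s' hj hF h27 ⟨h1, h2⟩ => ?_
  · rw [hr.size] at hbody
    refine Runs.mono (Runs.seq (T₂ := 18) hbody (Q := fun s' => RepEntry D q t s' ∧
      ∀ k ≠ q, ∀ t', RepEntry D k t' s → RepEntry D k t' s') fun s₁ hF ⟨h1, h2⟩ => ?_) (by omega)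
      fun _ _ h => h
    have ht1 := ht.frame hF (by decide) (by decide)
    have h40' : s₁.reg 40 = q := (hF.reg 40 (by decide)).trans h40
    have h32' : s₁.reg 32 = q * n := (hF.reg 32 (by decide)).trans h32
    have ha : ∀ a ∉ [5, 6], s₁.arr a = s.arr a := fun a h => hF.arr a (by
      simpa [Prog.forTo, writeBody, Prog.wa] using h)
    refine Runs.of_flat rfl (by decide) ⟨⟨fun y => ?_, fun y => ?_, ?_, ?_, ?_, ?_, ?_, ?_⟩,
      fun k hk t' h => ⟨fun y => ?_, fun y => ?_, ?_, ?_, ?_, ?_, ?_, ?_⟩⟩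
    · simpa [writeFields] using (h1 y y.2).1
    · simpa [writeFields] using (h1 y y.2).2
    · simp [writeFields, h40', h32']
    · simp [writeFields, h40', ht1.p]
    · simp [writeFields, h40', ht1.last]
    · simp [writeFields, h40', ht1.start]
    · simp [writeFields, h40', ht1.mode]
    · simp [writeFields, h40', ht1.size]
    · simpa [writeFields, (h2 k hk y).1] using h.pos y
    · simpa [writeFields, (h2 k hk y).2] using h.pn y
    · simpa [writeFields, h40', hk, ha] using h.off
    · simpa [writeFields, h40', hk, ha] using h.p
    · simpa [writeFields, h40', hk, ha] using h.last
    · simpa [writeFields, h40', hk, ha] using h.start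
    · simpa [writeFields, h40', hk, ha] using h.mode
    · simpa [writeFields, h40', hk, ha] using h.size
  · rw [hr.size] at hj
    have ht1 := ht.frame hF (by decide) (by decide)
    have h32' : s'.reg 32 = q * n := (hF.reg 32 (by decide)).trans h32
    have hp := ht1.pos ⟨j, hj⟩
    have hn := ht1.pn ⟨j, hj⟩
    dsimp only at hp hn
    have e5 : (writeBody.run s').arr 5
        = Function.update (s'.arr 5) (q * n + j) (t.pos ⟨j, hj⟩) := by
      simp [writeBody, h32', h27, hp]
    have e6 : (writeBody.run s').arr 6
        = Function.update (s'.arr 6) (q * n + j) (D.pn t.pos ⟨j, hj⟩) := by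
      simp [writeBody, h32', h27, hn]
    refine Runs.of_flat rfl (by decide) ⟨fun y hy => ?_, fun k hk y => ?_⟩
    · rw [e5, e6, update_cell _ _ y.2 hj, update_cell _ _ y.2 hj]
      by_cases hc : (y : ℕ) = j
      · rw [show y = ⟨j, hj⟩ from Fin.ext hc]
        simp
      · simp only [hc, and_false, if_false]
        exact h1 y (by omega)
    · rw [e5, e6, update_cell _ _ y.2 hj, update_cell _ _ y.2 hj]
      simp only [hk, false_and, if_false]
      exact h2 k hk y

/-- The worklist in memory is `c`. -/
structure Rep (D : Data n) (c : Config n) (s : State) : Prop where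
  m : s.reg 12 = c.m
  off : s.reg 13 = c.m * n
  ent : ∀ k < c.m, RepEntry D k (c.ent k) s
  unseen : ∀ x, s.arr 9 x = 0 → ∀ j, n + 1 ≤ j → j < c.m → D.key (c.ent j) ≠ x
  seen : ∀ x j, s.arr 9 x = j + 1 → n + 1 ≤ j ∧ j < c.m ∧ D.key (c.ent j) = x

theorem Rep.congr {D : Data n} {c : Config n} {s s' : State} (h : Rep D c s)
    (ha : ∀ a ∈ [5, 6, 9, 10, 11, 12, 13, 14, 15], s'.arr a = s.arr a)
    (h12 : s'.reg 12 = s.reg 12) (h13 : s'.reg 13 = s.reg 13) : Rep D c s' := by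
  refine ⟨h12.trans h.m, h13.trans h.off, fun k hk => (h.ent k hk).congr fun a hx => ha a ?_,
    fun x hx => h.unseen x (by rw [← ha 9 (by simp)]; exact hx),
    fun x j hx => h.seen x j (by rw [← ha 9 (by simp)]; exact hx)⟩
  simp only [List.mem_cons, List.not_mem_nil, or_false] at hx ⊢
  tauto

theorem Rep.frame {D : Data n} {c : Config n} {p : Prog} {s s' : State} (h : Rep D c s)
    (hF : Frame p s s') (h1 : ∀ a ∈ [5, 6, 9, 10, 11, 12, 13, 14, 15], a ∉ p.wa)
    (h2 : 12 ∉ p.wr) (h3 : 13 ∉ p.wr) : Rep D c s' :=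
  h.congr (fun a ha => hF.arr a (h1 a ha)) (hF.reg 12 h2) (hF.reg 13 h3)

/-! #### The start of the worklist -/

def startPos : Prog :=
  .write 7 (.reg 27) (.lit 0) ;;
  .ite (.lt (.lit 0) (.read 3 (.add (.reg 34) (.reg 27)))) (.write 8 (.reg 27) (.lit 1))
    (.write 8 (.reg 27) (.lit 0))

def startBody : Prog :=
  (.set 22 (.sub (.reg 14) (.lit 1)) ;; .set 18 (.reg 22) ;; .set 19 (.sub (.lit 1) (.reg 14)) ;;
    .set 34 (.read 1 (.reg 22))) ;;
  .forTo 27 0 startPos ;;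
  (.write 7 (.reg 22) (.lit 1) ;; .set 40 (.reg 12) ;; .set 32 (.reg 13)) ;;
  writeEntry ;;
  .set 12 (.add (.reg 12) (.lit 1)) ;; .set 13 (.add (.reg 13) (.reg 0))

/-- Fill the worklist with the placements of a single vertex, and set up constants. -/
def startList : Prog :=
  (.set 12 (.lit 0) ;; .set 13 (.lit 0) ;; .set 24 (.lit 1) ;; .set 41 (.lit 1) ;;
    .set 39 (.add (.reg 0) (.lit 1)) ;; .set 37 (.add (.reg 3) (.reg 3)) ;;
    .set 28 (.add (.reg 37) (.lit 3)) ;; .set 21 (.lit 0)) ;;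
  .forTo 14 39 startBody

/-- Truncated subtraction treats all starts alike: `t = 0` yields vertex 0, the root, in mode 1, and
`t ≥ 1` yields vertex `t - 1` in mode 0. -/
theorem startEntry_eq {D : Data n} (hroot : (D.root : ℕ) = 0) {t : ℕ} (ht : t ≤ n) :
    ∃ r : Fin n, (r : ℕ) = t - 1 ∧ D.startEntry t = Entry.init (1 - t) r := by
  unfold Data.startEntry
  split_ifs with h
  · refine ⟨⟨t - 1, by omega⟩, rfl, ?_⟩
    rw [show 1 - t = 0 by omega]
  · have : t = 0 := by omega
    subst this
    exact ⟨D.root, hroot, rfl⟩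

theorem runs_startBody {D : Data n} {s : State} (hE : Env D s) {t : ℕ} (hroot : (D.root : ℕ) = 0)
    (ht : t ≤ n) (h14 : s.reg 14 = t) (h24 : s.reg 24 = 1) (h41 : s.reg 41 = 1)
    (h12 : s.reg 12 = t) (h13 : s.reg 13 = t * n)
    (hent : ∀ k < t, RepEntry D k (D.startEntry k) s) :
    Runs startBody s (n * 38 + 60) (fun s' => s'.reg 12 = t + 1 ∧ s'.reg 13 = (t + 1) * n ∧
      ∀ k < t + 1, RepEntry D k (D.startEntry k) s') := by
  obtain ⟨r, hr, hst⟩ := startEntry_eq hroot ht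
  have hp : ∀ x, (Entry.init (1 - t) r).pos x = if x = r then 1 else 0 := fun x => by
    simp [Entry.init, Pi.single_apply]
  have hrow := hE.rows.row r r.2
  refine Runs.mono (Runs.seq (T₁ := 13) (T₂ := (n * 19 + 5) + (7 + ((n * 19 + 23) + 8)))
    (Q₁ := fun s' => s'.reg 22 = r ∧ s'.reg 18 = r ∧ s'.reg 19 = 1 - t ∧ s'.reg 34 = r * n)
    (Runs.of_flat rfl (by decide) (by simp [h14, ← hr, hrow]))
    fun s₁ hF1 ⟨h22, h18, h19, h34⟩ => ?_) (by omega) fun _ _ h => h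
  have hE1 := hE.frame hF1 (by decide) (by decide)
  refine Runs.seq (Q₁ := fun s' => ∀ y : Fin n, s'.arr 7 y = 0 ∧
    s'.arr 8 y = if 0 < D.e r y then 1 else 0) ?_ fun s₂ hF2 hpos => ?_
  · have := Runs.forTo_const (x := 27) (b := 0) (s := s₁) (p := startPos)
      (fun j s' => ∀ y : Fin n, (y : ℕ) < j → s'.arr 7 y = 0 ∧
        s'.arr 8 y = if 0 < D.e r y then 1 else 0) 12
      (by decide) (by decide) (by decide) (fun i s v h => h) (fun y hy => by omega)
      fun j s' hj hF h27 h1 => ?_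
    · rw [hE1.rows.size] at this
      exact Runs.mono this le_rfl fun s' _ h y => h y y.2
    · rw [hE1.rows.size] at hj
      have hE' := hE1.frame hF (by decide) (by decide)
      have h34' : s'.reg 34 = r * n := (hF.reg 34 (by decide)).trans h34
      have he := hE'.data.e r ⟨j, hj⟩
      dsimp only at he
      have e7 : (startPos.run s').arr 7 = Function.update (s'.arr 7) j 0 := by
        by_cases hc : 0 < D.e r ⟨j, hj⟩ <;> simp [startPos, h27, h34', he, hc]
      have e8 : (startPos.run s').arr 8
          = Function.update (s'.arr 8) j (if 0 < D.e r ⟨j, hj⟩ then 1 else 0) := by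
        by_cases hc : 0 < D.e r ⟨j, hj⟩ <;> simp [startPos, h27, h34', he, hc]
      refine Runs.of_flat rfl (by decide) fun y hy => ?_
      rw [e7, e8, Function.update_apply, Function.update_apply]
      by_cases hc : (y : ℕ) = j
      · rw [show y = ⟨j, hj⟩ from Fin.ext hc]
        simp
      · simp only [hc, if_false]
        exact h1 y (by omega)
  have hE2 := hE1.frame hF2 (by decide) (by decide)
  have h222 : s₂.reg 22 = r := (hF2.reg 22 (by decide)).trans h22
  have hF12 : Frame ((.set 22 (.sub (.reg 14) (.lit 1)) ;; .set 18 (.reg 22) ;;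
      .set 19 (.sub (.lit 1) (.reg 14)) ;; .set 34 (.read 1 (.reg 22))) ;;
      .forTo 27 0 startPos) s s₂ := (hF1.seq_left _).trans (hF2.seq_right _)
  refine Runs.seq (Q₁ := fun s' => (∀ y : Fin n, s'.arr 7 y = if y = r then 1 else 0) ∧
    s'.reg 40 = t ∧ s'.reg 32 = t * n) (Runs.of_flat rfl (by decide) ⟨fun y => ?_, ?_, ?_⟩)
    fun s₃ hF3 ⟨h7, h40, h32⟩ => ?_
  · simp [h222, (hpos y).1, Fin.ext_iff]
  · simpa using (hF12.reg 12 (by decide)).trans h12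
  · simpa using (hF12.reg 13 (by decide)).trans h13
  have hsc : Scratch D (D.startEntry t) s₃ := by
    rw [hst]
    refine ⟨fun y => by rw [hp, h7], fun y => ?_, ?_, ?_, ?_, ?_, ?_⟩
    · rw [pn_init, hF3.arr 8 (by decide), (hpos y).2]
    · exact (hF3.reg 24 (by decide)).trans ((hF12.reg 24 (by decide)).trans h24)
    · exact (hF3.reg 22 (by decide)).trans h222
    · exact (hF3.reg 18 (by decide)).trans ((hF2.reg 18 (by decide)).trans h18)
    · exact (hF3.reg 19 (by decide)).trans ((hF2.reg 19 (by decide)).trans h19)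
    · rw [Entry.size_init]
      exact (hF3.reg 41 (by decide)).trans ((hF12.reg 41 (by decide)).trans h41)
  have hE3 := hE2.frame hF3 (by decide) (by decide)
  refine Runs.seq (runs_writeEntry hE3.rows hsc h40 h32) fun s₄ hF4 ⟨hnew, hold⟩ => ?_
  have h124 : s₄.reg 12 = t := (hF4.reg 12 (by decide)).trans ((hF3.reg 12 (by decide)).trans
    ((hF12.reg 12 (by decide)).trans h12))
  have h134 : s₄.reg 13 = t * n := (hF4.reg 13 (by decide)).trans ((hF3.reg 13 (by decide)).trans
    ((hF12.reg 13 (by decide)).trans h13))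
  have h04 : s₄.reg 0 = n := (hF4.reg 0 (by decide)).trans hE3.rows.size
  refine Runs.of_flat rfl (by decide) ⟨by simp [h124], by simp [h134, h04, add_mul],
    fun k hk => ?_⟩
  refine RepEntry.congr (s := s₄) ?_ fun a _ => rfl
  by_cases hkt : k = t
  · rw [hkt]
    exact hnew
  · refine hold k hkt _ ((hent k (by omega)).congr fun a ha => ?_)
    have h3 : a ∉ [7, 8] := by
      simp only [List.mem_cons, List.not_mem_nil, or_false] at ha ⊢
      omega
    rw [hF3.arr a, hF12.arr a]
    · simpa [Prog.wa, Prog.forTo, startPos] using h3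
    · simp only [List.mem_cons, List.not_mem_nil, or_false, not_or] at h3
      simp [Prog.wa, h3.1]

theorem runs_startList {D : Data n} {s : State} (hE : Env D s) (hroot : (D.root : ℕ) = 0)
    (h9 : ∀ x, s.arr 9 x = 0) :
    Runs startList s ((n + 1) * (n * 38 + 67) + 29) (fun s' => Rep D ⟨n + 1, D.startEntry⟩ s' ∧
      s'.reg 37 = 2 * D.L ∧ s'.reg 28 = 2 * D.L + 3 ∧ s'.reg 21 = 0) := by
  refine Runs.mono (Runs.seq (T₁ := 24) (T₂ := (n + 1) * (n * 38 + 67) + 5)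
    (Q₁ := fun s' => s'.reg 12 = 0 ∧ s'.reg 13 = 0 ∧ s'.reg 24 = 1 ∧ s'.reg 41 = 1 ∧
      s'.reg 39 = n + 1 ∧ s'.reg 37 = 2 * D.L ∧ s'.reg 28 = 2 * D.L + 3 ∧ s'.reg 21 = 0)
    (Runs.of_flat rfl (by decide) (by simp [hE.rows.size, hE.L, two_mul]))
    fun s₁ hF1 ⟨h12, h13, h24, h41, h39, h37, h28, h21⟩ => ?_) (by omega) fun _ _ h => h
  have hE1 := hE.frame hF1 (by decide) (by decide)
  have := Runs.forTo_const (x := 14) (b := 39) (s := s₁) (p := startBody)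
    (fun t s' => s'.reg 12 = t ∧ s'.reg 13 = t * n ∧ ∀ k < t, RepEntry D k (D.startEntry k) s')
    (n * 38 + 60) (by decide) (by decide) (by decide)
    (fun i s v h => ⟨by simpa using h.1, by simpa using h.2.1,
      fun k hk => (h.2.2 k hk).congr fun a _ => rfl⟩)
    ⟨h12, by simpa using h13, by simp⟩ fun t s' ht hF h14 ⟨h1, h2, h3⟩ => ?_
  · rw [h39] at this
    refine Runs.mono this le_rfl fun s' hF h => ⟨⟨h.1, h.2.1, h.2.2, fun x _ j h1 h2 => ?_,
      fun x j hx => ?_⟩, (hF.reg 37 (by decide)).trans h37, (hF.reg 28 (by decide)).trans h28,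
      (hF.reg 21 (by decide)).trans h21⟩
    · dsimp only at h2
      omega
    · rw [hF.arr 9 (by decide), hF1.arr 9 (by decide), h9] at hx
      omega
  · rw [h39] at ht
    exact runs_startBody (hE1.frame hF (by decide) (by decide)) hroot (by omega) h14
      ((hF.reg 24 (by decide)).trans h24) ((hF.reg 41 (by decide)).trans h41) h1 h2 h3

end CycleInstance

namespace CycleInstance

open RealRAM CyclePlacement

attribute [local simp] NExpr.val RExpr.val Test.holds Prog.run Function.update_apply

variable {n : ℕ}

/-! #### Testing and inserting a candidate -/

/-- Registers while entry number `k`, which is `t`, is being extended. -/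
structure Cur (D : Data n) (k : ℕ) (t : Entry n) (s : State) : Prop where
  idx : s.reg 14 = k
  off : s.reg 15 = k * n
  p : s.reg 16 = t.p
  last : s.reg 17 = t.last
  start : s.reg 18 = t.start
  mode : s.reg 19 = t.mode
  row : s.reg 35 = t.last * n
  size : s.reg 41 = t.size + 1
  two : s.reg 37 = 2 * D.L
  base : s.reg 28 = 2 * D.L + 3

theorem Cur.congr {D : Data n} {k : ℕ} {t : Entry n} {s s' : State} (h : Cur D k t s)
    (hF : ∀ x ∈ [14, 15, 16, 17, 18, 19, 35, 41, 37, 28], s'.reg x = s.reg x) : Cur D k t s' :=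
  ⟨(hF 14 (by simp)).trans h.idx, (hF 15 (by simp)).trans h.off, (hF 16 (by simp)).trans h.p,
    (hF 17 (by simp)).trans h.last, (hF 18 (by simp)).trans h.start, (hF 19 (by simp)).trans h.mode,
    (hF 35 (by simp)).trans h.row, (hF 41 (by simp)).trans h.size, (hF 37 (by simp)).trans h.two,
    (hF 28 (by simp)).trans h.base⟩

theorem Cur.frame {D : Data n} {k : ℕ} {t : Entry n} {p : Prog} {s s' : State} (h : Cur D k t s)
    (hF : Frame p s s') (h1 : ∀ x ∈ [14, 15, 16, 17, 18, 19, 35, 41, 37, 28], x ∉ p.wr) :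
    Cur D k t s' :=
  h.congr fun x hx => hF.reg x (h1 x hx)

def buildBody : Prog :=
  .write 7 (.reg 27) (.read 5 (.add (.reg 15) (.reg 27))) ;;
  .ite (.lt (.lit 0) (.read 3 (.add (.reg 34) (.reg 27))))
    (.write 8 (.reg 27) (.add (.read 6 (.add (.reg 15) (.reg 27))) (.lit 1)))
    (.write 8 (.reg 27) (.read 6 (.add (.reg 15) (.reg 27))))

/-- Construct the extension of the current entry by vertex `22` at position `24`. -/
def build : Prog :=
  .set 34 (.read 1 (.reg 22)) ;; .forTo 27 0 buildBody ;; .write 7 (.reg 22) (.reg 24)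

theorem runs_build {D : Data n} {s : State} (hE : Env D s) {k : ℕ} {t : Entry n}
    (hk : RepEntry D k t s) (hc : Cur D k t s) {u : Fin n} {g : ℕ} (hu : t.pos u = 0) (hg : 1 ≤ g)
    (h22 : s.reg 22 = u) (h24 : s.reg 24 = t.p + g) :
    Runs build s (n * 27 + 11) (fun s' => Scratch D (t.ext u g) s' ∧ s'.reg 34 = u * n) := by
  refine Runs.mono (Runs.seq (T₁ := 3) (T₂ := (n * 27 + 5) + 3) (Q₁ := fun s' => s'.reg 34 = u * n)
    (Runs.of_flat rfl (by decide) (by simp [h22, hE.rows.row u u.2])) fun s₁ hF1 h34 => ?_)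
    (by omega) fun _ _ h => h
  have hE1 := hE.frame hF1 (by decide) (by decide)
  have hc1 := hc.frame hF1 (by decide)
  refine Runs.seq (Q₁ := fun s' => ∀ y : Fin n, s'.arr 7 y = t.pos y ∧
    s'.arr 8 y = D.pn (t.ext u g).pos y) ?_ fun s₂ hF2 h2 => ?_
  · have := Runs.forTo_const (x := 27) (b := 0) (s := s₁) (p := buildBody)
      (fun j s' => ∀ y : Fin n, (y : ℕ) < j → s'.arr 7 y = t.pos y ∧
        s'.arr 8 y = D.pn (t.ext u g).pos y) 20
      (by decide) (by decide) (by decide) (fun i s v h => h) (fun y hy => by omega)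
      fun j s' hj hF h27 h1 => ?_
    · rw [hE1.rows.size] at this
      exact Runs.mono this le_rfl fun s' _ h y => h y y.2
    · rw [hE1.rows.size] at hj
      have hE' := hE1.frame hF (by decide) (by decide)
      have h34' : s'.reg 34 = u * n := (hF.reg 34 (by decide)).trans h34
      have h15 : s'.reg 15 = k * n := (hc1.frame hF (by decide)).off
      have he := hE'.data.e u ⟨j, hj⟩
      have hp := hk.pos ⟨j, hj⟩
      have hn := hk.pn ⟨j, hj⟩
      have e5 : s'.arr 5 = s.arr 5 := (hF.arr 5 (by decide)).trans (hF1.arr 5 (by decide))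
      have e6 : s'.arr 6 = s.arr 6 := (hF.arr 6 (by decide)).trans (hF1.arr 6 (by decide))
      rw [← e5] at hp
      rw [← e6] at hn
      dsimp only at he hp hn
      have e7 : (buildBody.run s').arr 7 = Function.update (s'.arr 7) j (t.pos ⟨j, hj⟩) := by
        by_cases hc : 0 < D.e u ⟨j, hj⟩ <;> simp [buildBody, h27, h34', h15, he, hp, hc]
      have e8 : (buildBody.run s').arr 8
          = Function.update (s'.arr 8) j (D.pn (t.ext u g).pos ⟨j, hj⟩) := by
        rw [pn_ext hu hg]
        by_cases hc : 0 < D.e u ⟨j, hj⟩ <;> simp [buildBody, h27, h34', h15, he, hn, hc]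
      refine Runs.of_flat rfl (by decide) fun y hy => ?_
      rw [e7, e8, Function.update_apply, Function.update_apply]
      by_cases hc : (y : ℕ) = j
      · rw [show y = ⟨j, hj⟩ from Fin.ext hc]
        simp
      · simp only [hc, if_false]
        exact h1 y (by omega)
  · have h222 : s₂.reg 22 = u := (hF2.reg 22 (by decide)).trans ((hF1.reg 22 (by decide)).trans h22)
    have h242 : s₂.reg 24 = t.p + g :=
      (hF2.reg 24 (by decide)).trans ((hF1.reg 24 (by decide)).trans h24)
    have hc2 := hc1.frame hF2 (by decide)
    refine Runs.of_flat rfl (by decide) ⟨⟨fun y => ?_, fun y => ?_, h242, h222, hc2.start,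
      hc2.mode, ?_⟩, (hF2.reg 34 (by decide)).trans h34⟩
    · by_cases hy : y = u
      · subst hy
        rw [Entry.ext_pos_self]
        simp [h222, h242]
      · rw [Entry.ext_pos_ne _ _ hy]
        have : (y : ℕ) ≠ u := fun h => hy (Fin.ext h)
        simp [h222, this, (h2 y).1]
    · simpa using (h2 y).2
    · rw [Entry.size_ext hu hg]
      exact hc2.size

/-- Vertex `27` has free neighbours and is no longer near the end of the placement. -/
def farTest : Test :=
  .conj (.lt (.read 8 (.reg 27)) (.read 4 (.reg 27)))
    (.conj (.neg (.lt (.reg 24) (.add (.read 7 (.reg 27)) (.reg 3))))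
      (.neg (.conj (.lt (.lit 0) (.reg 19)) (.lt (.read 7 (.reg 27)) (.add (.reg 3) (.lit 1))))))

/-- Vertex `27` is a neighbour of the new vertex that is too far away. -/
def edgeTest : Test :=
  .conj (.lt (.lit 0) (.read 3 (.add (.reg 34) (.reg 27))))
    (.conj (.neg (.lt (.sub (.reg 24) (.read 7 (.reg 27))) (.read 3 (.add (.reg 34) (.reg 27)))))
      (.neg (.conj (.lt (.lit 0) (.reg 19)) (.lt (.sub (.reg 1) (.sub (.reg 24)
        (.read 7 (.reg 27)))) (.read 3 (.add (.reg 34) (.reg 27)))))))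

/-- The test at vertex `27`. -/
def checkBody : Prog :=
  .ite (.lt (.lit 0) (.read 7 (.reg 27)))
    (.ite (.neg (.conj (.neg farTest) (.neg edgeTest))) (.set 25 (.lit 0)) .skip)
    (.ite (.lt (.lit 0) (.read 8 (.reg 27))) (.set 26 (.add (.reg 26) (.lit 1))) .skip)

def check : Prog :=
  (.set 25 (.lit 1) ;; .set 26 (.lit 0)) ;; .forTo 27 0 checkBody ;;
  .ite (.lt (.reg 37) (.reg 26)) (.set 25 (.lit 0)) .skip

/-- The condition tested at the vertex `y` when `u` has been placed last. -/
def OkAt (D : Data n) (t : Entry n) (u y : Fin n) : Prop :=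
  t.pos y ≠ 0 → (D.pn t.pos y < D.deg y → D.Near t.mode t.p (t.pos y)) ∧
    (0 < D.e u y → D.EdgeOk t.mode (t.pos y) t.p (D.e u y))

theorem run_checkBody {D : Data n} {s : State} (hE : Env D s) {t : Entry n} (ht : Scratch D t s)
    (hm : t.mode = 0 ∨ t.mode = 1) {u y : Fin n} (h34 : s.reg 34 = u * n) (h27 : s.reg 27 = y) :
    (OkAt D t u y ∧ (checkBody.run s).reg 25 = s.reg 25 ∨
      ¬ OkAt D t u y ∧ (checkBody.run s).reg 25 = 0) ∧
    (checkBody.run s).reg 26 = s.reg 26 + if y ∈ D.bdry t.pos then 1 else 0 := by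
  have e7 := ht.pos y
  have e8 := ht.pn y
  have e4 := hE.deg y
  have e3 := hE.data.e u y
  have eL := hE.L
  have eN := hE.N
  have ep := ht.p
  have em := ht.mode
  have hmode : 0 < t.mode ↔ t.mode = 1 := by omega
  by_cases h0 : t.pos y = 0
  · have hb : y ∈ D.bdry t.pos ↔ 0 < D.pn t.pos y := by
      rw [pn_pos]
      simp [Data.bdry, h0]
    have hok : OkAt D t u y := fun h => absurd h0 h
    refine ⟨Or.inl ⟨hok, ?_⟩, ?_⟩
    · by_cases hp : 0 < D.pn t.pos y <;> simp [checkBody, h27, e7, e8, h0, hp]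
    · by_cases hp : 0 < D.pn t.pos y
      · simp [checkBody, h27, e7, e8, h0, hp, hb]
      · have : D.pn t.pos y = 0 := by omega
        simp [checkBody, h27, e7, e8, h0, hb, this]
  · have hb : y ∉ D.bdry t.pos := by simp [Data.bdry, h0]
    have hpos : 0 < t.pos y := by omega
    have hA : farTest.holds s ↔ ¬ (D.pn t.pos y < D.deg y → D.Near t.mode t.p (t.pos y)) := by
      unfold Data.Near farTest
      simp only [Test.holds, NExpr.val, h27, e7, e8, e4, eL, ep, em, hmode]
      by_cases h : D.pn t.pos y < D.deg y
      · simp only [h, true_and, true_imp_iff, Nat.lt_add_one_iff]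
        tauto
      · simp [h]
    have hB : edgeTest.holds s ↔
        ¬ (0 < D.e u y → D.EdgeOk t.mode (t.pos y) t.p (D.e u y)) := by
      unfold Data.EdgeOk edgeTest
      simp only [Test.holds, NExpr.val, h27, h34, e7, e3, eN, ep, em, hmode]
      by_cases h : 0 < D.e u y
      · simp only [h, true_and, true_imp_iff]
        tauto
      · simp [h]
    have hC : (Test.neg (.conj (.neg farTest) (.neg edgeTest))).holds s ↔ ¬ OkAt D t u y := by
      simp only [Test.holds, hA, hB, not_not, OkAt, ne_eq, h0, not_false_eq_true, true_imp_iff]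
    by_cases hok : OkAt D t u y
    · simp [checkBody, -Test.holds, hC, hok, hb, Test.holds.eq_1, h27, e7, hpos]
    · simp [checkBody, -Test.holds, hC, hok, hb, Test.holds.eq_1, h27, e7, hpos]

theorem runs_check {D : Data n} {s : State} (hE : Env D s) {t : Entry n} (ht : Scratch D t s)
    (hm : t.mode = 0 ∨ t.mode = 1) {u : Fin n} (h34 : s.reg 34 = u * n)
    (h37 : s.reg 37 = 2 * D.L) :
    Runs check s (n * 80 + 20) (fun s' =>
      s'.reg 25 = 1 ∧ ((∀ y, OkAt D t u y) ∧ (D.bdry t.pos).card ≤ 2 * D.L) ∨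
      s'.reg 25 = 0 ∧ ¬ ((∀ y, OkAt D t u y) ∧ (D.bdry t.pos).card ≤ 2 * D.L)) := by
  refine Runs.mono (Runs.seq (T₁ := 4) (T₂ := (n * 80 + 5) + 5)
    (Q₁ := fun s' => s'.reg 25 = 1 ∧ s'.reg 26 = 0)
    (Runs.of_flat rfl (by decide) (by simp)) fun s₁ hF1 ⟨h25, h26⟩ => ?_)
    (by omega) fun _ _ h => h
  have hE1 := hE.frame hF1 (by decide) (by decide)
  have ht1 := ht.frame hF1 (by decide) (by decide)
  have h341 : s₁.reg 34 = u * n := (hF1.reg 34 (by decide)).trans h34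
  refine Runs.seq (Q₁ := fun s' => (s'.reg 25 = 1 ∧ (∀ y, OkAt D t u y) ∨
    s'.reg 25 = 0 ∧ ∃ y, ¬ OkAt D t u y) ∧ s'.reg 26 = (D.bdry t.pos).card) ?_
    fun s₂ hF2 ⟨h2, h3⟩ => ?_
  · have := Runs.forTo_const (x := 27) (b := 0) (s := s₁) (p := checkBody)
      (fun j s' => (s'.reg 25 = 1 ∧ (∀ y : Fin n, (y : ℕ) < j → OkAt D t u y) ∨
        s'.reg 25 = 0 ∧ ∃ y, ¬ OkAt D t u y) ∧ s'.reg 26 = countBelow (· ∈ D.bdry t.pos) j) 73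
      (by decide) (by decide) (by decide) (fun i s v h => by simpa using h)
      ⟨Or.inl ⟨h25, by simp⟩, by rw [h26, countBelow_zero]⟩
      fun j s' hj hF h27 ⟨h4, h5⟩ => ?_
    · rw [hE1.rows.size] at this
      refine Runs.mono this le_rfl fun s' _ h => ⟨?_, ?_⟩
      · rcases h.1 with h' | h'
        · exact Or.inl ⟨h'.1, fun y => h'.2 y y.2⟩
        · exact Or.inr h'
      · rw [h.2, countBelow_last]
        congr 1
        ext y
        simp
    · rw [hE1.rows.size] at hj
      have h34' : s'.reg 34 = u * n := (hF.reg 34 (by decide)).trans h341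
      obtain ⟨h6, h7⟩ := run_checkBody (u := u) (y := ⟨j, hj⟩)
        (hE1.frame hF (by decide) (by decide))
        (ht1.frame hF (by decide) (by decide)) hm h34' h27
      refine Runs.of_flat rfl (by decide) ⟨?_, ?_⟩
      · rcases h6 with ⟨h6, h8⟩ | ⟨h6, h8⟩
        · rw [h8]
          rcases h4 with h4 | h4
          · refine Or.inl ⟨h4.1, fun y hy => ?_⟩
            by_cases hc : (y : ℕ) = j
            · rwa [show y = ⟨j, hj⟩ from Fin.ext hc]
            · exact h4.2 y (by omega)
          · exact Or.inr h4
        · exact Or.inr ⟨h8, _, h6⟩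
      · rw [h7, h5, countBelow_succ _ hj]
  · have h372 : s₂.reg 37 = 2 * D.L :=
      (hF2.reg 37 (by decide)).trans ((hF1.reg 37 (by decide)).trans h37)
    refine Runs.of_flat rfl (by decide) ?_
    by_cases hlt : 2 * D.L < (D.bdry t.pos).card
    · right
      simp only [Prog.run, Test.holds, NExpr.val, h372, h3, hlt, if_true, Function.update_self]
      exact ⟨trivial, fun h => absurd h.2 (not_le.2 hlt)⟩
    · simp only [Prog.run, Test.holds, NExpr.val, h372, h3, hlt, if_false]
      rcases h2 with h2 | ⟨h2, y, hy⟩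
      · exact Or.inl ⟨h2.1, h2.2, not_lt.1 hlt⟩
      · exact Or.inr ⟨h2, fun h => hy (h.1 y)⟩

/-- The machine tests the finished extension, in which `u` itself is placed. Since `u` is not its
own neighbour, its edge test is vacuous and the conditions agree. -/
theorem ok_iff_succ {D : Data n} (hD : D.Proper) {t : Entry n} {u : Fin n} {g : ℕ}
    (hu : t.pos u = 0) (h1 : 1 ≤ g) (hg : g ≤ D.L) (hdc : D.dc t.last u ≤ g) (hN : t.p + g ≤ D.N) :
    ((∀ y, OkAt D (t.ext u g) u y) ∧ (D.bdry (t.ext u g).pos).card ≤ 2 * D.L) ↔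
      D.Succ t u g := by
  constructor
  · rintro ⟨h2, h3⟩
    refine ⟨hu, h1, hg, hdc, hN, fun y hy he => ?_, fun y hy hz => ?_, h3⟩
    · have hyu : y ≠ u := fun h => hy (h ▸ hu)
      have h4 := h2 y
      unfold OkAt at h4
      rw [Entry.ext_pos_ne _ _ hyu] at h4
      exact (h4 hy).2 he
    · exact (h2 y hy).1 (pn_lt_deg.2 hz)
  · intro h
    refine ⟨fun y hy => ⟨fun hz => h.checked.near y hy (pn_lt_deg.1 hz), fun he => ?_⟩,
      h.checked.card⟩
    have hyu : y ≠ u := by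
      rintro rfl
      rw [hD.e_irrefl] at he
      omega
    rw [Entry.ext_pos_ne _ _ hyu] at hy ⊢
    exact h.edge y hy he

def digit : Prog :=
  .ite (.lt (.read 7 (.reg 27)) (.lit 1)) (.set 36 (.lit 0))
    (.ite (.conj (.lt (.lit 0) (.reg 19)) (.lt (.read 7 (.reg 27)) (.add (.reg 3) (.lit 1))))
      (.set 36 (.add (.lit 1) (.read 7 (.reg 27))))
      (.ite (.lt (.reg 24) (.add (.read 7 (.reg 27)) (.reg 3)))
        (.set 36 (.add (.add (.reg 3) (.lit 2)) (.sub (.reg 24) (.read 7 (.reg 27)))))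
        (.set 36 (.lit 1))))

/-- One Horner step. Multiplication by the base is a loop of additions, which brings the factor `L`
into the cost of a candidate. -/
def keyBody : Prog :=
  (digit ;; .set 30 (.lit 0)) ;; .forTo 31 28 (.set 30 (.add (.reg 30) (.reg 29))) ;;
  .set 29 (.add (.reg 30) (.reg 36))

def keyLoop : Prog :=
  .ite (.lt (.lit 0) (.reg 19)) (.set 29 (.add (.add (.reg 24) (.reg 24)) (.lit 1)))
    (.set 29 (.add (.reg 18) (.reg 18))) ;;
  .forTo 27 0 keyBody

theorem runs_keyBody {D : Data n} {s : State} (hE : Env D s) {t : Entry n} (ht : Scratch D t s)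
    (hm : t.mode = 0 ∨ t.mode = 1) (h28 : s.reg 28 = 2 * D.L + 3) {y : Fin n}
    (h27 : s.reg 27 = y) : Runs keyBody s ((2 * D.L + 3) * 11 + 40) (fun s' =>
      s'.reg 29 = s.reg 29 * (2 * D.L + 3) + D.dig t.mode t.p (t.pos y)) := by
  have hmode : 0 < t.mode ↔ t.mode = 1 := by omega
  refine Runs.mono (Runs.seq (T₁ := 31) (T₂ := ((2 * D.L + 3) * 11 + 5) + 4)
    (Q₁ := fun s' => s'.reg 36 = D.dig t.mode t.p (t.pos y) ∧ s'.reg 30 = 0)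
    (Runs.of_flat rfl (by decide) ?_) fun s₁ hF1 ⟨h36, h30⟩ => ?_)
    (by omega) fun _ _ h => h
  · have e7 := ht.pos y
    have eL := hE.L
    have ep := ht.p
    have em := ht.mode
    unfold Data.dig
    simp only [digit, Prog.run, Test.holds, NExpr.val, h27, e7, eL, ep, em, hmode,
      Nat.lt_add_one_iff]
    split_ifs <;> first | omega | simp
  have h281 : s₁.reg 28 = 2 * D.L + 3 := (hF1.reg 28 (by decide)).trans h28
  have h291 : s₁.reg 29 = s.reg 29 := hF1.reg 29 (by decide)
  refine Runs.seq (Q₁ := fun s' => s'.reg 30 = (2 * D.L + 3) * s.reg 29) ?_ fun s₂ hF2 h2 => ?_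
  · have := Runs.forTo_const (x := 31) (b := 28) (s := s₁)
      (p := .set 30 (.add (.reg 30) (.reg 29)))
      (fun j s' => s'.reg 30 = j * s.reg 29) 4
      (by decide) (by decide) (by decide) (fun i s v h => by simpa using h) (by simpa using h30)
      fun j s' hj hF h27 h1 => ?_
    · rw [h281] at this
      exact this
    · have h29' : s'.reg 29 = s.reg 29 := (hF.reg 29 (by decide)).trans h291
      exact Runs.of_flat rfl (by decide) (by simp [h1, h29', add_mul])
  · have h362 := (hF2.reg 36 (by decide)).trans h36
    exact Runs.of_flat rfl (by decide) (by simp [h2, h362, mul_comm])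

theorem runs_keyLoop {D : Data n} {s : State} (hE : Env D s) {t : Entry n} (ht : Scratch D t s)
    (hm : t.mode = 0 ∨ t.mode = 1) (h28 : s.reg 28 = 2 * D.L + 3) :
    Runs keyLoop s (n * ((2 * D.L + 3) * 11 + 47) + 15) (fun s' => s'.reg 29 = D.key t) := by
  have hmode : 0 < t.mode ↔ t.mode = 1 := by omega
  refine Runs.mono (Runs.seq (T₁ := 10) (T₂ := n * ((2 * D.L + 3) * 11 + 47) + 5)
    (Q₁ := fun s' => s'.reg 29 = if t.mode = 1 then 2 * t.p + 1 else 2 * t.start)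
    (Runs.of_flat rfl (by decide) ?_) fun s₁ hF1 h29 => ?_) (by omega) fun _ _ h => h
  · have ep := ht.p
    have em := ht.mode
    have es := ht.start
    simp only [Prog.run, Test.holds, NExpr.val, ep, em, es, hmode]
    split_ifs <;> simp [two_mul]
  have hE1 := hE.frame hF1 (by decide) (by decide)
  have ht1 := ht.frame hF1 (by decide) (by decide)
  have h281 : s₁.reg 28 = 2 * D.L + 3 := (hF1.reg 28 (by decide)).trans h28
  have := Runs.forTo_const (x := 27) (b := 0) (s := s₁) (p := keyBody)
    (fun j s' => s'.reg 29 = horner (2 * D.L + 3)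
      (if t.mode = 1 then 2 * t.p + 1 else 2 * t.start)
      (CyclePlacement.toNat fun y => D.dig t.mode t.p (t.pos y)) j) ((2 * D.L + 3) * 11 + 40)
    (by decide) (by decide) (by decide) (fun i s v h => by simpa using h) h29
    fun j s' hj hF h27 h1 => ?_
  · rw [hE1.rows.size] at this
    exact this
  · rw [hE1.rows.size] at hj
    refine Runs.mono (runs_keyBody (y := ⟨j, hj⟩) (hE1.frame hF (by decide) (by decide))
      (ht1.frame hF (by decide) (by decide)) hm ((hF.reg 28 (by decide)).trans h281) h27) le_rfl ?_
    rintro s₂ - h2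
    rw [h2, h1]
    simp [horner, CyclePlacement.toNat, hj]

def insertNew : Prog :=
  (.set 40 (.reg 12) ;; .set 32 (.reg 13)) ;; writeEntry ;;
  .write 9 (.reg 29) (.add (.reg 12) (.lit 1)) ;; .set 12 (.add (.reg 12) (.lit 1)) ;;
  .set 13 (.add (.reg 13) (.reg 0))

def insertUpd : Prog :=
  (.set 40 (.sub (.reg 33) (.lit 1)) ;; .set 32 (.read 10 (.reg 40))) ;; writeEntry

/-- Insert the entry under construction, with key `29`, into the worklist. -/
def insert : Prog :=
  .set 33 (.read 9 (.reg 29)) ;;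
  .ite (.lt (.reg 33) (.lit 1)) insertNew
    (.ite (.lt (.reg 24) (.read 11 (.sub (.reg 33) (.lit 1)))) insertUpd .skip)

/-- Array `9` is addressed by keys and holds an index plus one, so 0 marks a new key. Keys of good
entries agree exactly when the entries are equivalent; replacing an entry keeps its key and leaves
the table intact. -/
theorem runs_insert {D : Data n} {s : State} (hE : Env D s) {c : Config n} (hc : Rep D c s)
    {t : Entry n} (ht : Scratch D t s) (h29 : s.reg 29 = D.key t) (hm : n + 1 ≤ c.m)
    (hg : ∀ j < c.m, D.Good (c.ent j)) (hgt : D.Good t) :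
    Runs insert s (n * 19 + 60) (fun s' => ∃ c', Rep D c' s' ∧ D.Ins c t c') := by
  refine Runs.mono (Runs.seq (T₁ := 3) (T₂ := 4 + (10 + (n * 19 + 43)))
    (Q₁ := fun s' => s'.reg 33 = s.arr 9 (D.key t))
    (Runs.of_flat rfl (by decide) (by simp [h29])) fun s₁ hF1 h33 => ?_) (by omega) fun _ _ h => h
  have hE1 := hE.frame hF1 (by decide) (by decide)
  have ht1 := ht.frame hF1 (by decide) (by decide)
  have hc1 := hc.frame hF1 (by decide) (by decide) (by decide)
  have h291 : s₁.reg 29 = D.key t := (hF1.reg 29 (by decide)).trans h29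
  have h91 : s₁.arr 9 = s.arr 9 := hF1.arr 9 (by decide)
  refine Runs.mono (Runs.ite (T := 10 + (n * 19 + 43)) (fun hb => ?_) fun hb => ?_)
    (by simp [Test.cost, NExpr.cost]) fun _ _ h => h
  · simp only [Test.holds, NExpr.val, h33, Nat.lt_one_iff] at hb
    have hnot : ∀ j, n + 1 ≤ j → j < c.m → ¬ D.Same (c.ent j) t := fun j h1 h2 h3 =>
      hc.unseen _ hb j h1 h2 ((Data.key_eq_iff (hg j h2) hgt).2 h3)
    refine Runs.mono (Runs.seq (T₁ := 4) (T₂ := (n * 19 + 23) + 14)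
      (Q₁ := fun s' => s'.reg 40 = c.m ∧ s'.reg 32 = c.m * n)
      (Runs.of_flat rfl (by decide) (by simp [hc1.m, hc1.off])) fun s₂ hF2 ⟨h40, h32⟩ => ?_)
      (by omega) fun _ _ h => h
    have hE2 := hE1.frame hF2 (by decide) (by decide)
    have hc2 := hc1.frame hF2 (by decide) (by decide) (by decide)
    refine Runs.seq (runs_writeEntry hE2.rows (ht1.frame hF2 (by decide) (by decide)) h40 h32)
      fun s₃ hF3 ⟨hnew, hold⟩ => ?_
    have h123 : s₃.reg 12 = c.m := (hF3.reg 12 (by decide)).trans hc2.m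
    have h133 : s₃.reg 13 = c.m * n := (hF3.reg 13 (by decide)).trans hc2.off
    have h03 : s₃.reg 0 = n := (hF3.reg 0 (by decide)).trans hE2.rows.size
    have h293 : s₃.reg 29 = D.key t :=
      (hF3.reg 29 (by decide)).trans ((hF2.reg 29 (by decide)).trans h291)
    have h93 : s₃.arr 9 = s.arr 9 :=
      (hF3.arr 9 (by decide)).trans ((hF2.arr 9 (by decide)).trans h91)
    have e9 : ((Prog.write 9 (.reg 29) (.add (.reg 12) (.lit 1)) ;;
        .set 12 (.add (.reg 12) (.lit 1)) ;; .set 13 (.add (.reg 13) (.reg 0))).run s₃).arr 9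
        = Function.update (s.arr 9) (D.key t) (c.m + 1) := by
      simp [h293, h123, h93]
    refine Runs.of_flat rfl (by decide) ⟨_, ⟨?_, ?_, fun k hk => ?_, fun x hx j h1 h2 => ?_,
      fun x j hx => ?_⟩, .new hnot⟩
    · simp [h123]
    · simp [h133, h03, add_mul]
    · refine RepEntry.congr (s := s₃) ?_ fun a ha => ?_
      · dsimp only at hk ⊢
        by_cases hkm : k = c.m
        · rw [hkm, Function.update_self]
          exact hnew
        · rw [Function.update_of_ne hkm]
          exact hold k hkm _ (hc2.ent k (by omega))
      · have : a ≠ 9 := by rintro rfl; simp at ha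
        simp [this]
    · rw [e9, Function.update_apply] at hx
      dsimp only at h2 ⊢
      split_ifs at hx with hxk
      by_cases hj : j = c.m
      · rw [hj, Function.update_self]
        exact fun h => hxk h.symm
      · rw [Function.update_of_ne hj]
        exact hc.unseen x hx j h1 (by omega)
    · rw [e9, Function.update_apply] at hx
      dsimp only
      split_ifs at hx with hxk
      · obtain rfl : j = c.m := by omega
        rw [Function.update_self]
        exact ⟨hm, by omega, hxk.symm⟩
      · obtain ⟨h1, h2, h3⟩ := hc.seen x j hx
        rw [Function.update_of_ne (by omega)]
        exact ⟨h1, by omega, h3⟩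
  · simp only [Test.holds, NExpr.val, h33, Nat.lt_one_iff] at hb
    obtain ⟨j, hj⟩ := Nat.exists_eq_succ_of_ne_zero hb
    obtain ⟨h1, h2, h3⟩ := hc.seen _ j hj
    have hsame := (Data.key_eq_iff (hg j h2) hgt).1 h3
    have h33' : s₁.reg 33 = j + 1 := h33.trans hj
    have hent := hc1.ent j h2
    refine Runs.mono (Runs.ite (T := n * 19 + 33) (fun hb' => ?_) fun hb' => ?_)
      (by simp [Test.cost, NExpr.cost]; omega) fun _ _ h => h
    · simp only [Test.holds, NExpr.val, h33', Nat.add_sub_cancel, hent.p, ht1.p] at hb'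
      refine Runs.mono (Runs.seq (T₁ := 7)
        (Q₁ := fun s' => s'.reg 40 = j ∧ s'.reg 32 = j * n)
        (Q := fun s' => ∃ c', Rep D c' s' ∧ D.Ins c t c')
        (Runs.of_flat rfl (by decide) (by simp [h33', hent.off])) fun s₂ hF2 ⟨h40, h32⟩ =>
          Runs.mono (runs_writeEntry (hE1.frame hF2 (by decide) (by decide)).rows
          (ht1.frame hF2 (by decide) (by decide)) h40 h32) le_rfl fun s₃ hF3 ⟨hnew, hold⟩ => ?_)
        (by omega) fun _ _ h => h
      have hc2 := hc1.frame hF2 (by decide) (by decide) (by decide)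
      have h93 : s₃.arr 9 = s.arr 9 :=
        (hF3.arr 9 (by decide)).trans ((hF2.arr 9 (by decide)).trans h91)
      have hkey : ∀ i < c.m, D.key (Function.update c.ent j t i) = D.key (c.ent i) := by
        intro i hi
        by_cases hij : i = j
        · rw [hij, Function.update_self, h3]
        · rw [Function.update_of_ne hij]
      refine ⟨⟨c.m, Function.update c.ent j t⟩, ⟨(hF3.reg 12 (by decide)).trans hc2.m,
        (hF3.reg 13 (by decide)).trans hc2.off,
        fun k hk => ?_, fun x hx i h4 h5 => ?_, fun x i hx => ?_⟩, .upd j h1 h2 hsame hb'⟩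
      · dsimp only
        by_cases hkj : k = j
        · rw [hkj, Function.update_self]
          exact hnew
        · rw [Function.update_of_ne hkj]
          exact hold k hkj _ (hc2.ent k hk)
      · rw [h93] at hx
        dsimp only
        rw [hkey i h5]
        exact hc.unseen x hx i h4 h5
      · rw [h93] at hx
        obtain ⟨h4, h5, h6⟩ := hc.seen x i hx
        exact ⟨h4, h5, (hkey i h5).trans h6⟩
    · simp only [Test.holds, NExpr.val, h33', Nat.add_sub_cancel, hent.p, ht1.p, not_lt] at hb'
      exact Runs.mono (Runs.of_flat (T := 1) rfl (by decide) ⟨c, hc1, .old j h1 h2 hsame hb'⟩)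
        (by omega) fun _ _ h => h

/-- Test the extension of the current entry by vertex `22` at position `24`, and insert it. -/
def tryCandidate : Prog :=
  build ;; check ;; keyLoop ;; .ite (.lt (.lit 0) (.reg 25)) insert .skip

theorem runs_tryCandidate {D : Data n} (hD : D.Proper) {s : State} (hE : Env D s) {c : Config n}
    (hc : Rep D c s) (hm : n + 1 ≤ c.m) (hg : ∀ j < c.m, D.Good (c.ent j)) {k : ℕ} (hk : k < c.m)
    (hcur : Cur D k (c.ent k) s) {u : Fin n} {g : ℕ} (h22 : s.reg 22 = u)
    (h24 : s.reg 24 = (c.ent k).p + g) (hu : (c.ent k).pos u = 0) (h1 : 1 ≤ g) (hgL : g ≤ D.L)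
    (hdc : D.dc (c.ent k).last u ≤ g) (hN : (c.ent k).p + g ≤ D.N) :
    Runs tryCandidate s (n * (22 * D.L + 250) + 120) (fun s' => ∃ c', Rep D c' s' ∧
      (D.Succ (c.ent k) u g ∧ D.Ins c ((c.ent k).ext u g) c' ∨
        ¬ D.Succ (c.ent k) u g ∧ c' = c)) := by
  have hmode : ((c.ent k).ext u g).mode = 0 ∨ ((c.ent k).ext u g).mode = 1 := by
    rcases (hg k hk).mode with h | h
    · exact Or.inl h
    · exact Or.inr h.1
  have e : n * (22 * D.L + 250) = n * 27 + (n * 80 + (n * ((2 * D.L + 3) * 11 + 47) + n * 63)) := by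
    ring
  refine Runs.mono (Runs.seq (T₂ := (n * 80 + 20) + ((n * ((2 * D.L + 3) * 11 + 47) + 15) +
    (3 + (n * 19 + 60)))) (runs_build hE (hc.ent k hk) hcur hu h1 h22 h24)
    fun s₁ hF1 ⟨ht1, h34⟩ => ?_) (by omega) fun _ _ h => h
  have hE1 := hE.frame hF1 (by decide) (by decide)
  have hc1 := hc.frame hF1 (by decide) (by decide) (by decide)
  have hcur1 := hcur.frame hF1 (by decide)
  refine Runs.seq (runs_check hE1 ht1 hmode h34 hcur1.two) fun s₂ hF2 h25 => ?_
  rw [ok_iff_succ hD hu h1 hgL hdc hN] at h25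
  have hE2 := hE1.frame hF2 (by decide) (by decide)
  have hc2 := hc1.frame hF2 (by decide) (by decide) (by decide)
  have hcur2 := hcur1.frame hF2 (by decide)
  have ht2 := ht1.frame hF2 (by decide) (by decide)
  refine Runs.seq (runs_keyLoop hE2 ht2 hmode hcur2.base) fun s₃ hF3 h29 => ?_
  have hE3 := hE2.frame hF3 (by decide) (by decide)
  have hc3 := hc2.frame hF3 (by decide) (by decide) (by decide)
  have ht3 := ht2.frame hF3 (by decide) (by decide)
  have h253 : s₃.reg 25 = s₂.reg 25 := hF3.reg 25 (by decide)
  rcases h25 with ⟨h25, hs⟩ | ⟨h25, hs⟩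
  · refine Runs.mono (Runs.ite_true (by simp [h253, h25])
      (runs_insert hE3 hc3 ht3 h29 hm hg ((hg k hk).ext hD hs))) le_rfl ?_
    rintro s' - ⟨c', h2, h3⟩
    exact ⟨c', h2, Or.inl ⟨hs, h3⟩⟩
  · exact Runs.mono (Runs.ite_false (by simp [h253, h25])
      (Runs.of_flat (T := 1) rfl (by decide) ⟨c, hc3, Or.inr ⟨hs, rfl⟩⟩))
      (by simp [Test.cost, NExpr.cost]; omega) fun _ _ h => h

end CycleInstance

namespace CycleInstance

open RealRAM CyclePlacement

attribute [local simp] NExpr.val RExpr.val Test.holds Prog.run Function.update_apply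

variable {n : ℕ}

/-! #### The search -/

/-- Load the entry number `14`. -/
def loadEntry : Prog :=
  .set 15 (.read 10 (.reg 14)) ;; .set 16 (.read 11 (.reg 14)) ;; .set 17 (.read 12 (.reg 14)) ;;
  .set 18 (.read 13 (.reg 14)) ;; .set 19 (.read 14 (.reg 14)) ;;
  .set 41 (.add (.read 15 (.reg 14)) (.lit 1)) ;; .set 35 (.read 1 (.reg 17))

theorem runs_loadEntry {D : Data n} {s : State} (hr : Rows n s) {k : ℕ} {t : Entry n}
    (ht : RepEntry D k t s) (h14 : s.reg 14 = k) (h37 : s.reg 37 = 2 * D.L)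
    (h28 : s.reg 28 = 2 * D.L + 3) : Runs loadEntry s 23 (Cur D k t) := by
  refine Runs.of_flat rfl (by decide) ⟨?_, ?_, ?_, ?_, ?_, ?_, ?_, ?_, ?_, ?_⟩ <;>
    simp [loadEntry, h14, h37, h28, ht.off, ht.p, ht.last, ht.start, ht.mode, ht.size,
      hr.row t.last t.last.2]

/-- Record the current entry if it is a complete solution. -/
def finalCheck : Prog :=
  .ite (.conj (.lt (.reg 0) (.reg 41))
      (.neg (.lt (.add (.reg 1) (.lit 1)) (.add (.read 2 (.add (.reg 35) (.reg 18))) (.reg 16)))))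
    (.set 21 (.add (.reg 14) (.lit 1))) .skip

theorem runs_finalCheck {D : Data n} {s : State} (hE : Env D s) {k : ℕ} {t : Entry n}
    (hc : Cur D k t s) : Runs finalCheck s 20 (fun s' => D.Final t ∧ s'.reg 21 = k + 1 ∨
      ¬ D.Final t ∧ s'.reg 21 = s.reg 21) := by
  have hle : t.size ≤ n := by
    simpa [Entry.size] using Finset.card_le_univ (Finset.univ.filter fun y => t.pos y ≠ 0)
  have h2 := hE.data.dc t.last t.start
  have hiff : (Test.conj (.lt (.reg 0) (.reg 41)) (.neg (.lt (.add (.reg 1) (.lit 1))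
      (.add (.read 2 (.add (.reg 35) (.reg 18))) (.reg 16))))).holds s ↔ D.Final t := by
    simp only [Test.holds, NExpr.val, hE.rows.size, hc.size, hE.N, hc.row, hc.start, h2, hc.p]
    constructor
    · rintro ⟨h3, h4⟩
      exact ⟨by omega, by omega⟩
    · rintro ⟨h3, h4⟩
      exact ⟨by omega, by omega⟩
  refine Runs.of_flat rfl (by decide) ?_
  by_cases hf : D.Final t
  · simp only [finalCheck, Prog.run, hiff, hf, if_true, NExpr.val, hc.idx, Function.update_self,
      true_and, true_or]
  · simp only [finalCheck, Prog.run, hiff, hf, if_false, not_false_eq_true, and_self, or_true]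

/-- The worklist `c₀` has been extended by those successors `(u, g)` of its entry number `k` that
satisfy `P`. -/
def Expanded (D : Data n) (c₀ : Config n) (k : ℕ) (P : Fin n → ℕ → Prop) (s : State) : Prop :=
  ∃ c, Rep D c s ∧ D.Inv k c ∧ k < c.m ∧ (∀ j ≤ k, c.ent j = c₀.ent j) ∧
    ∀ u g, P u g → D.Succ (c₀.ent k) u g → c.Cov D ((c₀.ent k).ext u g)

theorem Expanded.mono {D : Data n} {c₀ : Config n} {k : ℕ} {P P' : Fin n → ℕ → Prop} {s : State}
    (h : Expanded D c₀ k P s) (hP : ∀ u g, P' u g → D.Succ (c₀.ent k) u g → P u g) :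
    Expanded D c₀ k P' s := by
  obtain ⟨c, h1, h2, h3, h4, h5⟩ := h
  exact ⟨c, h1, h2, h3, h4, fun u g hp hs => h5 u g (hP u g hp hs) hs⟩

theorem Expanded.frame {D : Data n} {c₀ : Config n} {k : ℕ} {P : Fin n → ℕ → Prop} {p : Prog}
    {s s' : State} (h : Expanded D c₀ k P s) (hF : Frame p s s')
    (h1 : ∀ a ∈ [5, 6, 9, 10, 11, 12, 13, 14, 15], a ∉ p.wa) (h2 : 12 ∉ p.wr) (h3 : 13 ∉ p.wr) :
    Expanded D c₀ k P s' := by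
  obtain ⟨c, h4, h5⟩ := h
  exact ⟨c, h4.frame hF h1 h2 h3, h5⟩

theorem Expanded.update {D : Data n} {c₀ : Config n} {k : ℕ} {P : Fin n → ℕ → Prop} {s : State}
    (h : Expanded D c₀ k P s) {x v : ℕ} (h12 : 12 ≠ x) (h13 : 13 ≠ x) :
    Expanded D c₀ k P { s with reg := Function.update s.reg x v } := by
  obtain ⟨c, h4, h5⟩ := h
  exact ⟨c, h4.congr (fun _ _ => rfl) (by simp [h12]) (by simp [h13]), h5⟩

/-- Try the gap `23 + 1`. -/
def gapBody : Prog :=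
  .set 24 (.add (.reg 16) (.add (.reg 23) (.lit 1))) ;;
  .ite (.conj (.neg (.lt (.add (.reg 23) (.lit 1)) (.reg 38))) (.neg (.lt (.reg 1) (.reg 24))))
    tryCandidate .skip

theorem runs_gapBody {D : Data n} (hD : D.Proper) {s : State} (hE : Env D s) {c₀ : Config n}
    {k : ℕ} (hcur : Cur D k (c₀.ent k) s) {P : Fin n → ℕ → Prop} (hX : Expanded D c₀ k P s)
    {u : Fin n} {i : ℕ} (h22 : s.reg 22 = u) (h23 : s.reg 23 = i) (hi : i < D.L)
    (hu : (c₀.ent k).pos u = 0) (h38 : s.reg 38 = D.dc (c₀.ent k).last u) :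
    Runs gapBody s (n * (22 * D.L + 250) + 137)
      (Expanded D c₀ k fun u' g => P u' g ∨ (u' = u ∧ g = i + 1)) := by
  refine Runs.mono (Runs.seq (T₁ := 6) (T₂ := 11 + (n * (22 * D.L + 250) + 120))
    (Q₁ := fun s' => s'.reg 24 = (c₀.ent k).p + (i + 1)) (Runs.of_flat rfl (by decide)
      (by simp [hcur.p, h23])) fun s₁ hF1 h24 => ?_) (by omega) fun _ _ h => h
  have hE1 := hE.frame hF1 (by decide) (by decide)
  have hcur1 := hcur.frame hF1 (by decide)
  obtain ⟨c, hr, hI, hk, hold, hcov⟩ := hX.frame hF1 (by decide) (by decide) (by decide)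
  have h221 : s₁.reg 22 = u := (hF1.reg 22 (by decide)).trans h22
  have h231 : s₁.reg 23 = i := (hF1.reg 23 (by decide)).trans h23
  have h381 : s₁.reg 38 = D.dc (c₀.ent k).last u := (hF1.reg 38 (by decide)).trans h38
  have hck := hold k le_rfl
  refine Runs.ite (fun hb => ?_) fun hb => ?_
  · simp only [Test.holds, NExpr.val, h231, h381, hE1.N, h24, not_lt] at hb
    rw [← hck] at hcur1 hb h24 hu
    refine Runs.mono (runs_tryCandidate hD hE1 hr hI.lt_m (fun j hj => (hI.reach j hj).good hD) hk
      hcur1 h221 h24 hu (by omega) hi hb.1 hb.2) le_rfl ?_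
    rintro s' - ⟨c', hr', hc'⟩
    rcases hc' with ⟨hs, hins⟩ | ⟨hs, rfl⟩
    · obtain ⟨h1, h2, h3, h4, h5⟩ := hI.ins hk hs hins
      refine ⟨c', hr', h1, hk.trans_le h3, fun j hj => (h2 j hj).trans (hold j hj), ?_⟩
      rintro u' g (hp | ⟨rfl, rfl⟩) hs'
      · exact h4 _ (hcov u' g hp hs')
      · rwa [← hck]
    · refine ⟨c', hr', hI, hk, hold, ?_⟩
      rintro u' g (hp | ⟨rfl, rfl⟩) hs'
      · exact hcov u' g hp hs'
      · rw [← hck] at hs'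
        exact absurd hs' hs
  · simp only [Test.holds, NExpr.val, h231, h381, hE1.N, h24, not_lt] at hb
    refine Runs.of_flat (T := n * (22 * D.L + 250) + 120) rfl
      (by simp only [Prog.bound]; omega) ⟨c, hr, hI, hk, hold, ?_⟩
    rintro u' g (hp | ⟨rfl, rfl⟩) hs'
    · exact hcov u' g hp hs'
    · exact absurd ⟨hs'.dc, hs'.le_N⟩ hb

/-- Try all gaps for the vertex `22`. -/
def vertexBody : Prog :=
  .set 38 (.read 2 (.add (.reg 35) (.reg 22))) ;;
  .ite (.conj (.lt (.read 5 (.add (.reg 15) (.reg 22))) (.lit 1))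
    (.lt (.reg 38) (.add (.reg 3) (.lit 1)))) (.forTo 23 3 gapBody) .skip

/-- The cost is stated conditionally because only vertices within distance `L` of the last one cause
work; the sum over all vertices can then be bounded by the ball size instead of `n`. -/
theorem runs_vertexBody {D : Data n} (hD : D.Proper) {s : State} (hE : Env D s) {c₀ : Config n}
    {k : ℕ} (hcur : Cur D k (c₀.ent k) s) {P : Fin n → ℕ → Prop} (hX : Expanded D c₀ k P s)
    {u : Fin n} (h22 : s.reg 22 = u) :
    Runs vertexBody s (23 + if D.dc (c₀.ent k).last u ≤ D.L then
        D.L * (n * (22 * D.L + 250) + 144) else 0)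
      (Expanded D c₀ k fun u' g => P u' g ∨ u' = u) := by
  refine Runs.mono (Runs.seq (T₁ := 5) (T₂ := 12 + (5 + if D.dc (c₀.ent k).last u ≤ D.L then
      D.L * (n * (22 * D.L + 250) + 144) else 0))
    (Q₁ := fun s' => s'.reg 38 = D.dc (c₀.ent k).last u) (Runs.of_flat rfl (by decide)
      (by simp [hcur.row, h22, hE.data.dc])) fun s₁ hF1 h38 => ?_) (by omega) fun _ _ h => h
  have hE1 := hE.frame hF1 (by decide) (by decide)
  have hcur1 := hcur.frame hF1 (by decide)
  have hX1 := hX.frame hF1 (by decide) (by decide) (by decide)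
  have h221 : s₁.reg 22 = u := (hF1.reg 22 (by decide)).trans h22
  have hpos : s₁.arr 5 (k * n + u) = (c₀.ent k).pos u := by
    obtain ⟨c, hr, hI, hk, hold, hcov⟩ := hX1
    rw [(hr.ent k hk).pos, hold k le_rfl]
  refine Runs.ite (fun hb => ?_) fun hb => ?_
  · simp only [Test.holds, NExpr.val, h221, h38, hE1.L, hcur1.off, hpos, Nat.lt_add_one_iff,
      Nat.le_zero] at hb
    have := Runs.forTo_const (x := 23) (b := 3) (s := s₁) (p := gapBody)
      (fun i => Expanded D c₀ k fun u' g => P u' g ∨ (u' = u ∧ g ≤ i))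
      (n * (22 * D.L + 250) + 137) (by decide) (by decide) (by decide)
      (fun i s v h => h.update (by decide) (by decide))
      (hX1.mono fun u' g h hs => h.resolve_right fun h => by have := hs.one_le; omega)
      fun i s' hi hF h23 hX' => ?_
    · rw [hE1.L] at this
      rw [if_pos hb.2]
      refine Runs.mono this (by rw [add_assoc, add_comm]) fun s' _ h => h.mono fun u' g hp hs => ?_
      exact hp.imp_right fun h => ⟨h, hs.le⟩
    · rw [hE1.L] at hi
      refine Runs.mono (runs_gapBody hD (hE1.frame hF (by decide) (by decide))
        (hcur1.frame hF (by decide)) hX' ((hF.reg 22 (by decide)).trans h221) h23 hi hb.1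
        ((hF.reg 38 (by decide)).trans h38)) le_rfl fun s'' _ h => h.mono fun u' g hp _ => ?_
      rcases hp with hp | ⟨hp, hg⟩
      · exact Or.inl (Or.inl hp)
      · by_cases hgi : g = i + 1
        · exact Or.inr ⟨hp, hgi⟩
        · exact Or.inl (Or.inr ⟨hp, by omega⟩)
  · simp only [Test.holds, NExpr.val, h221, h38, hE1.L, hcur1.off, hpos, Nat.lt_add_one_iff,
      Nat.le_zero] at hb
    refine Runs.of_flat rfl (by simp only [Prog.bound]; omega) (hX1.mono fun u' g hp hs => ?_)
    rcases hp with hp | rfl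
    · exact hp
    · exact absurd ⟨hs.new, hs.dc.trans hs.le⟩ hb

theorem runs_expand {D : Data n} (hD : D.Proper) {s : State} (hE : Env D s) {c₀ : Config n}
    {k : ℕ} (hcur : Cur D k (c₀.ent k) s) (hr : Rep D c₀ s) (hI : D.Inv k c₀) (hk : k < c₀.m)
    {B : ℕ} (hB : ∀ v, D.ball v ≤ B) :
    Runs (.forTo 22 0 vertexBody) s (n * 30 + B * (D.L * (n * (22 * D.L + 250) + 144)) + 5)
      (Expanded D c₀ k fun _ _ => True) := by
  set c := D.L * (n * (22 * D.L + 250) + 144) with hc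
  have := Runs.forTo (x := 22) (b := 0) (s := s) (p := vertexBody)
    (fun j => Expanded D c₀ k fun u' _ => (u' : ℕ) < j)
    (fun j => 23 + if h : j < n then if D.dc (c₀.ent k).last ⟨j, h⟩ ≤ D.L then c else 0 else 0)
    (by decide) (by decide) (by decide) (fun i s v h => h.update (by decide) (by decide))
    ⟨c₀, hr, hI, hk, fun _ _ => rfl, fun u g h => by omega⟩ fun j s' hj hF h22 hX => ?_
  · rw [hE.rows.size] at this
    refine Runs.mono this ?_ fun s' _ h => h.mono fun u g _ _ => u.2
    rw [← Fin.sum_univ_eq_sum_range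
      (fun j => 23 + (if h : j < n then if D.dc (c₀.ent k).last ⟨j, h⟩ ≤ D.L then c else 0 else 0)
        + 7)]
    simp only [Fin.is_lt, dif_pos, Fin.eta, add_right_comm _ _ 7, Finset.sum_add_distrib,
      ← Finset.sum_filter, Finset.sum_const, Finset.card_univ, Fintype.card_fin, smul_eq_mul]
    -- The expensive rounds belong to a ball of radius `L`, contained in the tested ball of radius
    -- `L + 1`.
    have h1 : (Finset.univ.filter fun u => D.dc (c₀.ent k).last u ≤ D.L).card ≤ B :=
      le_trans (Finset.card_le_card fun u => by simpa using fun h => by omega)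
        (hB (c₀.ent k).last)
    have := Nat.mul_le_mul_right c h1
    omega
  · rw [hE.rows.size] at hj
    simp only [hj, dif_pos]
    refine Runs.mono (runs_vertexBody (u := ⟨j, hj⟩) hD (hE.frame hF (by decide) (by decide))
      (hcur.frame hF (by decide)) hX h22) le_rfl fun s'' _ h => h.mono fun u' g hp _ => ?_
    rcases Nat.lt_succ_iff_lt_or_eq.1 hp with h | h
    · exact Or.inl h
    · exact Or.inr (Fin.ext h)

/-- Process the entry number `14`. -/
def searchBody : Prog :=
  loadEntry ;; finalCheck ;; .forTo 22 0 vertexBody ;; .set 14 (.add (.reg 14) (.lit 1))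

/-- Process the worklist. -/
def search : Prog :=
  .set 14 (.lit 0) ;; .loop (.lt (.reg 14) (.reg 12)) searchBody

/-- Register `21` tells whether a complete solution is among the first `k` entries. -/
def Found (D : Data n) (c : Config n) (k : ℕ) (s : State) : Prop :=
  (s.reg 21 = 0 ∧ ∀ j < k, ¬ D.Final (c.ent j)) ∨ ∃ j < k, s.reg 21 = j + 1 ∧ D.Final (c.ent j)

theorem runs_searchBody {D : Data n} (hD : D.Proper) {s : State} (hE : Env D s) {c : Config n}
    {k : ℕ} (h14 : s.reg 14 = k) (h37 : s.reg 37 = 2 * D.L) (h28 : s.reg 28 = 2 * D.L + 3)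
    (hr : Rep D c s) (hI : D.Inv k c) (hf : Found D c k s) (hk : k < c.m) {B : ℕ}
    (hB : ∀ v, D.ball v ≤ B) :
    Runs searchBody s (n * 30 + B * (D.L * (n * (22 * D.L + 250) + 144)) + 52)
      (fun s' => s'.reg 14 = k + 1 ∧ ∃ c', Rep D c' s' ∧ D.Inv (k + 1) c' ∧
        Found D c' (k + 1) s') := by
  refine Runs.mono (Runs.seq (T₂ := 20 + ((n * 30 + B * (D.L * (n * (22 * D.L + 250) + 144)) + 5)
    + 4)) (runs_loadEntry hE.rows (hr.ent k hk) h14 h37 h28) fun s₁ hF1 hc1 => ?_) (by omega)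
    fun _ _ h => h
  have hE1 := hE.frame hF1 (by decide) (by decide)
  refine Runs.seq (runs_finalCheck hE1 hc1) fun s₂ hF2 h21 => ?_
  have hE2 := hE1.frame hF2 (by decide) (by decide)
  have hc2 := hc1.frame hF2 (by decide)
  have hr2 := (hr.frame hF1 (by decide) (by decide) (by decide)).frame hF2 (by decide) (by decide)
    (by decide)
  refine Runs.seq (runs_expand hD hE2 hc2 hr2 hI hk hB) fun s₃ hF3 ⟨c', h1, h2, h3, h4, h5⟩ => ?_
  have h143 : s₃.reg 14 = k := (hF3.reg 14 (by decide)).trans hc2.idx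
  have h213 : s₃.reg 21 = s₂.reg 21 := hF3.reg 21 (by decide)
  refine Runs.of_flat rfl (by decide) ⟨by simp [h143], c',
    h1.congr (fun _ _ => rfl) (by simp) (by simp), h2.next h3 fun u g hs => ?_, ?_⟩
  · rw [h4 k le_rfl] at hs ⊢
    exact h5 u g trivial hs
  · rw [hF1.reg 21 (by decide)] at h21
    unfold Found at hf ⊢
    simp only [Prog.run, Function.update_apply, h213, show (21 : ℕ) ≠ 14 by decide, if_false]
    rcases h21 with ⟨h6, h7⟩ | ⟨h6, h7⟩
    · exact Or.inr ⟨k, by omega, by simpa using h7, by rwa [h4 k le_rfl]⟩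
    · rcases hf with ⟨h8, h9⟩ | ⟨j, hj, h8, h9⟩
      · refine Or.inl ⟨by simpa using h7.trans h8, fun j hj => ?_⟩
        rw [h4 j (by omega)]
        rcases Nat.lt_succ_iff_lt_or_eq.1 hj with h | rfl
        · exact h9 j h
        · exact h6
      · exact Or.inr ⟨j, by omega, by simpa using h7.trans h8, by rwa [h4 j (by omega)]⟩

/-- The list grows during the loop, but `Data.Inv.m_le` bounds its length at all times and so bounds
the number of rounds. -/
theorem runs_search {D : Data n} (hD : D.Proper) {s : State} (hE : Env D s)
    (h37 : s.reg 37 = 2 * D.L) (h28 : s.reg 28 = 2 * D.L + 3) (h21 : s.reg 21 = 0)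
    (hr : Rep D ⟨n + 1, D.startEntry⟩ s) {B : ℕ} (hB : ∀ v, D.ball v ≤ B) :
    Runs search s ((n + 1 + Fintype.card (Code n D.L B)) *
        (n * 30 + B * (D.L * (n * (22 * D.L + 250) + 144)) + 55) + 5)
      (fun s' => ∃ c, Rep D c s' ∧ D.Inv c.m c ∧ Found D c c.m s') := by
  refine Runs.mono (Runs.seq (T₁ := 2) (Q₁ := fun s' => s'.reg 14 = 0)
    (Runs.of_flat rfl (by decide) (by simp)) fun s₁ hF1 h14 => Runs.loop
      (fun k s' => s'.reg 14 = k ∧ ∃ c, Rep D c s' ∧ D.Inv k c ∧ Found D c k s')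
      (fun _ => n * 30 + B * (D.L * (n * (22 * D.L + 250) + 144)) + 52)
      (n + 1 + Fintype.card (Code n D.L B)) ?_ fun k s' hF ⟨h1, c, h2, h3, h4⟩ hb => ?_) ?_ ?_
  · refine ⟨h14, _, hr.frame hF1 (by decide) (by decide) (by decide),
      D.inv_zero rfl fun _ _ => rfl, Or.inl ⟨(hF1.reg 21 (by decide)).trans h21, by simp⟩⟩
  · simp only [Test.holds, NExpr.val, h1, h2.m] at hb
    exact ⟨hb.trans_le (h3.m_le hD hB), runs_searchBody hD
      ((hE.frame hF1 (by decide) (by decide)).frame hF (by decide) (by decide)) h1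
      ((hF.reg 37 (by decide)).trans ((hF1.reg 37 (by decide)).trans h37))
      ((hF.reg 28 (by decide)).trans ((hF1.reg 28 (by decide)).trans h28)) h2 h3 h4 hb hB⟩
  · simp only [Finset.sum_const, Finset.card_range, smul_eq_mul, Test.cost, NExpr.cost, add_assoc,
      Nat.reduceAdd]
    omega
  · rintro s' - ⟨k, -, ⟨h1, c, h2, h3, h4⟩, hn⟩
    simp only [Test.holds, NExpr.val, h1, h2.m] at hn
    obtain rfl : k = c.m := le_antisymm h3.k_le (not_lt.1 hn)
    exact ⟨c, h2, h3, h4⟩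

/-- Output the solution found. -/
def output : Prog :=
  .ite (.lt (.lit 0) (.reg 21))
    (.set 15 (.read 10 (.sub (.reg 21) (.lit 1))) ;;
      .forTo 27 0 (.write 0 (.reg 27) (.sub (.read 5 (.add (.reg 15) (.reg 27))) (.lit 1))) ;;
      .set 0 (.lit 1))
    (.set 0 (.lit 0))

theorem runs_output {D : Data n} {s : State} (hE : Env D s) {c : Config n} (hr : Rep D c s)
    (hf : Found D c c.m s) : Runs output s (n * 15 + 15) (fun s' =>
      (s'.reg 0 = 1 ∧ ∃ j < c.m, D.Final (c.ent j) ∧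
        ∀ y : Fin n, s'.arr 0 y = (c.ent j).pos y - 1) ∨
      (s'.reg 0 = 0 ∧ ∀ j < c.m, ¬ D.Final (c.ent j))) := by
  rcases hf with ⟨h1, h2⟩ | ⟨j, hj, h1, h2⟩
  · refine Runs.mono (Runs.ite_false (by simp [h1]) (Runs.of_flat (T := 2) rfl (by decide)
      (Or.inr ⟨by simp, h2⟩))) (by simp [Test.cost, NExpr.cost]) fun _ _ h => h
  have hent := hr.ent j hj
  refine Runs.mono (Runs.ite_true (by simp [h1]) (Runs.seq (T₁ := 5) (T₂ := (n * 15 + 5) + 2)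
    (Q₁ := fun s' => s'.reg 15 = j * n) (Runs.of_flat rfl (by decide) (by simp [h1, hent.off]))
    fun s₁ hF1 h15 => Runs.seq (Q₁ := fun s' => ∀ y : Fin n, s'.arr 0 y = (c.ent j).pos y - 1) ?_
      fun s₂ hF2 h3 => Runs.of_flat rfl (by decide) (Or.inl ⟨by simp, j, hj, h2, h3⟩)))
    (by simp [Test.cost, NExpr.cost]; omega) fun _ _ h => h
  have hr1 := hE.rows.frame hF1 (by decide) (by decide)
  have := Runs.forTo_const (x := 27) (b := 0) (s := s₁)
    (p := .write 0 (.reg 27) (.sub (.read 5 (.add (.reg 15) (.reg 27))) (.lit 1)))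
    (fun i s' => ∀ y : Fin n, (y : ℕ) < i → s'.arr 0 y = (c.ent j).pos y - 1) 8
    (by decide) (by decide) (by decide) (fun i s v h => h) (fun y hy => by omega)
    fun i s' hi hF h27 h3 => ?_
  · rw [hr1.size] at this
    exact Runs.mono this le_rfl fun s' _ h y => h y y.2
  · rw [hr1.size] at hi
    have h15' : s'.reg 15 = j * n := (hF.reg 15 (by decide)).trans h15
    have hp := hent.pos ⟨i, hi⟩
    rw [← hF1.arr 5 (by decide), ← hF.arr 5 (by decide)] at hp
    dsimp only at hp
    refine Runs.of_flat rfl (by decide) fun y hy => ?_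
    by_cases hc : (y : ℕ) = i
    · rw [show y = ⟨i, hi⟩ from Fin.ext hc]
      simp [h27, h15', hp]
    · simpa [h27, hc] using h3 y (by omega)

end CycleInstance

/-! ### The complete algorithm and its time bound -/

namespace CycleInstance

open RealRAM CyclePlacement

attribute [local simp] NExpr.val RExpr.val Test.holds Prog.run Function.update_apply

variable {I : CycleInstance}

/-- Compute the integer data and test the sizes of the balls. -/
def prepare : Prog :=
  initRows ;; maxWeight ;; bounds ;; distInit ;; distLoop ;; .forMat roundStep ;; ballTest

/-- The time needed by `prepare`. -/
def prepareTime (n d R : ℕ) : ℕ :=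
  (n * 14 + 7) + ((n * (n * 18 + 15) + 7) + ((d * 11 + 12 * R + n * 11 + 22) +
    ((n * (n * 31 + 15) + 5) + ((n * (n * (n * 34 + 15) + 15) + 5) +
    ((n * (n * (12 * (n * (R + 1)) + d * 15 + 12 * R + 57) + 15) + 5) +
    (d * 17 + n * (n * 33 + 27) + 14))))))

theorem runs_prepare (I : CycleInstance) {R : ℕ} (hL : I.data.L ≤ R) (hM : I.M ≤ R + 1) :
    Runs prepare I.input (prepareTime I.n I.d R) (fun s => Env I.data s ∧ (∀ x, s.arr 9 x = 0) ∧
      ((s.reg 9 = 0 ∧ ∀ v, I.data.ball v ≤ I.d * (2 * (I.data.L + 1)) + 1) ∨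
      (s.reg 9 = 1 ∧ ∃ v, I.d * (2 * (I.data.L + 1)) + 1 < I.data.ball v))) := by
  refine Runs.mono (Q := fun s => Env I.data s ∧
      ((s.reg 9 = 0 ∧ ∀ v, I.data.ball v ≤ I.d * (2 * (I.data.L + 1)) + 1) ∨
      (s.reg 9 = 1 ∧ ∃ v, I.d * (2 * (I.data.L + 1)) + 1 < I.data.ball v))) ?_ le_rfl
    fun s hF h => ⟨h.1, fun x => (congrFun (hF.arr 9 (by decide)) x).trans (I.inp_input.seen x),
      h.2⟩
  have h0 := I.inp_input
  refine Runs.seq (runs_initRows h0.n) fun s₁ hF1 hr1 => ?_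
  have h1 := h0.frame hF1 (by decide) (by decide) (by decide) (by decide) (by decide)
  refine Runs.seq (runs_maxWeight h1 hr1) fun s₂ hF2 hM2 => ?_
  have h2 := h1.frame hF2 (by decide) (by decide) (by decide) (by decide) (by decide)
  have hr2 := hr1.frame hF2 (by decide) (by decide)
  refine Runs.seq (runs_bounds h2 hM2 hL) fun s₃ hF3 ⟨hL3, hM3⟩ => ?_
  have h3 := h2.frame hF3 (by decide) (by decide) (by decide) (by decide) (by decide)
  have hr3 := hr2.frame hF3 (by decide) (by decide)
  refine Runs.seq (runs_distInit h3 hr3 hM3) fun s₄ hF4 hA4 => ?_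
  have h4 := h3.frame hF4 (by decide) (by decide) (by decide) (by decide) (by decide)
  have hr4 := hr3.frame hF4 (by decide) (by decide)
  refine Runs.seq (runs_distLoop hr4 hA4) fun s₅ hF5 hA5 => ?_
  have h5 := h4.frame hF5 (by decide) (by decide) (by decide) (by decide) (by decide)
  have hr5 := hr4.frame hF5 (by decide) (by decide)
  refine Runs.seq (runs_round h5 hr5 hA5 hL hM) fun s₆ hF6 hD6 => ?_
  have h6 := h5.frame hF6 (by decide) (by decide) (by decide) (by decide) (by decide)
  have hr6 := hr5.frame hF6 (by decide) (by decide)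
  exact runs_ballTest hr6 hD6 h6.N ((hF6.reg 3 (by decide)).trans ((hF5.reg 3 (by decide)).trans
    ((hF4.reg 3 (by decide)).trans hL3))) h6.d

/-- The complete algorithm. -/
def solve : Prog :=
  prepare ;; .ite (.lt (.reg 9) (.lit 1)) (startList ;; search ;; output) (.set 0 (.lit 0))

/-- The time needed by the search, if all balls have size at most `B`. -/
def searchTime (n L B : ℕ) : ℕ :=
  ((n + 1) * (n * 38 + 67) + 29) + (((n + 1 + Fintype.card (Code n L B)) *
    (n * 30 + B * (L * (n * (22 * L + 250) + 144)) + 55) + 5) + (n * 15 + 15))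

theorem isAnswer_of_final {s : State} {t : Entry I.n} (ht : I.data.Good t) (hf : I.data.Final t)
    (h0 : s.reg 0 = 1) (ha : ∀ y : Fin I.n, s.arr 0 y = t.pos y - 1) : I.IsAnswer s := by
  have hsol := ht.isSol I.data_proper (by have := I.three_le_N; exact (by omega : 1 ≤ I.N)) hf
  exact Or.inl ⟨h0, fun v => ⟨t.pos v - 1, hsol.lt v⟩, fun v => ha v, (I.isSolution_iff _).2 hsol⟩

/-- A ball that is too large excludes a solution by `ball_card_le`, so rejecting at once is correct.
Otherwise the tested bound is the `B` that limits keys and candidates. -/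
theorem runs_solve (I : CycleInstance) {R : ℕ} (hL : I.data.L ≤ R) (hM : I.M ≤ R + 1) :
    Runs solve I.input (prepareTime I.n I.d R +
      (3 + searchTime I.n I.data.L (I.d * (2 * (I.data.L + 1)) + 1))) I.IsAnswer := by
  refine Runs.seq (runs_prepare I hL hM) fun s₁ _ ⟨hE, h9, hball⟩ => ?_
  rcases hball with ⟨h, hB⟩ | ⟨h, v, hv⟩
  · refine Runs.ite_true (by simp [h]) (Runs.seq (runs_startList hE rfl h9)
      fun s₂ hF2 ⟨hr2, h37, h28, h21⟩ => ?_)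
    have hE2 := hE.frame hF2 (by decide) (by decide)
    refine Runs.seq (runs_search I.data_proper hE2 h37 h28 h21 hr2 hB)
      fun s₃ hF3 ⟨c, hr3, hI, hf⟩ => ?_
    refine Runs.mono (runs_output (hE2.frame hF3 (by decide) (by decide)) hr3 hf) le_rfl ?_
    rintro s - (⟨h0, j, hj, hfin, ha⟩ | ⟨h0, hno⟩)
    · exact isAnswer_of_final ((hI.reach j hj).good I.data_proper) hfin h0 ha
    · refine Or.inr ⟨h0, fun ⟨F, hF⟩ => ?_⟩
      obtain ⟨j, hj, hfin⟩ := hI.exists_final I.data_proper I.two_le_n ((I.isSolution_iff F).1 hF)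
      exact hno j hj hfin
  · refine Runs.mono (Runs.ite_false (by simp [h]) (Runs.of_flat (T := 2) rfl (by decide)
      (Or.inr ⟨by simp, fun ⟨F, hF⟩ => absurd (I.ball_card_le hF v) (not_le.2 hv)⟩))) ?_
      fun _ _ h => h
    simp only [Test.cost, NExpr.cost, searchTime]
    omega

/-! #### The running time -/

/-- With X = 4R(2R + 2), each window contributes at most X^R choices and the boundary at most
(RX)^(2R). Together this is R^(2R) X^(4R), the core of the running time. -/
theorem card_code_le {n L R B : ℕ} (hn : 1 ≤ n) (hR : 1 ≤ R) (hL : L ≤ R)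
    (hB : B ≤ R * (2 * (R + 1)) + 1) : Fintype.card (Code n L B) ≤
      4 * (n ^ 2 * R * (R ^ (2 * R) * (4 * R * (2 * R + 2)) ^ (4 * R))) := by
  set X := 4 * R * (2 * R + 2) with hX
  have h1 : B + 1 ≤ X := by nlinarith
  have h2 : 2 * (L * B) + 1 ≤ R * X := by
    have : L * B ≤ R * (R * (2 * (R + 1)) + 1) := Nat.mul_le_mul hL hB
    nlinarith [Nat.mul_le_mul hR hR]
  have h3 : n * L + 1 ≤ 2 * (n * R) := by
    have := Nat.mul_le_mul_left n hL
    have := Nat.mul_le_mul hn hR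
    omega
  have hX1 : 1 ≤ X := by omega
  have h4 : (B + 1) ^ L ≤ X ^ R := (Nat.pow_le_pow_left h1 L).trans (Nat.pow_le_pow_right hX1 hL)
  have h5 : (2 * (L * B) + 1) ^ (2 * L) ≤ (R * X) ^ (2 * R) :=
    (Nat.pow_le_pow_left h2 _).trans (Nat.pow_le_pow_right (Nat.mul_pos hR hX1) (by omega))
  rw [card_code]
  clear_value X
  calc 2 * ((n * L + 1) * (n * ((B + 1) ^ L * ((B + 1) ^ L * (2 * (L * B) + 1) ^ (2 * L)))))
      ≤ 2 * ((2 * (n * R)) * (n * (X ^ R * (X ^ R * (R * X) ^ (2 * R))))) := by gcongr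
    _ = 4 * (n ^ 2 * R * (R ^ (2 * R) * X ^ (4 * R))) := by
      rw [mul_pow, show X ^ (4 * R) = X ^ R * (X ^ R * X ^ (2 * R)) by
        rw [← pow_add, ← pow_add]; congr 1; ring]
      ring

theorem prepareTime_le {n d R : ℕ} (hn : 1 ≤ n) (hR : 1 ≤ R) (hd : d ≤ R) :
    prepareTime n d R ≤ 600 * (n ^ 3 * R) := by
  have h : ∀ a b, a ≤ 3 → b ≤ 1 → n ^ a * R ^ b ≤ n ^ 3 * R ^ 1 := fun a b ha hb =>
    Nat.mul_le_mul (Nat.pow_le_pow_right hn ha) (Nat.pow_le_pow_right hR hb)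
  have hd2 : n ^ 2 * d ≤ n ^ 2 * R := Nat.mul_le_mul_left _ hd
  have h00 := h 0 0 (by omega) (by omega)
  have h10 := h 1 0 (by omega) (by omega)
  have h20 := h 2 0 (by omega) (by omega)
  have h30 := h 3 0 (by omega) (by omega)
  have h01 := h 0 1 (by omega) (by omega)
  have h21 := h 2 1 (by omega) (by omega)
  unfold prepareTime
  linarith

/-- There are O(n²RW) entries. Each tries O(R²) vertices with at most R gaps at cost O(nR), that is
O(nR⁴). -/
theorem searchTime_le {n L R B : ℕ} (hn : 1 ≤ n) (hR : 1 ≤ R) (hL : L ≤ R)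
    (hB : B ≤ R * (2 * (R + 1)) + 1) : searchTime n L B ≤
      14000 * (n ^ 3 * R ^ 5 * (R ^ (2 * R) * (4 * R * (2 * R + 2)) ^ (4 * R))) := by
  have hcard := card_code_le hn hR hL hB
  set W := R ^ (2 * R) * (4 * R * (2 * R + 2)) ^ (4 * R) with hW
  have hW1 : 1 ≤ W := Nat.mul_pos (by positivity) (by positivity)
  have hp : ∀ a b, a ≤ 3 → b ≤ 5 → n ^ a * R ^ b ≤ n ^ 3 * R ^ 5 * W := fun a b ha hb =>
    (Nat.mul_le_mul (Nat.pow_le_pow_right hn ha) (Nat.pow_le_pow_right hR hb)).trans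
      (Nat.le_mul_of_pos_right _ hW1)
  have h1 : n + 1 + Fintype.card (Code n L B) ≤ 6 * (n ^ 2 * R * W) := by
    have h2 : n * 1 ≤ n ^ 2 * (R * W) :=
      Nat.mul_le_mul (Nat.le_self_pow (by omega) n) (Nat.mul_pos hR hW1)
    rw [← mul_assoc] at h2
    omega
  have h2 : n * 30 + B * (L * (n * (22 * L + 250) + 144)) + 55 ≤ 2165 * (n * R ^ 4) := by
    have hq : ∀ b, b ≤ 4 → n * R ^ b ≤ n * R ^ 4 := fun b hb =>
      Nat.mul_le_mul_left _ (Nat.pow_le_pow_right hR hb)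
    have h3 : B ≤ 5 * R ^ 2 := by nlinarith
    have h4 : L * (n * (22 * L + 250) + 144) ≤ R * (n * (416 * R)) := by
      refine Nat.mul_le_mul hL ?_
      nlinarith [Nat.mul_le_mul hn hR, Nat.mul_le_mul_left n hL]
    have h5 := Nat.mul_le_mul h3 h4
    have h6 := hq 0 (by omega)
    nlinarith
  have h3 := Nat.mul_le_mul h1 h2
  have h00 := hp 0 0 (by omega) (by omega)
  have h10 := hp 1 0 (by omega) (by omega)
  have h20 := hp 2 0 (by omega) (by omega)
  have h4 : 6 * (n ^ 2 * R * W) * (2165 * (n * R ^ 4)) = 12990 * (n ^ 3 * R ^ 5 * W) := by ring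
  unfold searchTime
  linarith

theorem time_le {n d L R : ℕ} (hn : 1 ≤ n) (hR : 1 ≤ R) (hd : d ≤ R) (hL : L ≤ R) :
    prepareTime n d R + (3 + searchTime n L (d * (2 * (L + 1)) + 1)) ≤
      15000 * (n ^ 3 * (R ^ (2 * R + 3) * (4 * R * (2 * R + 2)) ^ (4 * R + 4))) := by
  have h1 := prepareTime_le hn hR hd
  have h2 := searchTime_le hn hR hL (show d * (2 * (L + 1)) + 1 ≤ R * (2 * (R + 1)) + 1 by gcongr)
  set X := 4 * R * (2 * R + 2) with hX
  set W := R ^ (2 * R) * X ^ (4 * R) with hW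
  -- Of the factor R⁵ the target keeps R³; the remaining R² is absorbed by the additional X⁴.
  have hRX : R ^ 2 ≤ X ^ 4 := by
    have : R ≤ X := by nlinarith
    exact (Nat.pow_le_pow_left this 2).trans (Nat.pow_le_pow_right (by omega) (by omega))
  have hW1 : 1 ≤ W := Nat.mul_pos (by positivity) (by positivity)
  have hn1 : 1 ≤ n ^ 3 * R ^ 5 := Nat.mul_pos (by positivity) (by positivity)
  have hn2 : n ^ 3 * R ≤ n ^ 3 * R ^ 5 := Nat.mul_le_mul_left _ (Nat.le_self_pow (by omega) R)
  have h3 := Nat.mul_le_mul_left (n ^ 3 * R ^ 5) hW1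
  have h4 : n ^ 3 * R ^ 5 * W ≤ n ^ 3 * (R ^ (2 * R + 3) * X ^ (4 * R + 4)) := by
    have : n ^ 3 * R ^ 3 * W * R ^ 2 ≤ n ^ 3 * R ^ 3 * W * X ^ 4 := Nat.mul_le_mul_left _ hRX
    calc n ^ 3 * R ^ 5 * W = n ^ 3 * R ^ 3 * W * R ^ 2 := by ring
      _ ≤ n ^ 3 * R ^ 3 * W * X ^ 4 := this
      _ = _ := by rw [hW, pow_add, pow_add]; ring
  omega

/-- The algorithm solves every instance in time bounded by a function of `R` times `n ^ 3`. -/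
theorem exec_solve (I : CycleInstance) {R : ℕ} (hd : I.d ≤ R) (hL : I.data.L ≤ R)
    (hM : I.M ≤ R + 1) : ∃ t s, Exec solve I.input t s ∧ I.IsAnswer s ∧
      t ≤ 15000 * (I.n ^ 3 * (R ^ (2 * R + 3) * (4 * R * (2 * R + 2)) ^ (4 * R + 4))) := by
  obtain ⟨t, s, he, ht, ha⟩ := runs_solve I hL hM
  exact ⟨t, s, he, ha, ht.trans (time_le (by have := I.two_le_n; omega)
    (I.d_pos.trans_le hd) hd hL)⟩

end CycleInstance

/-! ### The two running time claims -/

theorem pow_le_rpow_of_le {a b y : ℝ} {m : ℕ} (h1 : 1 ≤ a) (hab : a ≤ b) (hm : (m : ℝ) ≤ y) :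
    a ^ m ≤ b ^ y := by
  rw [← Real.rpow_natCast]
  exact (Real.rpow_le_rpow (by linarith) hab (Nat.cast_nonneg m)).trans
    (Real.rpow_le_rpow_of_exponent_le (h1.trans hab) hm)

theorem mainTheorem6 :
    (∃ (p : RealRAM.Prog) (K : ℝ), ∀ I : CycleInstance, 1 ≤ I.M →
      ∃ (t : ℕ) (s : RealRAM.State), RealRAM.Exec p I.input t s ∧ I.IsAnswer s ∧
        (t : ℝ) ≤ K * ((I.n : ℝ) ^ 3 * (I.d * I.M) ^ (2 * (I.d * I.M) + 3) *
          (4 * (I.d * I.M) * (2 * (I.d * I.M) + 2)) ^ (4 * (I.d * I.M) + 4))) ∧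
    IsFPT (fun I => ∃ F : Fin I.n → Fin I.N, I.IsSolution F) (fun I => (I.d, ⌈I.M⌉₊)) := by
  refine ⟨⟨CycleInstance.solve, 15000, fun I hM => ?_⟩, CycleInstance.solve,
    fun a => 15000 * ((a.1 * a.2) ^ (2 * (a.1 * a.2) + 3) *
      (4 * (a.1 * a.2) * (2 * (a.1 * a.2) + 2)) ^ (4 * (a.1 * a.2) + 4)), 3, ?_, fun I => ?_⟩
  · have hd1 : (1 : ℝ) ≤ I.d := by exact_mod_cast I.d_pos
    have hdM : (I.d : ℝ) ≤ I.d * I.M := le_mul_of_one_le_right (by linarith) hM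
    have hfl : (I.data.L : ℝ) ≤ I.d * I.M := Nat.floor_le (by linarith)
    -- Here 1 ≤ M enters: it gives `d ≤ L`, so the general bound can be evaluated at R = L, the
    -- integer part of dM.
    have hd : I.d ≤ I.data.L := Nat.le_floor hdM
    obtain ⟨t, s, he, ha, ht⟩ := I.exec_solve hd le_rfl
      ((le_mul_of_one_le_left (by linarith) hd1).trans (Nat.lt_floor_add_one (I.d * I.M)).le)
    refine ⟨t, s, he, ha, ?_⟩
    set R := I.data.L
    set x : ℝ := I.d * I.M
    have hR1 : (1 : ℝ) ≤ R := by exact_mod_cast I.d_pos.trans_le hd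
    have h1 : (R : ℝ) ^ (2 * R + 3) ≤ x ^ (2 * x + 3) :=
      pow_le_rpow_of_le hR1 hfl (by push_cast; linarith)
    have h2 : (4 * (R : ℝ) * (2 * R + 2)) ^ (4 * R + 4) ≤ (4 * x * (2 * x + 2)) ^ (4 * x + 4) :=
      pow_le_rpow_of_le (by nlinarith) (by gcongr) (by push_cast; linarith)
    calc (t : ℝ) ≤ 15000 * ((I.n : ℝ) ^ 3 * ((R : ℝ) ^ (2 * R + 3) *
          (4 * (R : ℝ) * (2 * R + 2)) ^ (4 * R + 4))) := by exact_mod_cast ht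
      _ ≤ 15000 * ((I.n : ℝ) ^ 3 * (x ^ (2 * x + 3) * (4 * x * (2 * x + 2)) ^ (4 * x + 4))) := by
        gcongr
      _ = _ := by ring
  · refine Primrec.to_comp ?_
    have h1 : Primrec fun a : ℕ × ℕ => a.1 * a.2 := Primrec.nat_mul
    have hpow : Primrec₂ ((· ^ ·) : ℕ → ℕ → ℕ) := Primrec₂.unpaired'.1 Nat.Primrec.pow
    have hl : ∀ k m : ℕ, Primrec fun a : ℕ × ℕ => k * (a.1 * a.2) + m := fun k m =>
      Primrec.nat_add.comp (Primrec.nat_mul.comp (Primrec.const k) h1) (Primrec.const m)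
    exact Primrec.nat_mul.comp (Primrec.const _) (Primrec.nat_mul.comp
      (hpow.comp h1 (hl 2 3)) (hpow.comp
      (Primrec.nat_mul.comp (hl 4 0) (hl 2 2)) (hl 4 4)))
  · have hd1 : (1 : ℝ) ≤ I.d := by exact_mod_cast I.d_pos
    have hM0 := I.M_pos
    have hceil := Nat.le_ceil I.M
    have hm : 1 ≤ ⌈I.M⌉₊ := Nat.one_le_ceil_iff.2 hM0
    -- Small M may make `L` smaller than `d`, even 0. Rounding M up keeps `d ≤ R` and `1 ≤ R` and
    -- makes R a function of the parameter.
    obtain ⟨t, s, he, ha, ht⟩ := I.exec_solve (R := I.d * ⌈I.M⌉₊) (Nat.le_mul_of_pos_right _ hm)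
      (Nat.floor_le_of_le (by push_cast; gcongr))
      (by push_cast; nlinarith)
    refine ⟨t, s, he, ?_, ?_⟩
    · rcases ha with ⟨h0, F, -, hF⟩ | h
      · exact Or.inl ⟨h0, F, hF⟩
      · exact Or.inr h
    · refine ht.trans (le_of_eq ?_)
      dsimp only
      ring
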